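/- Fix integers $p,q\ge 2$. For $\beta>0$, $h\in\mathbb R$ and $N\ge 1$ let $\mathbb P_{\beta,h,N}$ be the probability measure on $[q]^N$ with $$\mathbb P_{\beta,h,N}(X)\;\propto\;\exp\Big(\beta N\sum_{r=1}^q \bar X_{\cdot r}^{\,p}+Nh\bar X_{\cdot 1}\Big),\qquad \bar X_{\cdot r}=\frac1N\#\{i:X_i=r\}.$$ With $\beta$ known, let $\hat h_N$ be the maximum likelihood estimate of $h$, i.e. a maximizer over $h'\in\mathbb R$ of $h'\mapsto \mathbb P_{\beta,h',N}(X)$, with any real value assigned to $\hat h_N$ at samples where no maximizer exists. On the probability vectors $t\in\mathbb R^q$ let $H_{\beta,h}(t)=\beta\sum_r t_r^p+ht_1-\sum_r t_r\log t_r$. For $s\in[0,1)$ put $x_s=\big(\tfrac{1+(q-1)s}{q},\tfrac{1-s}{q},\dots,\tfrac{1-s}{q}\big)$ and $f_{\beta,h}(s)=H_{\beta,h}(x_s)$, and let $u=(1-q,1,\dots,1)$. A point $(\beta,h)\in(0,\infty)\times[0,\infty)$ is *special* if $H_{\beta,h}$ has a unique global maximizer $m_*$ and the quadratic form $Q(t)=\sum_r\big(\beta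 p(p-1)m_{*,r}^{p-2}-1/m_{*,r}\big)t_r^2$, restricted to $\{t\in\mathbb R^q:\sum_r t_r=0\}$, is singular (has nontrivial kernel). A special point whose maximizer is $m_*=x_s$ with $s\in[0,1)$ is of *type I* if $f^{(4)}_{\beta,h}(s)<0$, and of *type II* if $f^{(4)}_{\beta,h}(s)=0$. **Theorem.** Let $(\beta,h)$ be special and $X\sim\mathbb P_{\beta,h,N}$. 1. If $(\beta,h)$ is of type I with $m_*=x_s$, then, as $N\to\infty$, $N^{3/4}(\hat h_N-h)$ converges in distribution to a non-Gaussian probability law on $\mathbb R$ with distribution function $$G_1(t)=R_{0,0}\Big(-\int_{-\infty}^\infty y\,dR_{0,t}(y)\Big),\qquad t\in\mathbb R,$$ where $R_{\bar\beta,\bar h}$ is the distribution function of the random variable $T_{\bar\beta,\bar h}$ whose density at $x$ is proportional to $$\exp\Big(\tfrac{x^4}{24}\,q^4 f^{(4)}_{\beta,h}(s)+\big(\bar\beta p\textstyle\sum_r m_{*,r}^{p-1}u_r+\bar h(1-q)\big)x\Big).$$ 2. If $(\beta,h)$ is of type II, then, as $N\to\infty$, $N^{5/6}(\hat h_N-h)$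 converges in distribution to a non-Gaussian probability law on $\mathbb R$ with distribution function $$G_2(t)=H_0\Big(-\int_{-\infty}^\infty y\,dH_t(y)\Big),\qquad t\in\mathbb R,$$ where $H_{\bar h}$ is the distribution function of the random variable $F_{\bar h}$ whose density at $x$ is proportional to $\exp\big(-\tfrac{32}{15}x^6-\bar h x\big)$. -/

import Mathlib

open MeasureTheory ProbabilityTheory Filter Topology

noncomputable section

namespace TensorPotts

/-- Fraction of the `N` sites that carry the color `r`; the colors are `Fin q`, and the
distinguished first color is `0`. -/
def magnetization {q N : ℕ} (x : Fin N → Fin q) (r : Fin q) : ℝ :=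
  (∑ i : Fin N, if x i = r then (1 : ℝ) else 0) / N

/-- Unnormalized weight `exp (β N ∑ᵣ X̄ᵣ ^ p + N h X̄₁)` of a configuration. -/
def weight (p q : ℕ) [NeZero q] (β h : ℝ) (N : ℕ) (x : Fin N → Fin q) : ℝ :=
  Real.exp (β * N * ∑ r, magnetization x r ^ p + N * h * magnetization x 0)

/-- The normalizing constant of the model. -/
def partitionSum (p q : ℕ) [NeZero q] (β h : ℝ) (N : ℕ) : ℝ :=
  ∑ x : Fin N → Fin q, weight p q β h N x

/-- Probability of the configuration `x`; as a function of the parameters, the likelihood. -/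
def prob (p q : ℕ) [NeZero q] (β h : ℝ) (N : ℕ) (x : Fin N → Fin q) : ℝ :=
  weight p q β h N x / partitionSum p q β h N

lemma partitionSum_pos (p q : ℕ) [NeZero q] (β h : ℝ) (N : ℕ) :
    0 < partitionSum p q β h N :=
  Finset.sum_pos (fun _ _ => Real.exp_pos _) Finset.univ_nonempty

lemma sum_prob (p q : ℕ) [NeZero q] (β h : ℝ) (N : ℕ) :
    ∑ x : Fin N → Fin q, ENNReal.ofReal (prob p q β h N x) = 1 := by
  have hnn : ∀ x : Fin N → Fin q, 0 ≤ prob p q β h N x := fun x =>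
    div_nonneg (Real.exp_pos _).le (partitionSum_pos p q β h N).le
  rw [← ENNReal.ofReal_sum_of_nonneg (fun x _ => hnn x)]
  have hs : ∑ x : Fin N → Fin q, prob p q β h N x = 1 := by
    unfold prob
    rw [← Finset.sum_div]
    exact div_self (partitionSum_pos p q β h N).ne'
  rw [hs, ENNReal.ofReal_one]

/-- The `p`-tensor Curie-Weiss Potts model on `[q]^N`, as a probability mass function. -/
def pottsPMF (p q : ℕ) [NeZero q] (β h : ℝ) (N : ℕ) : PMF (Fin N → Fin q) :=
  PMF.ofFintype (fun x => ENNReal.ofReal (prob p q β h N x)) (sum_prob p q β h N)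

/-- The `p`-tensor Curie-Weiss Potts model on `[q]^N`, as a measure. -/
def pottsMeasure (p q : ℕ) [NeZero q] (β h : ℝ) (N : ℕ) : Measure (Fin N → Fin q) :=
  (pottsPMF p q β h N).toMeasure

instance (p q : ℕ) [NeZero q] (β h : ℝ) (N : ℕ) :
    IsProbabilityMeasure (pottsMeasure p q β h N) := by
  unfold pottsMeasure
  infer_instance

/-- `h'` is a maximum likelihood estimate of the field parameter from the sample `x`, when `β` is
known: it maximizes the likelihood over the whole real line. -/
def IsMLE (p q : ℕ) [NeZero q] (β : ℝ) (N : ℕ) (x : Fin N → Fin q) (h' : ℝ) : Prop :=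
  ∀ h'' : ℝ, prob p q β h'' N x ≤ prob p q β h' N x

/-- The negative free energy `H_{β,h}`. -/
def freeEnergy (p q : ℕ) [NeZero q] (β h : ℝ) (t : Fin q → ℝ) : ℝ :=
  β * ∑ r, t r ^ p + h * t 0 - ∑ r, t r * Real.log (t r)

/-- `m` is a global maximizer of `H_{β,h}` on the set of probability vectors. -/
def IsGlobalMaximizer (p q : ℕ) [NeZero q] (β h : ℝ) (m : Fin q → ℝ) : Prop :=
  m ∈ stdSimplex ℝ (Fin q) ∧ IsMaxOn (freeEnergy p q β h) (stdSimplex ℝ (Fin q)) m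

/-- The symmetric bilinear form of the quadratic form
`Q_{s,β}(t) = ∑ᵣ (β p (p - 1) sᵣ ^ (p - 2) - 1 / sᵣ) tᵣ ^ 2`. -/
def hessForm (p q : ℕ) (β : ℝ) (s t v : Fin q → ℝ) : ℝ :=
  ∑ r, (β * p * (p - 1) * s r ^ (p - 2) - 1 / s r) * t r * v r

/-- `Q_{s,β}` is singular on the hyperplane of vectors with coordinate sum `0`: its restriction to
that hyperplane has a nontrivial kernel. -/
def IsSingularOnHyperplane (p q : ℕ) (β : ℝ) (s : Fin q → ℝ) : Prop :=
  ∃ t : Fin q → ℝ, t ≠ 0 ∧ ∑ r, t r = 0 ∧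
    ∀ v : Fin q → ℝ, ∑ r, v r = 0 → hessForm p q β s t v = 0

/-- `(β, h)` is a special point of the parameter space `(0, ∞) × [0, ∞)`. -/
def IsSpecial (p q : ℕ) [NeZero q] (β h : ℝ) : Prop :=
  0 < β ∧ 0 ≤ h ∧ ∃ m : Fin q → ℝ, IsGlobalMaximizer p q β h m ∧
    (∀ m' : Fin q → ℝ, IsGlobalMaximizer p q β h m' → m' = m) ∧
    IsSingularOnHyperplane p q β m

/-- The vector `x_s = ((1 + (q - 1) s) / q, (1 - s) / q, …, (1 - s) / q)`. -/
def xvec (q : ℕ) [NeZero q] (s : ℝ) : Fin q → ℝ :=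
  fun r => if r = 0 then (1 + ((q : ℝ) - 1) * s) / q else (1 - s) / q

/-- The function `f_{β,h}(s) = H_{β,h}(x_s)`. -/
def fline (p q : ℕ) [NeZero q] (β h : ℝ) (s : ℝ) : ℝ :=
  freeEnergy p q β h (xvec q s)

/-- `(β, h)` is special, and the maximizer `x_s` satisfies `f_{β,h}⁗(s) < 0`. -/
def IsTypeISpecial (p q : ℕ) [NeZero q] (β h : ℝ) : Prop :=
  IsSpecial p q β h ∧ ∃ s ∈ Set.Ico (0 : ℝ) 1,
    IsGlobalMaximizer p q β h (xvec q s) ∧ iteratedDeriv 4 (fline p q β h) s < 0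

/-- `(β, h)` is special, and the maximizer `x_s` satisfies `f_{β,h}⁗(s) = 0`. -/
def IsTypeIISpecial (p q : ℕ) [NeZero q] (β h : ℝ) : Prop :=
  IsSpecial p q β h ∧ ∃ s ∈ Set.Ico (0 : ℝ) 1,
    IsGlobalMaximizer p q β h (xvec q s) ∧ iteratedDeriv 4 (fline p q β h) s = 0

/-- The vector `u = (1 - q, 1, …, 1)`. -/
def uvec (q : ℕ) [NeZero q] : Fin q → ℝ :=
  fun r => if r = 0 then 1 - (q : ℝ) else 1

/-- The law of `T_{β̄,h̄}`: its density at `x` is proportional to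
`exp (x ^ 4 / 24 * q ^ 4 * f_{β,h}⁗(s) + (β̄ p ⟨x_s ^ (p - 1), u⟩ + h̄ (1 - q)) x)`. -/
def quarticLaw (p q : ℕ) [NeZero q] (β h s βbar hbar : ℝ) : Measure ℝ :=
  volume.tilted fun x =>
    x ^ 4 / 24 * (q : ℝ) ^ 4 * iteratedDeriv 4 (fline p q β h) s
      + (βbar * p * ∑ r, xvec q s r ^ (p - 1) * uvec q r + hbar * (1 - (q : ℝ))) * x

/-- The law of `F_{h̄}`: its density at `x` is proportional to `exp (-(32 / 15) x ^ 6 - h̄ x)`. -/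
def sexticLaw (hbar : ℝ) : Measure ℝ :=
  volume.tilted fun x => -(32 / 15) * x ^ 6 - hbar * x

end TensorPotts

end

/-! The log-likelihood in the field has derivative proportional to `magnetization x 0` minus its
mean, and that mean is strictly increasing in the field. Hence, when color 0 is neither absent nor
universal, `hhat ≤ h'` holds exactly when `magnetization x 0` is at most its mean under `h'`. So the
law of the estimate is determined by two limits: that of the rescaled magnetization `fluct` under
`h`, and that of its mean under the shifted field `h + t N^(-(1 - 1/(2k)))`. The shift tilts the
model by `exp ((1 - q) t W)`, where `W` is `fluct`, up to a constant factor. Both limits therefore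
follow once expectations of smooth functions of `W` of exponential growth converge to those under
`evenLaw c k`, with density proportional to `exp (-c x^(2k))`. This is `FluctConverges`.

That convergence is proved by Stein's method. Detailed balance for recoloring one site yields an
exact identity (`pottsMean_flow_identity`). Up to errors of higher order it says that the Stein
operator `φ' - 2kc x^(2k-1) φ` has mean zero at `W` (`stein_remainder_le`,
`exists_abs_pottsMean_sub_le`). The errors are controlled by exponential moments. A count of types
and a Jensen lower bound for the partition sum give `E exp (N * deficit) ≤ (N+1)^q`
(`pottsMean_exp_deficit_le`), where the deficit is the gap of the free energy to its maximum. Taking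
a small power makes the polynomial factor negligible against the gain `N^(-1/(2k))`.

Two analytic inputs on the free energy enter: the deficit dominates `axisCoord^(2k) + transverseSq`
(`exists_coercive`), and the drift equals `-2kc m₁ axisCoord^(2k-1)` up to that same quantity, with
`m₁ = (1-s)/q` (`exists_drift_bound`). At a special point the derivatives of `fline` of orders 1, 2,
3 vanish (`singular_consequences` and parity at a maximum), so type I has `k = 2`. If the fourth
vanishes too, so does the fifth, and eliminating among the equations of orders 2 to 5 leaves only `p
= 4`, `q = 2`, `s = 0`, `β = 2/3` (`degenerate_parameters`). There the sixth derivative is `-24`, so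
`k = 3` and `c = 32/15`.

The limit is not Gaussian because its upper tail is too heavy: integration by parts keeps the tilted
mean from growing fast, and a Gaussian tail would force that mean to stay bounded
(`ne_gaussianReal_of_tiltMean`). -/

noncomputable section
namespace TensorPotts

/-! ### Functions of exponential growth against even-power weights -/

/-- At most exponential growth. -/
def ExpGrowth (f : ℝ → ℝ) : Prop := ∃ K : ℝ, 0 ≤ K ∧ ∀ x, |f x| ≤ K * Real.exp (K * |x|)

lemma ExpGrowth.of_le {f g : ℝ → ℝ} (hg : ExpGrowth g) (h : ∀ x, |f x| ≤ |g x|) :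
    ExpGrowth f := by
  obtain ⟨K, hK, hb⟩ := hg
  exact ⟨K, hK, fun x => (h x).trans (hb x)⟩

lemma expGrowth_const (a : ℝ) : ExpGrowth fun _ => a :=
  ⟨|a|, abs_nonneg a, fun x => le_mul_of_one_le_right (abs_nonneg a)
    (Real.one_le_exp (by positivity))⟩

lemma expGrowth_exp_mul (a : ℝ) : ExpGrowth fun x => Real.exp (a * x) := by
  refine ⟨1 + |a|, by positivity, fun x => ?_⟩
  rw [abs_of_pos (Real.exp_pos _)]
  have h1 : a * x ≤ (1 + |a|) * |x| := by
    have := le_abs_self (a * x)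
    rw [abs_mul] at this
    nlinarith [abs_nonneg x]
  have h2 := Real.exp_le_exp.2 h1
  have h3 := Real.exp_pos ((1 + |a|) * |x|)
  nlinarith [abs_nonneg a]

lemma expGrowth_id : ExpGrowth fun x => x := by
  refine ⟨1, zero_le_one, fun x => ?_⟩
  rw [one_mul, one_mul]
  linarith [Real.add_one_le_exp |x|]

lemma ExpGrowth.add {f g : ℝ → ℝ} (hf : ExpGrowth f) (hg : ExpGrowth g) :
    ExpGrowth fun x => f x + g x := by
  obtain ⟨K, hK, hb⟩ := hf
  obtain ⟨L, hL, hc⟩ := hg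
  refine ⟨K + L, by positivity, fun x => ?_⟩
  have h1 : Real.exp (K * |x|) ≤ Real.exp ((K + L) * |x|) :=
    Real.exp_le_exp.2 (by nlinarith [abs_nonneg x])
  have h2 : Real.exp (L * |x|) ≤ Real.exp ((K + L) * |x|) :=
    Real.exp_le_exp.2 (by nlinarith [abs_nonneg x])
  calc |f x + g x| ≤ |f x| + |g x| := abs_add_le _ _
    _ ≤ K * Real.exp (K * |x|) + L * Real.exp (L * |x|) := add_le_add (hb x) (hc x)
    _ ≤ K * Real.exp ((K + L) * |x|) + L * Real.exp ((K + L) * |x|) := by gcongr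
    _ = _ := by ring

lemma ExpGrowth.mul {f g : ℝ → ℝ} (hf : ExpGrowth f) (hg : ExpGrowth g) :
    ExpGrowth fun x => f x * g x := by
  obtain ⟨K, hK, hb⟩ := hf
  obtain ⟨L, hL, hc⟩ := hg
  refine ⟨K + L + K * L, by positivity, fun x => ?_⟩
  have h1 : Real.exp (K * |x|) * Real.exp (L * |x|) ≤ Real.exp ((K + L + K * L) * |x|) := by
    rw [← Real.exp_add]
    exact Real.exp_le_exp.2 (by nlinarith [abs_nonneg x, mul_nonneg (mul_nonneg hK hL) (abs_nonneg x)])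
  calc |f x * g x| = |f x| * |g x| := abs_mul _ _
    _ ≤ (K * Real.exp (K * |x|)) * (L * Real.exp (L * |x|)) :=
        mul_le_mul (hb x) (hc x) (abs_nonneg _) (by positivity)
    _ = (K * L) * (Real.exp (K * |x|) * Real.exp (L * |x|)) := by ring
    _ ≤ (K * L) * Real.exp ((K + L + K * L) * |x|) := by gcongr
    _ ≤ (K + L + K * L) * Real.exp ((K + L + K * L) * |x|) := by gcongr; linarith

lemma ExpGrowth.neg {f : ℝ → ℝ} (hf : ExpGrowth f) : ExpGrowth fun x => -f x :=
  hf.of_le fun _ => (abs_neg _).le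

lemma ExpGrowth.sub {f g : ℝ → ℝ} (hf : ExpGrowth f) (hg : ExpGrowth g) :
    ExpGrowth fun x => f x - g x := by
  simpa only [sub_eq_add_neg] using hf.add hg.neg

lemma ExpGrowth.const_mul {f : ℝ → ℝ} (a : ℝ) (hf : ExpGrowth f) :
    ExpGrowth fun x => a * f x := (expGrowth_const a).mul hf

lemma ExpGrowth.abs {f : ℝ → ℝ} (hf : ExpGrowth f) : ExpGrowth fun x => |f x| :=
  hf.of_le fun _ => (abs_abs _).le

lemma expGrowth_pow (n : ℕ) : ExpGrowth fun x => x ^ n := by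
  induction n with
  | zero => simpa using expGrowth_const 1
  | succ n ih => simpa only [pow_succ] using ih.mul expGrowth_id

lemma expGrowth_exp_abs (a : ℝ) : ExpGrowth fun x => Real.exp (a * |x|) := by
  refine ⟨1 + |a|, by positivity, fun x => ?_⟩
  rw [abs_of_pos (Real.exp_pos _)]
  have h1 : a * |x| ≤ (1 + |a|) * |x| := by
    nlinarith [abs_nonneg x, le_abs_self a]
  have h2 := Real.exp_le_exp.2 h1
  have h3 := Real.exp_pos ((1 + |a|) * |x|)
  nlinarith [abs_nonneg a]

lemma le_one_add_even_pow {k : ℕ} (hk : 2 ≤ k) (y : ℝ) : y ^ 4 ≤ 1 + y ^ (2 * k) := by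
  have h0 : y ^ 4 = |y| ^ 4 := by rw [← abs_pow, abs_of_nonneg (by positivity)]
  have h1 : y ^ (2 * k) = |y| ^ (2 * k) := by
    rw [← abs_pow, abs_of_nonneg (by rw [pow_mul]; positivity)]
  rw [h0, h1]
  rcases le_total |y| 1 with h | h
  · have := pow_le_one₀ (n := 4) (abs_nonneg y) h
    have := pow_nonneg (abs_nonneg y) (2 * k)
    linarith
  · have := pow_le_pow_right₀ h (show 4 ≤ 2 * k by omega)
    linarith

/-- Combines `K|y| ≤ K² + y²`, `2y² ≤ c y⁴ + 1/c` and `y⁴ ≤ 1 + y^(2k)`. The leftover `-y²` provides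
a Gaussian majorant for integrability. -/
lemma exists_linear_sub_even_pow_le {c : ℝ} (hc : 0 < c) {k : ℕ} (hk : 2 ≤ k) (K : ℝ) :
    ∃ C, ∀ y : ℝ, K * |y| - c * y ^ (2 * k) ≤ C - y ^ 2 := by
  refine ⟨K ^ 2 + 1 / c + c, fun y => ?_⟩
  have h1 := le_one_add_even_pow hk y
  have h2 : c * y ^ 4 ≤ c * (1 + y ^ (2 * k)) := by gcongr
  have h3 : K * |y| ≤ K ^ 2 + y ^ 2 := by
    nlinarith [sq_nonneg (K - |y|), sq_abs y, sq_nonneg K, sq_nonneg y]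
  have h4 : 2 * y ^ 2 ≤ c * y ^ 4 + 1 / c := by
    have h := mul_nonneg hc.le (sq_nonneg (y ^ 2 - 1 / c))
    have e : c * (y ^ 2 - 1 / c) ^ 2 = c * y ^ 4 - 2 * y ^ 2 + 1 / c := by field_simp; ring
    rw [e] at h; linarith
  linarith

lemma integrable_mul_exp_neg_even_pow {c : ℝ} (hc : 0 < c) {k : ℕ} (hk : 2 ≤ k) {f : ℝ → ℝ}
    (hf : Continuous f) (hg : ExpGrowth f) :
    Integrable fun y => f y * Real.exp (-(c * y ^ (2 * k))) := by
  obtain ⟨K, hK, hb⟩ := hg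
  obtain ⟨C, hC⟩ := exists_linear_sub_even_pow_le hc hk K
  have hG : Integrable fun y : ℝ => K * Real.exp C * Real.exp (-1 * y ^ 2) :=
    (integrable_exp_neg_mul_sq one_pos).const_mul _
  refine hG.mono' (by fun_prop) (ae_of_all _ fun y => ?_)
  rw [Real.norm_eq_abs, abs_mul, abs_of_pos (Real.exp_pos _)]
  calc |f y| * Real.exp (-(c * y ^ (2 * k)))
      ≤ K * Real.exp (K * |y|) * Real.exp (-(c * y ^ (2 * k))) := by gcongr; exact hb y
    _ = K * Real.exp (K * |y| - c * y ^ (2 * k)) := by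
        rw [mul_assoc, ← Real.exp_add, sub_eq_add_neg]
    _ ≤ K * Real.exp (C - y ^ 2) := mul_le_mul_of_nonneg_left (Real.exp_le_exp.2 (hC y)) hK
    _ = _ := by rw [mul_assoc, ← Real.exp_add]; congr 2; ring

/-! ### The even-power law and its Stein equation -/

/-- The probability law on the line with density proportional to `exp (-c x ^ (2 k))`. -/
def evenLaw (c : ℝ) (k : ℕ) : Measure ℝ := volume.tilted fun x => -(c * x ^ (2 * k))

section evenLaw
variable {c : ℝ} {k : ℕ}

lemma integrable_exp_neg_even_pow (hc : 0 < c) (hk : 2 ≤ k) :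
    Integrable fun y : ℝ => Real.exp (-(c * y ^ (2 * k))) := by
  simpa using integrable_mul_exp_neg_even_pow hc hk continuous_const (expGrowth_const 1)

lemma isProbabilityMeasure_evenLaw (hc : 0 < c) (hk : 2 ≤ k) :
    IsProbabilityMeasure (evenLaw c k) :=
  isProbabilityMeasure_tilted (integrable_exp_neg_even_pow hc hk)

lemma integral_exp_neg_even_pow_pos (hc : 0 < c) (hk : 2 ≤ k) :
    0 < ∫ y : ℝ, Real.exp (-(c * y ^ (2 * k))) :=
  integral_exp_pos (integrable_exp_neg_even_pow hc hk)

lemma integral_evenLaw (f : ℝ → ℝ) :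
    ∫ x, f x ∂(evenLaw c k) =
      (∫ x, f x * Real.exp (-(c * x ^ (2 * k)))) / ∫ y : ℝ, Real.exp (-(c * y ^ (2 * k))) := by
  rw [evenLaw, integral_tilted, ← integral_div]
  congr 1; ext x
  rw [smul_eq_mul]; ring

lemma integrable_evenLaw (hc : 0 < c) (hk : 2 ≤ k) {f : ℝ → ℝ} (hf : Continuous f)
    (hg : ExpGrowth f) : Integrable f (evenLaw c k) := by
  rw [evenLaw, integrable_tilted_iff (integrable_exp_neg_even_pow hc hk)]
  have := integrable_mul_exp_neg_even_pow hc hk hf hg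
  refine this.congr (ae_of_all _ fun x => ?_)
  simp only [smul_eq_mul]; ring

lemma integral_centered (hc : 0 < c) (hk : 2 ≤ k) {g : ℝ → ℝ} (hg : Continuous g)
    (hgg : ExpGrowth g) :
    ∫ y, (g y - ∫ z, g z ∂(evenLaw c k)) * Real.exp (-(c * y ^ (2 * k))) = 0 := by
  simp_rw [sub_mul]
  rw [integral_sub (integrable_mul_exp_neg_even_pow hc hk hg hgg)
    ((integrable_exp_neg_even_pow hc hk).const_mul _), integral_const_mul, integral_evenLaw,
    div_mul_cancel₀ _ (integral_exp_neg_even_pow_pos hc hk).ne', sub_self]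

/-- The sign condition says that `y` lies beyond `w`, away from the origin. Then the cross term in
`y² = (w + (y - w))²` is nonnegative, and `k`-th powers are superadditive on nonnegative reals. -/
lemma even_pow_add_le {k : ℕ} (hk : k ≠ 0) {w y : ℝ} (h : 0 ≤ w * (y - w)) :
    w ^ (2 * k) + (y - w) ^ (2 * k) ≤ y ^ (2 * k) := by
  rw [pow_mul, pow_mul, pow_mul]
  refine (pow_add_pow_le (sq_nonneg w) (sq_nonneg (y - w)) hk).trans ?_
  refine pow_le_pow_left₀ (by positivity) ?_ _
  nlinarith

/-- Beyond `w`, the weight at `y` is at most the weight at `w` times the weight at `y - w`, by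
`even_pow_add_le`. The blow-up `exp (c w^(2k))` is thus cancelled exactly and only the factor `exp
(K|w|)` coming from `f` survives. This keeps the Stein solution of exponential growth. -/
lemma abs_setIntegral_tail_le (hc : 0 < c) (hk : 2 ≤ k) {f : ℝ → ℝ} (hf : Continuous f)
    {K : ℝ} (hK : 0 ≤ K) (hb : ∀ x, |f x| ≤ K * Real.exp (K * |x|)) (w : ℝ) {S : Set ℝ}
    (hS : MeasurableSet S) (h : ∀ y ∈ S, 0 ≤ w * (y - w)) :
    Real.exp (c * w ^ (2 * k)) * |∫ y in S, f y * Real.exp (-(c * y ^ (2 * k)))| ≤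
      (K * ∫ y, Real.exp (K * |y|) * Real.exp (-(c * y ^ (2 * k)))) * Real.exp (K * |w|) := by
  have hint := integrable_mul_exp_neg_even_pow hc hk hf ⟨K, hK, hb⟩
  have hE := integrable_mul_exp_neg_even_pow hc hk (f := fun y => Real.exp (K * |y|))
    (by fun_prop) (expGrowth_exp_abs K)
  set V : ℝ → ℝ := fun y => Real.exp (K * |y|) * Real.exp (-(c * y ^ (2 * k))) with hV
  have hVs : Integrable fun y => V (y - w) := hE.comp_sub_right w
  have hVn : ∀ y, 0 ≤ V y := fun y => by positivity
  have key : ∀ y ∈ S, Real.exp (c * w ^ (2 * k)) * |f y * Real.exp (-(c * y ^ (2 * k)))| ≤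
      K * Real.exp (K * |w|) * V (y - w) := by
    intro y hy
    have h1 := even_pow_add_le (k := k) (by omega) (h y hy)
    have h2 : |y| ≤ |w| + |y - w| := by
      have := abs_add_le w (y - w); rwa [add_sub_cancel] at this
    rw [abs_mul, abs_of_pos (Real.exp_pos _)]
    calc Real.exp (c * w ^ (2 * k)) * (|f y| * Real.exp (-(c * y ^ (2 * k))))
        ≤ Real.exp (c * w ^ (2 * k)) * ((K * Real.exp (K * |y|)) *
            Real.exp (-(c * y ^ (2 * k)))) := by gcongr; exact hb y
      _ = K * Real.exp (c * w ^ (2 * k) + K * |y| - c * y ^ (2 * k)) := by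
          rw [sub_eq_add_neg, Real.exp_add, Real.exp_add]; ring
      _ ≤ K * Real.exp (K * |w| + (K * |y - w| + -(c * (y - w) ^ (2 * k)))) := by
          have h3 : c * (w ^ (2 * k) + (y - w) ^ (2 * k)) ≤ c * y ^ (2 * k) := by gcongr
          have h4 : K * |y| ≤ K * (|w| + |y - w|) := by gcongr
          gcongr; linarith
      _ = _ := by rw [Real.exp_add, Real.exp_add, hV]; ring
  calc Real.exp (c * w ^ (2 * k)) * |∫ y in S, f y * Real.exp (-(c * y ^ (2 * k)))|
      ≤ Real.exp (c * w ^ (2 * k)) * ∫ y in S, |f y * Real.exp (-(c * y ^ (2 * k)))| := by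
        gcongr; exact abs_integral_le_integral_abs
    _ = ∫ y in S, Real.exp (c * w ^ (2 * k)) * |f y * Real.exp (-(c * y ^ (2 * k)))| :=
        (integral_const_mul _ _).symm
    _ ≤ ∫ y in S, K * Real.exp (K * |w|) * V (y - w) :=
        setIntegral_mono_on (hint.abs.const_mul _).integrableOn (hVs.const_mul _).integrableOn
          hS key
    _ ≤ ∫ y, K * Real.exp (K * |w|) * V (y - w) :=
        setIntegral_le_integral (hVs.const_mul _) (ae_of_all _ fun y => by
          have := hVn (y - w); positivity)
    _ = _ := by
        rw [integral_const_mul, integral_sub_right_eq_self V w]; ring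

lemma hasDerivAt_setIntegral_Iic {F : ℝ → ℝ} (hF : Continuous F) (hi : Integrable F) (w : ℝ) :
    HasDerivAt (fun w => ∫ y in Set.Iic w, F y) (F w) w := by
  have h1 : (fun w => ∫ y in Set.Iic w, F y) =
      fun w => (∫ y in Set.Iic 0, F y) + ∫ y in (0 : ℝ)..w, F y := by
    ext w
    rw [← intervalIntegral.integral_Iic_sub_Iic hi.integrableOn hi.integrableOn]; ring
  rw [h1]
  exact (intervalIntegral.integral_hasDerivAt_right (hF.intervalIntegrable _ _)
    (hF.stronglyMeasurableAtFilter _ _) hF.continuousAt).const_add _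

/-- Solution of the Stein equation of `evenLaw c k`, with two derivatives of exponential growth. -/
theorem exists_stein_solution (hc : 0 < c) (hk : 2 ≤ k) {g g' : ℝ → ℝ}
    (hg : ∀ x, HasDerivAt g (g' x) x) (hgg : ExpGrowth g) (hgg' : ExpGrowth g') :
    ∃ φ φ₁ φ₂ : ℝ → ℝ, (∀ x, HasDerivAt φ (φ₁ x) x) ∧ (∀ x, HasDerivAt φ₁ (φ₂ x) x) ∧
      ExpGrowth φ ∧ ExpGrowth φ₁ ∧ ExpGrowth φ₂ ∧
      ∀ x, φ₁ x - 2 * k * c * x ^ (2 * k - 1) * φ x = g x - ∫ y, g y ∂(evenLaw c k) := by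
  have hgc : Continuous g := continuous_iff_continuousAt.2 fun x => (hg x).continuousAt
  set g₀ : ℝ → ℝ := fun x => g x - ∫ y, g y ∂(evenLaw c k) with hg₀
  have hg₀c : Continuous g₀ := by fun_prop
  have hg₀g : ExpGrowth g₀ := hgg.sub (expGrowth_const _)
  have hg₀d : ∀ x, HasDerivAt g₀ (g' x) x := fun x => (hg x).sub_const _
  set F : ℝ → ℝ := fun y => g₀ y * Real.exp (-(c * y ^ (2 * k))) with hF
  have hFc : Continuous F := by fun_prop
  have hFi : Integrable F := integrable_mul_exp_neg_even_pow hc hk hg₀c hg₀g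
  have hF0 : ∫ y, F y = 0 := integral_centered hc hk hgc hgg
  set φ : ℝ → ℝ := fun w => Real.exp (c * w ^ (2 * k)) * ∫ y in Set.Iic w, F y with hφ
  set V' : ℝ → ℝ := fun x => 2 * k * c * x ^ (2 * k - 1) with hV'
  set V'' : ℝ → ℝ := fun x => 2 * k * c * ((2 * k - 1 : ℕ) * x ^ (2 * k - 1 - 1)) with hV''
  have hV'g : ExpGrowth V' := (expGrowth_pow _).const_mul _
  have hV''g : ExpGrowth V'' := ((expGrowth_pow _).const_mul _).const_mul _
  have hV'd : ∀ x, HasDerivAt V' (V'' x) x := fun x => (hasDerivAt_pow _ x).const_mul _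
  have hφg : ExpGrowth φ := by
    obtain ⟨K, hK, hb⟩ := hg₀g
    have hJ : 0 ≤ K * ∫ y, Real.exp (K * |y|) * Real.exp (-(c * y ^ (2 * k))) :=
      mul_nonneg hK (integral_nonneg fun y => by positivity)
    refine ((expGrowth_exp_abs K).const_mul
      (K * ∫ y, Real.exp (K * |y|) * Real.exp (-(c * y ^ (2 * k))))).of_le fun w => ?_
    rw [abs_of_nonneg (mul_nonneg hJ (Real.exp_pos _).le), hφ]
    simp only []
    rw [abs_mul, abs_of_pos (Real.exp_pos _)]
    -- Because `F` has total integral zero, the integral up to `w` is minus the integral past `w`.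
    -- For either sign of `w` one can therefore integrate over the side pointing away from the
    -- origin.
    rcases le_total 0 w with hw | hw
    · have e : ∫ y in Set.Iic w, F y = -∫ y in Set.Ioi w, F y := by
        have := intervalIntegral.integral_Iic_add_Ioi (b := w) hFi.integrableOn hFi.integrableOn
        rw [hF0] at this; linarith
      rw [e, abs_neg]
      exact abs_setIntegral_tail_le hc hk hg₀c hK hb w measurableSet_Ioi fun y hy =>
        mul_nonneg hw (sub_nonneg.2 (le_of_lt hy))
    · exact abs_setIntegral_tail_le hc hk hg₀c hK hb w measurableSet_Iic fun y hy =>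
        mul_nonneg_of_nonpos_of_nonpos hw (sub_nonpos.2 hy)
  have hφd : ∀ x, HasDerivAt φ (V' x * φ x + g₀ x) x := by
    intro x
    have h1 : HasDerivAt (fun w : ℝ => Real.exp (c * w ^ (2 * k)))
        (Real.exp (c * x ^ (2 * k)) * V' x) x := by
      have := ((hasDerivAt_pow (2 * k) x).const_mul c).exp
      convert this using 1
      rw [hV']; push_cast; ring
    have h2 := h1.mul (hasDerivAt_setIntegral_Iic hFc hFi x)
    refine h2.congr_deriv ?_
    have e : Real.exp (c * x ^ (2 * k)) * F x = g₀ x := by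
      rw [hF]; simp only []
      rw [mul_left_comm, ← Real.exp_add, add_neg_cancel, Real.exp_zero, mul_one]
    rw [e, hφ]; ring
  -- The equation expresses both derivatives of `φ` through `φ`, `g₀` and `g'`, so their growth
  -- follows from that of `φ`.
  have hφ₁g : ExpGrowth fun x => V' x * φ x + g₀ x := (hV'g.mul hφg).add hg₀g
  refine ⟨φ, fun x => V' x * φ x + g₀ x,
    fun x => V'' x * φ x + V' x * (V' x * φ x + g₀ x) + g' x, hφd,
    fun x => ((hV'd x).mul (hφd x)).add (hg₀d x), hφg, hφ₁g,
    ((hV''g.mul hφg).add (hV'g.mul hφ₁g)).add hgg', fun x => ?_⟩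
  ring

end evenLaw
-- Exponential tilts of the even-power law
section evenLaw
variable {c : ℝ} {k : ℕ}

lemma evenLaw_real_apply (hc : 0 < c) (hk : 2 ≤ k) (S : Set ℝ) :
    (evenLaw c k).real S =
      (∫ y in S, Real.exp (-(c * y ^ (2 * k)))) / ∫ y : ℝ, Real.exp (-(c * y ^ (2 * k))) := by
  have hZ := integral_exp_neg_even_pow_pos hc hk
  rw [Measure.real, evenLaw, tilted_apply_eq_ofReal_integral, integral_div,
    ENNReal.toReal_ofReal (div_nonneg (integral_nonneg fun _ => (Real.exp_pos _).le) hZ.le)]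

lemma evenLaw_real_Iic_neg (hc : 0 < c) (hk : 2 ≤ k) (x : ℝ) :
    (evenLaw c k).real (Set.Iic (-x)) = (evenLaw c k).real (Set.Ici x) := by
  rw [evenLaw_real_apply hc hk, evenLaw_real_apply hc hk, integral_Ici_eq_integral_Ioi]
  congr 1
  have := integral_comp_neg_Iic (-x) fun y : ℝ => Real.exp (-(c * y ^ (2 * k)))
  rw [neg_neg] at this
  rw [← this]
  simp_rw [Even.neg_pow (even_two_mul k)]

lemma integral_comp_neg_evenLaw (f : ℝ → ℝ) :
    ∫ x, f (-x) ∂(evenLaw c k) = ∫ x, f x ∂(evenLaw c k) := by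
  rw [integral_evenLaw, integral_evenLaw]
  congr 1
  rw [← integral_neg_eq_self]
  simp_rw [neg_neg, Even.neg_pow (even_two_mul k)]

lemma nullSingletonClass_evenLaw : NullSingletonClass (evenLaw c k) :=
  ⟨fun x => tilted_absolutelyContinuous _ _ (by simp)⟩

lemma integrableExpSet_evenLaw (hc : 0 < c) (hk : 2 ≤ k) :
    integrableExpSet id (evenLaw c k) = Set.univ := by
  ext t
  simp only [integrableExpSet, Set.mem_ofPred_eq, Set.mem_univ, iff_true]
  exact integrable_evenLaw hc hk (f := fun x => Real.exp (t * id x)) (by fun_prop) (expGrowth_exp_mul t)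

lemma mem_interior_integrableExpSet_evenLaw (hc : 0 < c) (hk : 2 ≤ k) (t : ℝ) :
    t ∈ interior (integrableExpSet id (evenLaw c k)) := by
  rw [integrableExpSet_evenLaw hc hk, interior_univ]; trivial

/-- Mean of the exponential tilt by `x ↦ θ x` of `evenLaw c k`. -/
def tiltMean (c : ℝ) (k : ℕ) (θ : ℝ) : ℝ := deriv (cgf id (evenLaw c k)) θ

lemma tiltMean_eq_div (hc : 0 < c) (hk : 2 ≤ k) (θ : ℝ) :
    tiltMean c k θ = (∫ x, x * Real.exp (θ * x) ∂(evenLaw c k)) /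
      ∫ x, Real.exp (θ * x) ∂(evenLaw c k) :=
  deriv_cgf (mem_interior_integrableExpSet_evenLaw hc hk θ)

lemma integrable_exp_tilt (hc : 0 < c) (hk : 2 ≤ k) (θ : ℝ) :
    Integrable fun x : ℝ => Real.exp (-(c * x ^ (2 * k)) + θ * x) := by
  refine (integrable_mul_exp_neg_even_pow hc hk (f := fun x => Real.exp (θ * x))
    (by fun_prop) (expGrowth_exp_mul θ)).congr (ae_of_all _ fun x => ?_)
  simp only []
  rw [← Real.exp_add, add_comm]

lemma integral_tilted_even_pow (hc : 0 < c) (hk : 2 ≤ k) (θ : ℝ) (f : ℝ → ℝ) :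
    ∫ u, f u ∂(volume.tilted fun x => -(c * x ^ (2 * k)) + θ * x) =
      (∫ x, f x * Real.exp (θ * x) ∂(evenLaw c k)) / ∫ x, Real.exp (θ * x) ∂(evenLaw c k) := by
  rw [integral_tilted, integral_evenLaw, integral_evenLaw,
    div_div_div_cancel_right₀ (integral_exp_neg_even_pow_pos hc hk).ne', ← integral_div]
  congr 1; ext x
  have : ∀ x : ℝ, Real.exp (-(c * x ^ (2 * k)) + θ * x) =
      Real.exp (θ * x) * Real.exp (-(c * x ^ (2 * k))) := fun x => by
    rw [← Real.exp_add, add_comm]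
  simp_rw [this, smul_eq_mul]
  ring

lemma integral_id_tilted_even_pow (hc : 0 < c) (hk : 2 ≤ k) (θ : ℝ) :
    ∫ u, u ∂(volume.tilted fun x => -(c * x ^ (2 * k)) + θ * x) = tiltMean c k θ := by
  rw [integral_tilted_even_pow hc hk θ fun u => u, tiltMean_eq_div hc hk]

lemma differentiable_cgf_evenLaw (hc : 0 < c) (hk : 2 ≤ k) :
    Differentiable ℝ (cgf id (evenLaw c k)) := fun θ =>
  (analyticAt_cgf (mem_interior_integrableExpSet_evenLaw hc hk θ)).differentiableAt

lemma differentiable_tiltMean (hc : 0 < c) (hk : 2 ≤ k) : Differentiable ℝ (tiltMean c k) :=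
  fun θ => (analyticAt_cgf (mem_interior_integrableExpSet_evenLaw hc hk θ)).deriv.differentiableAt

lemma monotone_tiltMean (hc : 0 < c) (hk : 2 ≤ k) : Monotone (tiltMean c k) := by
  refine monotone_of_deriv_nonneg (differentiable_tiltMean hc hk) fun θ => ?_
  have h := variance_tilted_mul (mem_interior_integrableExpSet_evenLaw hc hk θ)
  rw [iteratedDeriv_succ, iteratedDeriv_one] at h
  change 0 ≤ deriv (deriv (cgf id (evenLaw c k))) θ
  rw [← h]
  exact variance_nonneg _ _

lemma tiltMean_neg (hc : 0 < c) (hk : 2 ≤ k) (θ : ℝ) :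
    tiltMean c k (-θ) = -tiltMean c k θ := by
  rw [tiltMean_eq_div hc hk, tiltMean_eq_div hc hk,
    ← integral_comp_neg_evenLaw fun x => x * Real.exp (-θ * x),
    ← integral_comp_neg_evenLaw fun x => Real.exp (-θ * x)]
  simp_rw [neg_mul_neg, neg_mul]
  rw [integral_neg, neg_div]

lemma evenLaw_real_Ioi_ge (hc : 0 < c) (hk : 2 ≤ k) {x : ℝ} (hx : 0 ≤ x) :
    Real.exp (-(c * (x + 1) ^ (2 * k))) / ∫ y : ℝ, Real.exp (-(c * y ^ (2 * k))) ≤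
      (evenLaw c k).real (Set.Ioi x) := by
  rw [evenLaw_real_apply hc hk]
  have hi := integrable_exp_neg_even_pow hc hk
  refine div_le_div_of_nonneg_right ?_ (integral_exp_neg_even_pow_pos hc hk).le
  calc Real.exp (-(c * (x + 1) ^ (2 * k)))
      = ∫ y in Set.Ioc x (x + 1), Real.exp (-(c * (x + 1) ^ (2 * k))) := by
        rw [setIntegral_const]; simp [Measure.real]
    _ ≤ ∫ y in Set.Ioc x (x + 1), Real.exp (-(c * y ^ (2 * k))) := by
        refine setIntegral_mono_on (by simp) hi.integrableOn
          measurableSet_Ioc fun y hy => ?_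
        have h1 : y ^ (2 * k) ≤ (x + 1) ^ (2 * k) :=
          pow_le_pow_left₀ (hx.trans hy.1.le) hy.2 _
        gcongr
    _ ≤ ∫ y in Set.Ioi x, Real.exp (-(c * y ^ (2 * k))) :=
        setIntegral_mono_set hi.integrableOn (ae_of_all _ fun y => (Real.exp_pos _).le)
          (ae_of_all _ fun y hy => hy.1)

lemma evenLaw_real_Ioi_pos (hc : 0 < c) (hk : 2 ≤ k) {x : ℝ} (hx : 0 ≤ x) :
    0 < (evenLaw c k).real (Set.Ioi x) :=
  (div_pos (Real.exp_pos _) (integral_exp_neg_even_pow_pos hc hk)).trans_le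
    (evenLaw_real_Ioi_ge hc hk hx)

lemma tendsto_tiltMean_atTop (hc : 0 < c) (hk : 2 ≤ k) :
    Tendsto (tiltMean c k) atTop atTop := by
  have := isProbabilityMeasure_evenLaw hc hk
  refine tendsto_atTop.2 fun M => ?_
  wlog hM : 0 ≤ M generalizing M
  · exact (this 0 le_rfl).mono fun θ h => (le_of_not_ge hM).trans h
  -- The Chernoff bound at level `M + 1` gives `cgf θ / θ ≥ M + 1 + log δ / θ`. The spare unit
  -- absorbs the last term once `θ ≥ -log δ`, and `cgf θ / θ` is a tilted mean at an intermediate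
  -- point.
  set δ := (evenLaw c k).real (Set.Ioi (M + 1)) with hδ
  have hδ0 : 0 < δ := evenLaw_real_Ioi_pos hc hk (by linarith)
  filter_upwards [eventually_ge_atTop (max 1 (-Real.log δ))] with θ hθ
  have hθ1 : 1 ≤ θ := (le_max_left _ _).trans hθ
  have hθ2 : -Real.log δ ≤ θ := (le_max_right _ _).trans hθ
  have h1 : δ ≤ Real.exp (-θ * (M + 1) + cgf id (evenLaw c k) θ) := by
    refine le_trans ?_ (measure_ge_le_exp_cgf (M + 1) (by linarith)
      (integrable_of_mem_integrableExpSet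
        (interior_subset (mem_interior_integrableExpSet_evenLaw hc hk θ))))
    exact measureReal_mono fun y hy => le_of_lt (Set.mem_Ioi.1 hy)
  have h2 : Real.log δ ≤ -θ * (M + 1) + cgf id (evenLaw c k) θ :=
    (Real.log_le_iff_le_exp hδ0).2 h1
  obtain ⟨ξ, hξ, h3⟩ := exists_deriv_eq_slope (cgf id (evenLaw c k)) (show (0 : ℝ) < θ by linarith)
    (differentiable_cgf_evenLaw hc hk).continuous.continuousOn
    (differentiable_cgf_evenLaw hc hk).differentiableOn
  rw [cgf_zero, sub_zero, sub_zero] at h3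
  have h4 : tiltMean c k ξ ≤ tiltMean c k θ := monotone_tiltMean hc hk hξ.2.le
  refine le_trans ?_ h4
  rw [tiltMean, h3, le_div_iff₀ (by linarith)]
  nlinarith

/-- Integration by parts and Jensen's inequality bound the growth of the tilted mean. -/
lemma tiltMean_pow_le (hc : 0 < c) (hk : 2 ≤ k) (θ : ℝ) :
    2 * k * c * tiltMean c k θ ^ (2 * k) ≤ 1 + θ * tiltMean c k θ := by
  have hi := integrable_exp_tilt hc hk θ
  set μ : Measure ℝ := volume.tilted fun x => -(c * x ^ (2 * k)) + θ * x with hμ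
  have hp : IsProbabilityMeasure μ := isProbabilityMeasure_tilted hi
  set E : ℝ → ℝ := fun x => Real.exp (-(c * x ^ (2 * k)) + θ * x) with hE
  have hgrow : ∀ f : ℝ → ℝ, Continuous f → ExpGrowth f → Integrable fun x => f x * E x := by
    intro f hf hg
    refine (integrable_mul_exp_neg_even_pow hc hk (f := fun x => f x * Real.exp (θ * x))
      (by fun_prop) (hg.mul (expGrowth_exp_mul θ))).congr (ae_of_all _ fun x => ?_)
    simp only [hE]
    rw [Real.exp_add]; ring
  have hμi : ∀ f : ℝ → ℝ, Continuous f → ExpGrowth f → Integrable f μ := by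
    intro f hf hg
    rw [hμ, integrable_tilted_iff hi]
    refine (hgrow f hf hg).congr (ae_of_all _ fun x => ?_)
    simp only [smul_eq_mul, hE]; ring
  have hmean : ∫ u, u ∂μ = tiltMean c k θ := integral_id_tilted_even_pow hc hk θ
  have hconv := (even_two_mul k).convexOn_pow (𝕜 := ℝ)
  have hJ := hconv.map_integral_le (f := fun u : ℝ => u) (μ := μ) (by fun_prop) isClosed_univ (by simp)
    (hμi _ continuous_id expGrowth_id) (hμi _ (by simp only [Function.comp_def]; fun_prop)
      (expGrowth_pow _))
  rw [hmean] at hJ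
  -- The integral of the derivative of `x E(x)` vanishes, which gives `2kc E[x^(2k)] = 1 + θ E[x]`
  -- under the tilted law. Jensen (`hJ`) bounds the left side from below.
  have hd : ∀ x : ℝ, HasDerivAt (fun x => x * E x)
      ((1 + θ * x - 2 * k * c * x ^ (2 * k)) * E x) x := by
    intro x
    have h1 : HasDerivAt E (E x * (-(c * ((2 * k : ℕ) * x ^ (2 * k - 1))) + θ * 1)) x :=
      ((((hasDerivAt_pow (2 * k) x).const_mul c).neg).add ((hasDerivAt_id x).const_mul θ)).exp
    refine ((hasDerivAt_id x).mul h1).congr_deriv ?_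
    have e : x ^ (2 * k) = x ^ (2 * k - 1) * x := by
      rw [← pow_succ]; congr 1; omega
    rw [e]; push_cast; simp only [id]; ring
  have h0 := integral_eq_zero_of_hasDerivAt_of_integrable hd
    (hgrow (fun x => 1 + θ * x - 2 * k * c * x ^ (2 * k)) (by fun_prop)
      (((expGrowth_const 1).add (expGrowth_id.const_mul θ)).sub ((expGrowth_pow _).const_mul _)))
    (hgrow (fun x => x) continuous_id expGrowth_id)
  have h1 : ∫ x, (1 + θ * x - 2 * k * c * x ^ (2 * k)) ∂μ = 0 := by
    rw [hμ, integral_tilted]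
    have : ∀ x : ℝ, (Real.exp (-(c * x ^ (2 * k)) + θ * x) /
        ∫ x, Real.exp (-(c * x ^ (2 * k)) + θ * x)) • (1 + θ * x - 2 * k * c * x ^ (2 * k)) =
        ((1 + θ * x - 2 * k * c * x ^ (2 * k)) * E x) /
        ∫ x, Real.exp (-(c * x ^ (2 * k)) + θ * x) := fun x => by
      simp only [smul_eq_mul, hE]; ring
    simp_rw [this]
    rw [integral_div, h0, zero_div]
  have i1 : Integrable (fun x : ℝ => 1 + θ * x) μ :=
    hμi _ (by fun_prop) ((expGrowth_const 1).add (expGrowth_id.const_mul θ))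
  have i2 : Integrable (fun x : ℝ => θ * x) μ := hμi _ (by fun_prop) (expGrowth_id.const_mul θ)
  have i3 : Integrable (fun x : ℝ => 2 * k * c * x ^ (2 * k)) μ :=
    hμi _ (by fun_prop) ((expGrowth_pow _).const_mul _)
  rw [integral_sub i1 i3, integral_add (integrable_const _) i2, integral_const_mul,
    integral_const_mul, hmean] at h1
  simp only [integral_const, probReal_univ, smul_eq_mul, mul_one] at h1
  have h2 : 2 * k * c * tiltMean c k θ ^ (2 * k) ≤ 2 * k * c * ∫ x, x ^ (2 * k) ∂μ := by
    have : (0 : ℝ) ≤ 2 * k * c := by positivity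
    exact mul_le_mul_of_nonneg_left hJ this
  linarith

end evenLaw
-- The limiting law and its non-Gaussian tail
section evenLaw
variable {c : ℝ} {k : ℕ}

lemma continuous_evenLaw_real_Iic (hc : 0 < c) (hk : 2 ≤ k) :
    Continuous fun x => (evenLaw c k).real (Set.Iic x) := by
  simp_rw [evenLaw_real_apply hc hk]
  refine Continuous.div_const (continuous_iff_continuousAt.2 fun x => ?_) _
  exact (hasDerivAt_setIntegral_Iic (by fun_prop) (integrable_exp_neg_even_pow hc hk) x).continuousAt

/-- A Chernoff bound with parameter `t/(v+1)`. Dividing by `v + 1` instead of `v` includes the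
degenerate Gaussian `v = 0` without a separate case. -/
lemma gaussianReal_Ioi_le (a : ℝ) (v : NNReal) {t : ℝ} (ht : 0 ≤ t) :
    (gaussianReal a v).real (Set.Ioi t) ≤
      Real.exp ((|a| * t - t ^ 2 / 2) / (v + 1)) := by
  have hv : (0 : ℝ) < v + 1 := by positivity
  have hl : 0 ≤ t / (v + 1) := by positivity
  have hint : Integrable (fun ω => Real.exp (t / (v + 1) * id ω)) (gaussianReal a v) :=
    integrable_exp_mul_gaussianReal _
  refine (measureReal_mono (s₂ := {ω | t ≤ id ω}) fun y hy => le_of_lt (Set.mem_Ioi.1 hy)).trans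
    ((measure_ge_le_exp_mul_mgf t hl hint).trans ?_)
  rw [mgf_id_gaussianReal]
  rw [← Real.exp_add, Real.exp_le_exp]
  have e1 : -(t / (v + 1)) * t + (a * (t / (v + 1)) + v * (t / (v + 1)) ^ 2 / 2) =
      (a * t - t ^ 2 + (v / (v + 1)) * (t ^ 2 / 2)) / (v + 1) := by field_simp; ring
  rw [e1]
  refine div_le_div_of_nonneg_right ?_ hv.le
  have h1 : (v : ℝ) / (v + 1) ≤ 1 := (div_le_one hv).2 (by linarith)
  have h2 : (v : ℝ) / (v + 1) * (t ^ 2 / 2) ≤ 1 * (t ^ 2 / 2) := by gcongr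
  have h3 : a * t ≤ |a| * t := by gcongr; exact le_abs_self a
  linarith

/-- The law with distribution function `t ↦ ν (-∞, -mean (b t)]` exists. -/
lemma exists_law_tiltMean (hc : 0 < c) (hk : 2 ≤ k) {b : ℝ} (hb : b < 0) :
    ∃ (G : Measure ℝ) (_ : IsProbabilityMeasure G), ∀ t : ℝ, G.real (Set.Iic t) =
      (evenLaw c k).real (Set.Iic (-tiltMean c k (b * t))) := by
  have := isProbabilityMeasure_evenLaw hc hk
  have hcont : Continuous fun t => (evenLaw c k).real (Set.Iic (-tiltMean c k (b * t))) :=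
    (continuous_evenLaw_real_Iic hc hk).comp
      (((differentiable_tiltMean hc hk).continuous.comp (continuous_const.mul continuous_id)).neg)
  have hmono : Monotone fun t => (evenLaw c k).real (Set.Iic (-tiltMean c k (b * t))) := by
    intro s t hst
    refine measureReal_mono (Set.Iic_subset_Iic.2 (neg_le_neg (monotone_tiltMean hc hk ?_)))
    exact mul_le_mul_of_nonpos_left hst hb.le
  let F : StieltjesFunction ℝ := ⟨_, hmono, fun x => hcont.continuousAt.continuousWithinAt⟩
  have htop : Tendsto (fun t => -tiltMean c k (b * t)) atTop atTop := by
    have : ∀ t, -tiltMean c k (b * t) = tiltMean c k (-b * t) := fun t => by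
      rw [← tiltMean_neg hc hk, neg_mul]
    simp_rw [this]
    exact (tendsto_tiltMean_atTop hc hk).comp (tendsto_id.const_mul_atTop (by linarith))
  have hbot : Tendsto (fun t => -tiltMean c k (b * t)) atBot atBot :=
    tendsto_neg_atTop_atBot.comp ((tendsto_tiltMean_atTop hc hk).comp
      (tendsto_id.const_mul_atBot_of_neg hb))
  have hF0 : Tendsto F atBot (𝓝 0) := by
    have := (tendsto_cdf_atBot (evenLaw c k)).comp hbot
    exact this.congr fun t => cdf_eq_real _ _
  have hF1 : Tendsto F atTop (𝓝 1) := by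
    have := (tendsto_cdf_atTop (evenLaw c k)).comp htop
    exact this.congr fun t => cdf_eq_real _ _
  refine ⟨F.measure, F.isProbabilityMeasure hF0 hF1, fun t => ?_⟩
  rw [Measure.real, F.measure_Iic hF0, sub_zero]
  exact ENNReal.toReal_ofReal measureReal_nonneg

/-- The upper tail of the law is too heavy for a Gaussian law. -/
lemma ne_gaussianReal_of_tiltMean (hc : 0 < c) (hk : 2 ≤ k) {b : ℝ} (hb : b < 0) {G : Measure ℝ}
    (hG : ∀ t : ℝ, G.real (Set.Iic t) =
      (evenLaw c k).real (Set.Iic (-tiltMean c k (b * t)))) (a : ℝ) (v : NNReal) :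
    G ≠ gaussianReal a v := by
  rintro rfl
  have := isProbabilityMeasure_evenLaw hc hk
  set Z : ℝ := ∫ y : ℝ, Real.exp (-(c * y ^ (2 * k))) with hZ
  have hZ0 : 0 < Z := integral_exp_neg_even_pow_pos hc hk
  have hv : (0 : ℝ) < v + 1 := by positivity
  set B := -b with hB
  have hB0 : 0 < B := by simpa [hB] using hb
  have hk0 : (0 : ℝ) < 2 * k := by positivity
  set D : ℝ := 2 ^ (2 * k) / (2 * k) with hD
  have hD0 : 0 < D := by positivity
  set L : ℝ := |Real.log Z| with hL
  set A : ℝ := 2 * (v + 1) * (D * (1 + B) + L) + 2 * |a| with hA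
  have hA0 : 0 ≤ A := by positivity
  have hx : Tendsto (fun t => tiltMean c k (B * t)) atTop atTop :=
    (tendsto_tiltMean_atTop hc hk).comp (tendsto_id.const_mul_atTop hB0)
  -- `t` is chosen so that `x` exceeds the bound that `h15` is going to place on `x²`.
  obtain ⟨t, ht1, hxt1, hxt2⟩ := ((eventually_ge_atTop (1 : ℝ)).and
    ((hx.eventually_ge_atTop 1).and
      (hx.eventually_gt_atTop ((1 + B * A) / (2 * k * c) + 1 + c)))).exists
  set x := tiltMean c k (B * t) with hxdef
  have hneg : -tiltMean c k (b * t) = x := by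
    rw [← tiltMean_neg hc hk, ← neg_mul]
  have hpow := tiltMean_pow_le hc hk (B * t)
  rw [← hxdef] at hpow
  have htail : (evenLaw c k).real (Set.Ioi x) = (gaussianReal a v).real (Set.Ioi t) := by
    rw [← Set.compl_Iic, ← Set.compl_Iic, probReal_compl_eq_one_sub measurableSet_Iic,
      probReal_compl_eq_one_sub measurableSet_Iic, hG t, hneg]
  have h1 : Real.exp (-(c * (x + 1) ^ (2 * k))) / Z ≤
      Real.exp ((|a| * t - t ^ 2 / 2) / (v + 1)) :=
    (evenLaw_real_Ioi_ge hc hk (by linarith)).trans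
      (htail.le.trans (gaussianReal_Ioi_le a v (by linarith)))
  have h2 : -(c * (x + 1) ^ (2 * k)) - Real.log Z ≤ (|a| * t - t ^ 2 / 2) / (v + 1) := by
    rw [← Real.exp_le_exp, Real.exp_sub, Real.exp_log hZ0]
    exact h1
  have h3 : c * (x + 1) ^ (2 * k) ≤ D * (1 + B * t * x) := by
    have h4 : (x + 1) ^ (2 * k) ≤ 2 ^ (2 * k) * x ^ (2 * k) := by
      rw [← mul_pow]
      exact pow_le_pow_left₀ (by linarith) (by linarith) _
    calc c * (x + 1) ^ (2 * k) ≤ c * (2 ^ (2 * k) * x ^ (2 * k)) := by gcongr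
      _ = D * (2 * k * c * x ^ (2 * k)) := by rw [hD]; field_simp
      _ ≤ D * (1 + B * t * x) := by gcongr
  have htx : 1 ≤ t * x := one_le_mul_of_one_le_of_one_le ht1 hxt1
  -- The Gaussian tail exponent is of order `t²`, whereas the tail of `evenLaw` at `x` has exponent
  -- of order `x^(2k)`, which `tiltMean_pow_le` bounds by a multiple of `t x`. Hence `t ≤ A x`, then
  -- `x^(2k) ≲ x²`, and since `2k ≥ 4` this bounds `x`.
  have h5 : t ^ 2 ≤ A * (t * x) := by
    have h6 : (t ^ 2 / 2 - |a| * t) / (v + 1) ≤ D * (1 + B * t * x) + L := by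
      have : (t ^ 2 / 2 - |a| * t) / (v + 1) = -((|a| * t - t ^ 2 / 2) / (v + 1)) := by ring
      rw [this]
      linarith [le_abs_self (Real.log Z)]
    rw [div_le_iff₀ hv] at h6
    have h7 : D * (1 + B * t * x) + L ≤ (D * (1 + B) + L) * (t * x) := by
      have : 0 ≤ (D + L) * (t * x - 1) := mul_nonneg (by positivity) (by linarith)
      nlinarith
    have h8 : (D * (1 + B * t * x) + L) * (v + 1) ≤ (D * (1 + B) + L) * (t * x) * (v + 1) := by
      gcongr
    have h9 : |a| * t ≤ |a| * (t * x) := by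
      gcongr; nlinarith
    have : A * (t * x) = 2 * ((D * (1 + B) + L) * (t * x) * (v + 1)) + 2 * (|a| * (t * x)) := by
      rw [hA]; ring
    linarith
  have h10 : t ≤ A * x := by
    have : t * t ≤ t * (A * x) := by nlinarith
    exact le_of_mul_le_mul_left this (by linarith)
  have h11 : x ^ 4 ≤ x ^ (2 * k) := pow_le_pow_right₀ hxt1 (by omega)
  have hkc : 0 < 2 * k * c := by positivity
  have h12 : 2 * k * c * x ^ 4 ≤ (1 + B * A) * x ^ 2 := by
    have h13 : B * t * x ≤ B * (A * x) * x := by gcongr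
    have h14 : 2 * k * c * x ^ 4 ≤ 2 * k * c * x ^ (2 * k) := by gcongr
    have h16 : 1 ≤ x ^ 2 := one_le_pow₀ hxt1
    have e : B * (A * x) * x = B * A * x ^ 2 := by ring
    have e' : (1 + B * A) * x ^ 2 = x ^ 2 + B * A * x ^ 2 := by ring
    rw [e] at h13
    rw [e']
    linarith
  have h15 : x ^ 2 ≤ (1 + B * A) / (2 * k * c) := by
    rw [le_div_iff₀ hkc]
    have : x ^ 2 * (x ^ 2 * (2 * k * c)) ≤ x ^ 2 * (1 + B * A) := by
      calc x ^ 2 * (x ^ 2 * (2 * k * c)) = 2 * k * c * x ^ 4 := by ring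
        _ ≤ (1 + B * A) * x ^ 2 := h12
        _ = _ := mul_comm _ _
    exact le_of_mul_le_mul_left this (by positivity)
  have h17 : x ≤ x ^ 2 := le_self_pow₀ hxt1 two_ne_zero
  linarith

end evenLaw

/-! ### Counting configurations by their types -/

section Combinatorics
variable {p q N : ℕ}

lemma magnetization_nonneg (x : Fin N → Fin q) (r : Fin q) : 0 ≤ magnetization x r :=
  div_nonneg (Finset.sum_nonneg fun i _ => by split_ifs <;> norm_num) (Nat.cast_nonneg _)

lemma sum_apply_eq_magnetization (hN : 0 < N) (x : Fin N → Fin q) (φ : Fin q → ℝ) :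
    ∑ i, φ (x i) = N * ∑ r, magnetization x r * φ r := by
  have hN' : (N : ℝ) ≠ 0 := by positivity
  simp_rw [magnetization, Finset.mul_sum, ← mul_assoc, mul_div_cancel₀ _ hN', Finset.sum_mul]
  rw [Finset.sum_comm]
  simp

lemma sum_magnetization (hN : 0 < N) (x : Fin N → Fin q) : ∑ r, magnetization x r = 1 := by
  have h := sum_apply_eq_magnetization hN x fun _ => 1
  have hN' : (N : ℝ) ≠ 0 := by positivity
  simp only [Finset.sum_const, Finset.card_univ, Fintype.card_fin, nsmul_eq_mul, mul_one] at h
  exact mul_left_cancel₀ hN' (by rw [← h, mul_one])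

lemma magnetization_mem_stdSimplex (hN : 0 < N) (x : Fin N → Fin q) :
    magnetization x ∈ stdSimplex ℝ (Fin q) :=
  ⟨magnetization_nonneg x, sum_magnetization hN x⟩

lemma magnetization_apply_pos (hN : 0 < N) (x : Fin N → Fin q) (i : Fin N) :
    0 < magnetization x (x i) := by
  refine div_pos (Finset.sum_pos' (fun i _ => by split_ifs <;> norm_num) ⟨i, Finset.mem_univ _, ?_⟩)
    (by positivity)
  simp

lemma card_image_magnetization_le [DecidableEq (Fin q → ℝ)] :
    (Finset.univ.image fun x : Fin N → Fin q => magnetization x).card ≤ (N + 1) ^ q := by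
  let f : (Fin q → Fin (N + 1)) → Fin q → ℝ := fun c r => (c r : ℝ) / N
  have hsub : (Finset.univ.image fun x : Fin N → Fin q => magnetization x) ⊆
      Finset.univ.image f := by
    intro t ht
    obtain ⟨x, -, rfl⟩ := Finset.mem_image.1 ht
    refine Finset.mem_image.2 ⟨fun r => ⟨(Finset.univ.filter fun i => x i = r).card, ?_⟩,
      Finset.mem_univ _, ?_⟩
    · have := Finset.card_filter_le (Finset.univ : Finset (Fin N)) fun i => x i = r
      simp only [Finset.card_univ, Fintype.card_fin] at this
      omega
    · ext r
      simp [f, magnetization]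
  refine (Finset.card_le_card hsub).trans (Finset.card_image_le.trans ?_)
  simp

/-- Method of types: replace the empirical vector of `x` by a sum over all attained types. Each type
`t` contributes `(∑ t r)^N = 1`, and there are at most `(N+1)^q` of them. -/
lemma sum_prod_magnetization_le (hN : 0 < N) :
    ∑ x : Fin N → Fin q, ∏ i, magnetization x (x i) ≤ ((N : ℝ) + 1) ^ q := by
  classical
  set T := Finset.univ.image fun x : Fin N → Fin q => magnetization x with hT
  calc ∑ x : Fin N → Fin q, ∏ i, magnetization x (x i)
      ≤ ∑ x : Fin N → Fin q, ∑ t ∈ T, ∏ i, t (x i) := by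
        refine Finset.sum_le_sum fun x _ => ?_
        refine Finset.single_le_sum (f := fun t : Fin q → ℝ => ∏ i, t (x i)) (fun t ht => ?_)
          (Finset.mem_image_of_mem _ (Finset.mem_univ x))
        obtain ⟨y, -, rfl⟩ := Finset.mem_image.1 ht
        exact Finset.prod_nonneg fun i _ => magnetization_nonneg _ _
    _ = ∑ t ∈ T, (∑ r, t r) ^ N := by
        rw [Finset.sum_comm]
        exact Finset.sum_congr rfl fun t _ => (Fintype.sum_pow t N).symm
    _ = ∑ t ∈ T, 1 := by
        refine Finset.sum_congr rfl fun t ht => ?_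
        obtain ⟨y, -, rfl⟩ := Finset.mem_image.1 ht
        rw [sum_magnetization hN, one_pow]
    _ ≤ ((N : ℝ) + 1) ^ q := by
        rw [Finset.sum_const, nsmul_eq_mul, mul_one]
        exact_mod_cast card_image_magnetization_le

variable [NeZero q]

/-- The entropy term of the free energy is exactly the logarithm of the product of empirical
frequencies along the sample. The identity is exact, with no Stirling approximation. -/
lemma weight_eq_exp_freeEnergy (hN : 0 < N) (β h : ℝ) (x : Fin N → Fin q) :
    weight p q β h N x = Real.exp (N * freeEnergy p q β h (magnetization x)) *
      ∏ i, magnetization x (x i) := by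
  have h1 : ∏ i, magnetization x (x i) =
      Real.exp (∑ i, Real.log (magnetization x (x i))) := by
    rw [Real.exp_sum]
    exact Finset.prod_congr rfl fun i _ => (Real.exp_log (magnetization_apply_pos hN x i)).symm
  rw [h1, ← Real.exp_add, weight,
    sum_apply_eq_magnetization hN x fun r => Real.log (magnetization x r), freeEnergy]
  congr 1; ring

end Combinatorics

/-! ### Variational lower bound for the partition sum -/

section ProductMeasure
variable {p q N : ℕ}

lemma sum_prod_mul_indicator {m : Fin q → ℝ} (hm : ∑ r, m r = 1) (i : Fin N) (r : Fin q) :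
    ∑ x : Fin N → Fin q, (∏ j, m (x j)) * (if x i = r then 1 else 0) = m r := by
  classical
  have h := Finset.prod_univ_sum (fun _ : Fin N => (Finset.univ : Finset (Fin q)))
    fun j a => if j = i then (if a = r then m a else 0) else m a
  rw [Fintype.piFinset_univ] at h
  have hl : ∏ j : Fin N, ∑ a, (if j = i then (if a = r then m a else 0) else m a) = m r := by
    rw [Finset.prod_eq_single i]
    · simp
    · intro j _ hj; simp [hj, hm]
    · simp
  rw [hl] at h
  rw [h]
  refine Finset.sum_congr rfl fun x _ => ?_
  by_cases hx : x i = r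
  · rw [if_pos hx, mul_one]
    refine Finset.prod_congr rfl fun j _ => ?_
    by_cases hj : j = i
    · subst hj; simp [hx]
    · simp [hj]
  · rw [if_neg hx, mul_zero]
    exact (Finset.prod_eq_zero (Finset.mem_univ i) (by simp [hx])).symm

lemma sum_prod_mul_magnetization (hN : 0 < N) {m : Fin q → ℝ} (hm : ∑ r, m r = 1) (r : Fin q) :
    ∑ x : Fin N → Fin q, (∏ j, m (x j)) * magnetization x r = m r := by
  have hN' : (N : ℝ) ≠ 0 := by positivity
  simp_rw [magnetization, mul_div_assoc', Finset.mul_sum]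
  rw [← Finset.sum_div, Finset.sum_comm]
  simp_rw [sum_prod_mul_indicator hm]
  simp [hN']

variable [NeZero q]

/-- Gibbs variational principle with the product measure of marginal `m` as trial measure. Convexity
of `x ↦ x^p` on the nonnegative half-line and `β ≥ 0` allow the mean of the interaction to be
replaced by its value at `m`, so no prefactor is lost. -/
lemma exp_freeEnergy_le_partitionSum (hN : 0 < N) {β : ℝ} (hβ : 0 ≤ β) (h : ℝ) {m : Fin q → ℝ}
    (hm0 : ∀ r, 0 < m r) (hm : ∑ r, m r = 1) :
    Real.exp (N * freeEnergy p q β h m) ≤ partitionSum p q β h N := by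
  set π : (Fin N → Fin q) → ℝ := fun x => ∏ j, m (x j) with hπ
  have hπ0 : ∀ x, 0 < π x := fun x => Finset.prod_pos fun j _ => hm0 _
  have hπ1 : ∑ x, π x = 1 := by
    rw [hπ, ← Fintype.sum_pow, hm, one_pow]
  have hπm : ∀ r, ∑ x, π x * magnetization x r = m r := sum_prod_mul_magnetization hN hm
  -- The exponent of the weight minus the logarithm of the trial density, so that the partition sum
  -- is the trial mean of `exp e`.
  set e : (Fin N → Fin q) → ℝ := fun x =>
    β * N * ∑ r, magnetization x r ^ p + N * h * magnetization x 0 - ∑ i, Real.log (m (x i)) with he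
  have hJ := convexOn_exp.map_sum_le (t := Finset.univ) (w := π) (p := e)
    (fun x _ => (hπ0 x).le) hπ1 (fun _ _ => Set.mem_univ _)
  simp only [smul_eq_mul] at hJ
  have hR : ∑ x, π x * Real.exp (e x) = partitionSum p q β h N := by
    refine Finset.sum_congr rfl fun x _ => ?_
    have : π x = Real.exp (∑ i, Real.log (m (x i))) := by
      rw [Real.exp_sum, hπ]
      exact Finset.prod_congr rfl fun i _ => (Real.exp_log (hm0 _)).symm
    rw [this, ← Real.exp_add, weight, he]
    congr 1; ring
  rw [hR] at hJ
  refine le_trans (Real.exp_le_exp.2 ?_) hJ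
  have hpow : ∀ r, m r ^ p ≤ ∑ x, π x * magnetization x r ^ p := by
    intro r
    have := (convexOn_pow (𝕜 := ℝ) p).map_sum_le (t := Finset.univ) (w := π)
      (p := fun x => magnetization x r) (fun x _ => (hπ0 x).le) hπ1
      (fun x _ => magnetization_nonneg x r)
    simp only [smul_eq_mul] at this
    rwa [hπm r] at this
  have hlog : ∑ x, π x * ∑ i, Real.log (m (x i)) = N * ∑ r, m r * Real.log (m r) := by
    simp_rw [sum_apply_eq_magnetization hN _ fun r => Real.log (m r), Finset.mul_sum]
    rw [Finset.sum_comm]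
    refine Finset.sum_congr rfl fun r _ => ?_
    rw [← hπm r, Finset.sum_mul, Finset.mul_sum]
    refine Finset.sum_congr rfl fun x _ => ?_
    rw [hπm r]; ring
  have hE : ∑ x, π x * e x = β * N * ∑ r, ∑ x, π x * magnetization x r ^ p + N * h * m 0 -
      N * ∑ r, m r * Real.log (m r) := by
    rw [← hlog, ← hπm 0, Finset.sum_comm]
    simp_rw [he, mul_sub, mul_add, Finset.sum_sub_distrib, Finset.sum_add_distrib, Finset.mul_sum]
    congr 2
    · refine Finset.sum_congr rfl fun x _ => Finset.sum_congr rfl fun r _ => by ring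
    · refine Finset.sum_congr rfl fun x _ => by ring
  rw [hE, freeEnergy]
  have : β * N * ∑ r, m r ^ p ≤ β * N * ∑ r, ∑ x, π x * magnetization x r ^ p := by
    gcongr with r _
    exact hpow r
  linarith

/-- Expectation under the model. -/
def pottsMean (p q : ℕ) [NeZero q] (β h : ℝ) (N : ℕ) (f : (Fin N → Fin q) → ℝ) : ℝ :=
  ∑ x, prob p q β h N x * f x

lemma prob_nonneg (β h : ℝ) (x : Fin N → Fin q) : 0 ≤ prob p q β h N x :=
  div_nonneg (Real.exp_pos _).le (partitionSum_pos p q β h N).le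

lemma sum_prob_eq_one (β h : ℝ) : ∑ x, prob p q β h N x = 1 := by
  unfold prob
  rw [← Finset.sum_div]
  exact div_self (partitionSum_pos p q β h N).ne'

/-- Exponential integrability of the free energy deficit. -/
lemma pottsMean_exp_deficit_le (hN : 0 < N) {β : ℝ} (hβ : 0 ≤ β) (h : ℝ) {m : Fin q → ℝ}
    (hm0 : ∀ r, 0 < m r) (hm : ∑ r, m r = 1) :
    pottsMean p q β h N (fun x => Real.exp (N * (freeEnergy p q β h m -
      freeEnergy p q β h (magnetization x)))) ≤ ((N : ℝ) + 1) ^ q := by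
  have hZ := partitionSum_pos p q β h N
  have hle := exp_freeEnergy_le_partitionSum (p := p) hN hβ h hm0 hm
  have e : pottsMean p q β h N (fun x => Real.exp (N * (freeEnergy p q β h m -
      freeEnergy p q β h (magnetization x)))) =
      (Real.exp (N * freeEnergy p q β h m) / partitionSum p q β h N) *
        ∑ x : Fin N → Fin q, ∏ i, magnetization x (x i) := by
    rw [pottsMean, Finset.mul_sum]
    refine Finset.sum_congr rfl fun x _ => ?_
    rw [prob, weight_eq_exp_freeEnergy hN, mul_sub, Real.exp_sub]
    have := (Real.exp_pos (N * freeEnergy p q β h (magnetization x))).ne'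
    field_simp
  rw [e]
  have h1 : Real.exp (N * freeEnergy p q β h m) / partitionSum p q β h N ≤ 1 :=
    (div_le_one hZ).2 hle
  have h2 : 0 ≤ ∑ x : Fin N → Fin q, ∏ i, magnetization x (x i) :=
    Finset.sum_nonneg fun x _ => Finset.prod_nonneg fun i _ => magnetization_nonneg _ _
  calc _ ≤ 1 * ∑ x : Fin N → Fin q, ∏ i, magnetization x (x i) := by gcongr
    _ ≤ _ := by rw [one_mul]; exact sum_prod_magnetization_le hN

end ProductMeasure

/-! ### Detailed balance for recoloring one site -/

section Exchange
variable {p q N : ℕ}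

lemma magnetization_update (hN : 0 < N) (x : Fin N → Fin q) (i : Fin N) (s r : Fin q) :
    magnetization (Function.update x i s) r = magnetization x r +
      ((if s = r then 1 else 0) - (if x i = r then 1 else 0)) / N := by
  have hN' : (N : ℝ) ≠ 0 := by positivity
  simp only [magnetization]
  rw [← add_div]
  congr 1
  rw [← Finset.add_sum_erase _ _ (Finset.mem_univ i),
    ← Finset.add_sum_erase _ (fun j => if x j = r then (1 : ℝ) else 0) (Finset.mem_univ i)]
  have : ∑ j ∈ Finset.univ.erase i, (if Function.update x i s j = r then (1 : ℝ) else 0) =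
      ∑ j ∈ Finset.univ.erase i, (if x j = r then (1 : ℝ) else 0) := by
    refine Finset.sum_congr rfl fun j hj => ?_
    rw [Function.update_of_ne (Finset.ne_of_mem_erase hj)]
  rw [this, Function.update_self]
  ring

lemma sum_update_eq (i : Fin N) (r s : Fin q)
    (A : (Fin N → Fin q) → (Fin N → Fin q) → ℝ) :
    ∑ x : Fin N → Fin q, (if x i = r then A x (Function.update x i s) else 0) =
      ∑ y : Fin N → Fin q, (if y i = s then A (Function.update y i r) y else 0) := by
  rw [← Finset.sum_filter, ← Finset.sum_filter]
  refine Finset.sum_nbij' (fun x => Function.update x i s) (fun y => Function.update y i r)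
    (by simp) (by simp) ?_ ?_ ?_
  · intro x hx
    simp only [Finset.mem_filter, Finset.mem_univ, true_and] at hx
    rw [Function.update_idem, ← hx, Function.update_eq_self]
  · intro x hx
    simp only [Finset.mem_filter, Finset.mem_univ, true_and] at hx
    rw [Function.update_idem, ← hx, Function.update_eq_self]
  · intro x hx
    simp only [Finset.mem_filter, Finset.mem_univ, true_and] at hx
    rw [Function.update_idem, ← hx, Function.update_eq_self]

/-- Ratio of the weights before and after a site changes from color `0` to another color. -/
def flipRatio (p : ℕ) (β h : ℝ) (N : ℕ) (a b : ℝ) : ℝ :=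
  Real.exp (β * N * ((b + 1 / N) ^ p - b ^ p + ((a - 1 / N) ^ p - a ^ p)) - h)

variable [NeZero q]

lemma weight_update (hN : 0 < N) (β h : ℝ) (x : Fin N → Fin q) (i : Fin N) {s : Fin q}
    (hs : s ≠ 0) (hx : x i = 0) :
    weight p q β h N (Function.update x i s) =
      weight p q β h N x * flipRatio p β h N (magnetization x 0) (magnetization x s) := by
  have hN' : (N : ℝ) ≠ 0 := by positivity
  have h0 : magnetization (Function.update x i s) 0 = magnetization x 0 - 1 / N := by
    rw [magnetization_update hN, if_neg hs, if_pos hx]; ring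
  have h1 : magnetization (Function.update x i s) s = magnetization x s + 1 / N := by
    rw [magnetization_update hN, if_pos rfl, hx, if_neg hs.symm]; ring
  have h2 : ∀ r, r ≠ 0 → r ≠ s → magnetization (Function.update x i s) r = magnetization x r := by
    intro r hr0 hrs
    rw [magnetization_update hN, if_neg hrs.symm, hx, if_neg hr0.symm]; ring
  have hsum : ∑ r, magnetization (Function.update x i s) r ^ p = ∑ r, magnetization x r ^ p +
      ((magnetization x s + 1 / N) ^ p - magnetization x s ^ p +
        ((magnetization x 0 - 1 / N) ^ p - magnetization x 0 ^ p)) := by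
    have key : ∑ r, (magnetization (Function.update x i s) r ^ p - magnetization x r ^ p) =
        ((magnetization x s + 1 / N) ^ p - magnetization x s ^ p) +
        ((magnetization x 0 - 1 / N) ^ p - magnetization x 0 ^ p) := by
      rw [Fintype.sum_eq_add s 0 hs, h0, h1]
      rintro r ⟨hrs, hr0⟩
      rw [h2 r hr0 hrs, sub_self]
    rw [← key, Finset.sum_sub_distrib]; ring
  rw [weight, weight, flipRatio, ← Real.exp_add, hsum, h0]
  congr 1
  field_simp
  ring

/-- Detailed balance for the change of one site between the colors `0` and `s`. -/
lemma pottsMean_exchange (hN : 0 < N) (β h : ℝ) {s : Fin q} (hs : s ≠ 0) (φ : ℝ → ℝ) :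
    pottsMean p q β h N (fun x => magnetization x 0 *
      flipRatio p β h N (magnetization x 0) (magnetization x s) * φ (magnetization x 0)) =
    pottsMean p q β h N (fun x => magnetization x s * φ (magnetization x 0 + 1 / N)) := by
  have hN' : (N : ℝ) ≠ 0 := by positivity
  -- Both sides sum over a site and a pair of configurations differing there, colored 0 in one and
  -- `s` in the other. The left side is indexed by the first and the right side by the second.
  have key : ∑ i : Fin N, ∑ x : Fin N → Fin q, (if x i = 0 then
        weight p q β h N (Function.update x i s) * φ (magnetization x 0) else 0) =
      ∑ i : Fin N, ∑ y : Fin N → Fin q, (if y i = s then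
        weight p q β h N y * φ (magnetization (Function.update y i 0) 0) else 0) :=
    Finset.sum_congr rfl fun i _ =>
      sum_update_eq i 0 s fun x y => weight p q β h N y * φ (magnetization x 0)
  have hl : ∑ i : Fin N, ∑ x : Fin N → Fin q, (if x i = 0 then
        weight p q β h N (Function.update x i s) * φ (magnetization x 0) else 0) =
      N * ∑ x : Fin N → Fin q, weight p q β h N x * (magnetization x 0 *
      flipRatio p β h N (magnetization x 0) (magnetization x s) * φ (magnetization x 0)) := by
    rw [Finset.sum_comm, Finset.mul_sum]
    refine Finset.sum_congr rfl fun x _ => ?_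
    have e : ∀ i, (if x i = 0 then
        weight p q β h N (Function.update x i s) * φ (magnetization x 0) else 0) =
        (if x i = 0 then (1 : ℝ) else 0) * (weight p q β h N x *
          flipRatio p β h N (magnetization x 0) (magnetization x s) * φ (magnetization x 0)) := by
      intro i
      split_ifs with hx
      · rw [weight_update hN β h x i hs hx, one_mul]
      · rw [zero_mul]
    simp_rw [e]
    rw [← Finset.sum_mul]
    have : ∑ i, (if x i = 0 then (1 : ℝ) else 0) = N * magnetization x 0 := by
      rw [magnetization, mul_div_cancel₀ _ hN']
    rw [this]; ring
  have hr : ∑ i : Fin N, ∑ y : Fin N → Fin q, (if y i = s then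
        weight p q β h N y * φ (magnetization (Function.update y i 0) 0) else 0) =
      N * ∑ x : Fin N → Fin q, weight p q β h N x * (magnetization x s *
        φ (magnetization x 0 + 1 / N)) := by
    rw [Finset.sum_comm, Finset.mul_sum]
    refine Finset.sum_congr rfl fun x _ => ?_
    have e : ∀ i, (if x i = s then
        weight p q β h N x * φ (magnetization (Function.update x i 0) 0) else 0) =
        (if x i = s then (1 : ℝ) else 0) * (weight p q β h N x *
          φ (magnetization x 0 + 1 / N)) := by
      intro i
      split_ifs with hx
      · rw [magnetization_update hN, if_pos rfl, hx, if_neg hs, sub_zero, one_mul]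
      · rw [zero_mul]
    simp_rw [e]
    rw [← Finset.sum_mul]
    have : ∑ i, (if x i = s then (1 : ℝ) else 0) = N * magnetization x s := by
      rw [magnetization, mul_div_cancel₀ _ hN']
    rw [this]; ring
  rw [hl, hr] at key
  have key' := mul_left_cancel₀ hN' key
  simp only [pottsMean, prob, div_mul_eq_mul_div]
  rw [← Finset.sum_div, ← Finset.sum_div, key']

end Exchange

/-! ### Second-order expansions and the flip ratio -/

section Taylor

lemma abs_taylor_two_le {f f₁ f₂ : ℝ → ℝ} {w δ M : ℝ}
    (h1 : ∀ x ∈ Set.uIcc w (w + δ), HasDerivAt f (f₁ x) x)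
    (h2 : ∀ x ∈ Set.uIcc w (w + δ), HasDerivAt f₁ (f₂ x) x)
    (hM : ∀ x ∈ Set.uIcc w (w + δ), |f₂ x| ≤ M) :
    |f (w + δ) - f w - δ * f₁ w| ≤ M * δ ^ 2 := by
  have hw : w ∈ Set.uIcc w (w + δ) := Set.left_mem_uIcc
  have hM0 : 0 ≤ M := (abs_nonneg _).trans (hM w hw)
  have hlen : ∀ x ∈ Set.uIcc w (w + δ), |x - w| ≤ |δ| := by
    intro x hx
    have := Set.abs_sub_left_of_mem_uIcc hx
    rwa [add_sub_cancel_left] at this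
  have hstep : ∀ x ∈ Set.uIcc w (w + δ), |f₁ x - f₁ w| ≤ M * |δ| := by
    intro x hx
    have := (convex_uIcc w (w + δ)).norm_image_sub_le_of_norm_hasDerivWithin_le
      (fun y hy => (h2 y hy).hasDerivWithinAt) (fun y hy => hM y hy) hw hx
    exact this.trans (mul_le_mul_of_nonneg_left (hlen x hx) hM0)
  have hd : ∀ y ∈ Set.uIcc w (w + δ),
      HasDerivAt (fun y => f y - (y - w) * f₁ w) (f₁ y - 1 * f₁ w) y := fun y hy =>
    (h1 y hy).sub (((hasDerivAt_id y).sub_const w).mul_const _)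
  have := (convex_uIcc w (w + δ)).norm_image_sub_le_of_norm_hasDerivWithin_le
    (fun y hy => (hd y hy).hasDerivWithinAt) (C := M * |δ|)
    (fun y hy => by rw [one_mul]; exact hstep y hy) hw Set.right_mem_uIcc
  simp only [Real.norm_eq_abs, sub_self, zero_mul, sub_zero, add_sub_cancel_left] at this
  calc |f (w + δ) - f w - δ * f₁ w| = |f (w + δ) - δ * f₁ w - f w| := by congr 1; ring
    _ ≤ M * |δ| * |δ| := this
    _ = M * δ ^ 2 := by rw [mul_assoc, abs_mul_abs_self, sq]

lemma abs_exp_sub_exp_le {u v M : ℝ} (hu : u ≤ M) (hv : v ≤ M) :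
    |Real.exp u - Real.exp v| ≤ Real.exp M * |u - v| :=
  (convex_Iic M).norm_image_sub_le_of_norm_hasDerivWithin_le
    (fun y _ => (Real.hasDerivAt_exp y).hasDerivWithinAt)
    (fun y hy => by
      rw [Real.norm_eq_abs, abs_of_pos (Real.exp_pos _)]; exact Real.exp_le_exp.2 hy) hv hu

lemma exists_abs_pow_increment_le (p : ℕ) :
    ∃ C, 0 ≤ C ∧ ∀ a δ : ℝ, a ∈ Set.Icc (0 : ℝ) 1 → |δ| ≤ 1 →
      |(a + δ) ^ p - a ^ p - δ * (p * a ^ (p - 1))| ≤ C * δ ^ 2 := by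
  refine ⟨p * ((p - 1 : ℕ) * 2 ^ (p - 1 - 1)), by positivity, fun a δ ha hδ => ?_⟩
  refine abs_taylor_two_le (f := fun x => x ^ p) (f₁ := fun x => p * x ^ (p - 1))
    (f₂ := fun x => p * ((p - 1 : ℕ) * x ^ (p - 1 - 1))) (fun x _ => hasDerivAt_pow p x)
    (fun x _ => (hasDerivAt_pow (p - 1) x).const_mul _) fun x hx => ?_
  have h1 : |x| ≤ 2 := by
    have h2 := Set.abs_sub_left_of_mem_uIcc hx
    rw [add_sub_cancel_left] at h2
    have h3 : |x| ≤ |x - a| + |a| := by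
      have := abs_add_le (x - a) a; rwa [sub_add_cancel] at this
    have h4 : |a| ≤ 1 := by rw [abs_of_nonneg ha.1]; exact ha.2
    linarith
  rw [abs_mul, abs_mul, abs_pow, Nat.abs_cast, Nat.abs_cast]
  gcongr

/-- The two exponents differ by at most `2|β|C/N`, since each power increment is linear up to
`C/N²`. Both are bounded by `M`, uniformly in `N`, `a` and `b`, so the exponential is Lipschitz on
the relevant range. -/
lemma exists_abs_flipRatio_sub_le (p : ℕ) (β h : ℝ) :
    ∃ C, 0 ≤ C ∧ ∀ N : ℕ, 0 < N → ∀ a b : ℝ, a ∈ Set.Icc (0 : ℝ) 1 → b ∈ Set.Icc (0 : ℝ) 1 →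
      |flipRatio p β h N a b - Real.exp (β * p * (b ^ (p - 1) - a ^ (p - 1)) - h)| ≤ C / N := by
  obtain ⟨C, hC0, hC⟩ := exists_abs_pow_increment_le p
  set M := |β| * p + |h| + 2 * |β| * C with hM
  refine ⟨Real.exp M * (2 * |β| * C), by positivity, fun N hN a b ha hb => ?_⟩
  have hN' : (1 : ℝ) ≤ N := by exact_mod_cast hN
  have hN0 : (0 : ℝ) < N := by positivity
  have hδ : |(1 : ℝ) / N| ≤ 1 := by
    rw [abs_of_pos (by positivity)]; exact (div_le_one hN0).2 hN'
  set u := β * N * ((b + 1 / N) ^ p - b ^ p + ((a - 1 / N) ^ p - a ^ p)) - h with hu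
  set v := β * p * (b ^ (p - 1) - a ^ (p - 1)) - h with hv
  have h1 := hC b (1 / N) hb hδ
  have h2 := hC a (-(1 / N)) ha (by rwa [abs_neg])
  have huv : |u - v| ≤ 2 * |β| * C / N := by
    have e : u - v = β * N * (((b + 1 / N) ^ p - b ^ p - 1 / N * (p * b ^ (p - 1))) +
        ((a + -(1 / N)) ^ p - a ^ p - -(1 / N) * (p * a ^ (p - 1)))) := by
      rw [hu, hv, ← sub_eq_add_neg]; field_simp; ring
    rw [e, abs_mul, abs_mul, Nat.abs_cast]
    calc _ ≤ |β| * N * (C * (1 / N) ^ 2 + C * (-(1 / N)) ^ 2) := by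
          gcongr; exact (abs_add_le _ _).trans (add_le_add h1 h2)
      _ = _ := by field_simp; ring
  have hvM : v ≤ |β| * p + |h| := by
    have hb1 : |b ^ (p - 1) - a ^ (p - 1)| ≤ 1 := by
      have := pow_le_one₀ (n := p - 1) hb.1 hb.2
      have := pow_le_one₀ (n := p - 1) ha.1 ha.2
      have := pow_nonneg hb.1 (p - 1)
      have := pow_nonneg ha.1 (p - 1)
      rw [abs_le]; constructor <;> linarith
    have h3 : β * p * (b ^ (p - 1) - a ^ (p - 1)) ≤ |β| * p * 1 := by
      refine (le_abs_self _).trans ?_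
      rw [abs_mul, abs_mul, Nat.abs_cast]; gcongr
    have := neg_abs_le h
    rw [hv]; linarith
  have hdiv : 2 * |β| * C / N ≤ 2 * |β| * C := div_le_self (by positivity) hN'
  have huM : u ≤ M := by
    have := (le_abs_self _).trans huv
    rw [hM]; linarith
  have hvM' : v ≤ M := by
    have : 0 ≤ 2 * |β| * C := by positivity
    rw [hM]; linarith
  calc |flipRatio p β h N a b - Real.exp v| ≤ Real.exp M * |u - v| := abs_exp_sub_exp_le huM hvM'
    _ ≤ Real.exp M * (2 * |β| * C / N) := by gcongr
    _ = _ := by ring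

end Taylor

/-! ### Axis and transverse coordinates on the simplex -/

section Coordinates
variable {q : ℕ} [NeZero q]

/-- Coordinate along `uvec q` of a probability vector, measured from `xvec q s`. -/
def axisCoord (q : ℕ) [NeZero q] (s : ℝ) (t : Fin q → ℝ) : ℝ := (t 0 - xvec q s 0) / (1 - q)

/-- Squared distance of a probability vector to the line spanned by `uvec q`. -/
def transverseSq (q : ℕ) [NeZero q] (t : Fin q → ℝ) : ℝ :=
  ∑ r ∈ Finset.univ.erase 0, (t r - (1 - t 0) / (q - 1)) ^ 2

/-- Mean flow from color `0` to the other colors. -/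
def drift (p q : ℕ) [NeZero q] (β h : ℝ) (t : Fin q → ℝ) : ℝ :=
  ∑ r ∈ Finset.univ.erase 0,
    (t 0 * Real.exp (β * p * (t r ^ (p - 1) - t 0 ^ (p - 1)) - h) - t r)

lemma transverseSq_nonneg (t : Fin q → ℝ) : 0 ≤ transverseSq q t :=
  Finset.sum_nonneg fun _ _ => sq_nonneg _

/-- For probability vectors this identifies `(1-s)/q + axisCoord q s t` as the average of the
coordinates other than 0, the reference value used throughout for those coordinates. -/
lemma one_sub_eq_of_axisCoord (hq : 2 ≤ q) (s : ℝ) (t : Fin q → ℝ) :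
    1 - t 0 = (q - 1) * ((1 - s) / q + axisCoord q s t) := by
  have h1 : (2 : ℝ) ≤ q := by exact_mod_cast hq
  have h2 : (1 : ℝ) - q ≠ 0 := by linarith
  have h3 : (q : ℝ) ≠ 0 := by linarith
  have h4 : ((q : ℝ) - 1) * ((t 0 - xvec q s 0) / (1 - q)) = -(t 0 - xvec q s 0) := by
    field_simp; ring
  rw [axisCoord, mul_add, h4, xvec, if_pos rfl]
  field_simp
  ring

lemma sum_erase_eq {t : Fin q → ℝ} (ht : ∑ r, t r = 1) :
    ∑ r ∈ Finset.univ.erase 0, t r = 1 - t 0 := by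
  have := Finset.add_sum_erase Finset.univ t (Finset.mem_univ 0)
  linarith

end Coordinates

/-! ### Expectation under the model -/

section pottsMean
variable {p q N : ℕ} [NeZero q] {β h : ℝ}

lemma pottsMean_mono {f g : (Fin N → Fin q) → ℝ} (hfg : ∀ x, f x ≤ g x) :
    pottsMean p q β h N f ≤ pottsMean p q β h N g :=
  Finset.sum_le_sum fun x _ => mul_le_mul_of_nonneg_left (hfg x) (prob_nonneg β h x)

lemma pottsMean_const_mul (a : ℝ) (f : (Fin N → Fin q) → ℝ) :
    pottsMean p q β h N (fun x => a * f x) = a * pottsMean p q β h N f := by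
  rw [pottsMean, pottsMean, Finset.mul_sum]
  exact Finset.sum_congr rfl fun x _ => by ring

lemma pottsMean_add (f g : (Fin N → Fin q) → ℝ) :
    pottsMean p q β h N (fun x => f x + g x) = pottsMean p q β h N f + pottsMean p q β h N g := by
  simp_rw [pottsMean, mul_add, Finset.sum_add_distrib]

lemma pottsMean_sub (f g : (Fin N → Fin q) → ℝ) :
    pottsMean p q β h N (fun x => f x - g x) = pottsMean p q β h N f - pottsMean p q β h N g := by
  simp_rw [pottsMean, mul_sub, Finset.sum_sub_distrib]

lemma pottsMean_const (a : ℝ) : pottsMean p q β h N (fun _ => a) = a := by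
  rw [pottsMean, ← Finset.sum_mul, sum_prob_eq_one, one_mul]

lemma pottsMean_sum {ι : Type*} (S : Finset ι) (f : ι → (Fin N → Fin q) → ℝ) :
    pottsMean p q β h N (fun x => ∑ i ∈ S, f i x) = ∑ i ∈ S, pottsMean p q β h N (f i) := by
  simp_rw [pottsMean, Finset.mul_sum]
  exact Finset.sum_comm

lemma abs_pottsMean_le {f g : (Fin N → Fin q) → ℝ} (hfg : ∀ x, |f x| ≤ g x) :
    |pottsMean p q β h N f| ≤ pottsMean p q β h N g := by
  refine (Finset.abs_sum_le_sum_abs _ _).trans (Finset.sum_le_sum fun x _ => ?_)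
  rw [abs_mul, abs_of_nonneg (prob_nonneg β h x)]
  exact mul_le_mul_of_nonneg_left (hfg x) (prob_nonneg β h x)

lemma pottsMean_nonneg {f : (Fin N → Fin q) → ℝ} (hf : ∀ x, 0 ≤ f x) :
    0 ≤ pottsMean p q β h N f :=
  Finset.sum_nonneg fun x _ => mul_nonneg (prob_nonneg β h x) (hf x)

lemma pottsMean_pow_le {f : (Fin N → Fin q) → ℝ} (hf : ∀ x, 0 ≤ f x) (n : ℕ) :
    pottsMean p q β h N f ^ n ≤ pottsMean p q β h N fun x => f x ^ n := by
  have := (convexOn_pow (𝕜 := ℝ) n).map_sum_le (t := Finset.univ) (w := prob p q β h N)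
    (p := f) (fun x _ => prob_nonneg β h x) (sum_prob_eq_one β h) (fun x _ => hf x)
  simp only [smul_eq_mul] at this
  exact this

end pottsMean

/-! ### Pointwise estimates for the Stein remainder -/

lemma le_one_add_even_pow' {k : ℕ} (hk : 2 ≤ k) (y : ℝ) : |y| ≤ 1 + y ^ (2 * k) := by
  have h := le_one_add_even_pow hk y
  have h0 : 0 ≤ y ^ (2 * k) := by rw [pow_mul]; positivity
  rcases le_total |y| 1 with h1 | h1
  · linarith
  · have : |y| ≤ |y| ^ (2 * k) := le_self_pow₀ h1 (by omega)
    rw [(even_two_mul k).pow_abs] at this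
    linarith

/-- Half of the exponent `c (w^(2k) + Y)` pays for the polynomial factor and the other half for `exp
(K|w|)`. -/
lemma exists_mul_exp_le {c : ℝ} (hc : 0 < c) {k : ℕ} (hk : 2 ≤ k) (K : ℝ) :
    ∃ C, 0 ≤ C ∧ ∀ w Y Δ : ℝ, 0 ≤ Y → c * (w ^ (2 * k) + Y) ≤ Δ →
      (1 + w ^ (2 * k) + Y) * Real.exp (K * |w|) ≤ C * Real.exp Δ := by
  have hc2 : 0 < c / 2 := by positivity
  obtain ⟨C, hC⟩ := exists_linear_sub_even_pow_le hc2 hk K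
  refine ⟨(1 + 2 / c) * Real.exp C, by positivity, fun w Y Δ hY hΔ => ?_⟩
  have hw : 0 ≤ w ^ (2 * k) := by rw [pow_mul]; positivity
  set T := w ^ (2 * k) + Y with hT
  have hT0 : 0 ≤ T := by positivity
  have h1 : 1 + w ^ (2 * k) + Y ≤ (1 + 2 / c) * Real.exp (c / 2 * T) := by
    have h2 := Real.add_one_le_exp (c / 2 * T)
    have h3 : (1 + 2 / c) * (c / 2 * T + 1) = 1 + T + (2 / c + c / 2 * T) := by
      field_simp; ring
    have h4 : (1 + 2 / c) * (c / 2 * T + 1) ≤ (1 + 2 / c) * Real.exp (c / 2 * T) := by gcongr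
    have : 0 ≤ 2 / c + c / 2 * T := by positivity
    linarith
  have h2 : K * |w| ≤ C + c / 2 * T := by
    have h5 := hC w
    have h6 : c / 2 * w ^ (2 * k) ≤ c / 2 * T := by gcongr; linarith
    nlinarith [sq_nonneg w]
  calc (1 + w ^ (2 * k) + Y) * Real.exp (K * |w|)
      ≤ ((1 + 2 / c) * Real.exp (c / 2 * T)) * Real.exp (C + c / 2 * T) := by gcongr
    _ = (1 + 2 / c) * Real.exp C * Real.exp (c * T) := by
        rw [mul_assoc, mul_assoc, ← Real.exp_add, ← Real.exp_add]; congr 2; ring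
    _ ≤ _ := by gcongr

/-- The flow identity, read at one sample, is `-m₁ ε^(2k-1)` times the Stein operator, with an error
of the next order `ε^(2k)`. The three constants come from the drift error (`C K`), from `1 - t₀`
differing from `Q m₁` by `Q ε W` (`K`), and from the Taylor remainder of the Stein solution (`K exp
K`). -/
lemma stein_remainder_le {ε W t₀ m₁ Q D C K c Y a a' a₁ g₀ : ℝ} {k : ℕ} (hk : 2 ≤ k)
    (hε : 0 < ε) (hε1 : ε ≤ 1) (hQ : 1 ≤ Q) (hY : 0 ≤ Y) (hK : 0 ≤ K)
    (ht : 1 - t₀ = Q * (m₁ + ε * W)) (ht0 : 0 ≤ t₀) (ht1 : t₀ ≤ 1)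
    (hD : |D + 2 * k * c * m₁ * (ε * W) ^ (2 * k - 1)| ≤ C * (ε ^ (2 * k) * (1 + W ^ (2 * k) + Y)))
    (ha : |a| ≤ K * Real.exp (K * |W|)) (ha₁ : |a₁| ≤ K * Real.exp (K * |W|))
    (ha' : |a' - a - (-ε ^ (2 * k - 1) / Q) * a₁| ≤
      K * Real.exp (K * (|W| + 1)) * (-ε ^ (2 * k - 1) / Q) ^ 2)
    (hg : a₁ - 2 * k * c * W ^ (2 * k - 1) * a = g₀) :
    |(1 - t₀) * (a' - a) - D * a + m₁ * ε ^ (2 * k - 1) * g₀| ≤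
      ε ^ (2 * k) * ((C * K + K + K * Real.exp K) *
        ((1 + W ^ (2 * k) + Y) * Real.exp (K * |W|))) := by
  have hQ0 : 0 < Q := by linarith
  set E := Real.exp (K * |W|) with hE
  have hE0 : 0 < E := Real.exp_pos _
  have hW : 0 ≤ W ^ (2 * k) := by rw [pow_mul]; positivity
  set T := 1 + W ^ (2 * k) + Y with hT
  have hT1 : 1 ≤ T := by linarith
  have hWT : |W| ≤ T := (le_one_add_even_pow' hk W).trans (by linarith)
  have hpow : ε ^ (2 * k - 1) * ε = ε ^ (2 * k) := by rw [← pow_succ]; congr 1; omega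
  have e : (1 - t₀) * (a' - a) - D * a + m₁ * ε ^ (2 * k - 1) * g₀ =
      (1 - t₀) * (a' - a - (-ε ^ (2 * k - 1) / Q) * a₁) + -(ε ^ (2 * k) * W * a₁) +
      -((D + 2 * k * c * m₁ * (ε * W) ^ (2 * k - 1)) * a) := by
    have h1 : (1 - t₀) * (-ε ^ (2 * k - 1) / Q) = -(m₁ * ε ^ (2 * k - 1)) - ε ^ (2 * k) * W := by
      rw [ht, ← hpow]; field_simp; ring
    rw [← hg, mul_pow]
    linear_combination (a₁) * h1
  have b1 : |(1 - t₀) * (a' - a - (-ε ^ (2 * k - 1) / Q) * a₁)| ≤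
      ε ^ (2 * k) * (K * Real.exp K * (T * E)) := by
    rw [abs_mul, abs_of_nonneg (by linarith : (0 : ℝ) ≤ 1 - t₀)]
    -- The squared increment has order `ε^(2(2k-1))`, and `2(2k-1) ≥ 2k`.
    have h2 : (-ε ^ (2 * k - 1) / Q) ^ 2 ≤ ε ^ (2 * k) := by
      rw [div_pow, neg_sq]
      calc (ε ^ (2 * k - 1)) ^ 2 / Q ^ 2 ≤ (ε ^ (2 * k - 1)) ^ 2 :=
            div_le_self (by positivity) (one_le_pow₀ hQ)
        _ = ε ^ ((2 * k - 1) * 2) := (pow_mul _ _ _).symm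
        _ ≤ ε ^ (2 * k) := pow_le_pow_of_le_one hε.le hε1 (by omega)
    have h3 : Real.exp (K * (|W| + 1)) = Real.exp K * E := by
      rw [hE, ← Real.exp_add]; congr 1; ring
    rw [h3] at ha'
    calc (1 - t₀) * |a' - a - (-ε ^ (2 * k - 1) / Q) * a₁|
        ≤ 1 * (K * (Real.exp K * E) * (-ε ^ (2 * k - 1) / Q) ^ 2) := by
          gcongr
          linarith
      _ ≤ 1 * (K * (Real.exp K * E) * ε ^ (2 * k)) := by gcongr
      _ = ε ^ (2 * k) * (K * Real.exp K * (1 * E)) := by ring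
      _ ≤ _ := by gcongr
  have b2 : |-(ε ^ (2 * k) * W * a₁)| ≤ ε ^ (2 * k) * (K * (T * E)) := by
    rw [abs_neg, abs_mul, abs_mul, abs_of_pos (by positivity : 0 < ε ^ (2 * k))]
    calc ε ^ (2 * k) * |W| * |a₁| ≤ ε ^ (2 * k) * T * (K * E) := by gcongr
      _ = _ := by ring
  have b3 : |-((D + 2 * k * c * m₁ * (ε * W) ^ (2 * k - 1)) * a)| ≤
      ε ^ (2 * k) * (C * K * (T * E)) := by
    rw [abs_neg, abs_mul]
    calc _ ≤ C * (ε ^ (2 * k) * T) * (K * E) :=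
          mul_le_mul hD ha (abs_nonneg _) ((abs_nonneg _).trans hD)
      _ = _ := by ring
  rw [e]
  refine (abs_add_three _ _ _).trans ((add_le_add (add_le_add b1 b2) b3).trans (le_of_eq ?_))
  ring

/-! ### Scaling and exponential moments of the fluctuation -/

section Convergence
variable {p q : ℕ} [NeZero q] {β h s c : ℝ} {k : ℕ}

/-- The scale of the magnetization fluctuations. -/
def fluctScale (k N : ℕ) : ℝ := (N : ℝ) ^ ((2 * k : ℝ)⁻¹)

lemma fluctScale_pow (hk : 2 ≤ k) (N : ℕ) : fluctScale k N ^ (2 * k) = N := by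
  have := Real.rpow_inv_natCast_pow (Nat.cast_nonneg N) (show 2 * k ≠ 0 by omega)
  simpa [fluctScale] using this

lemma fluctScale_pos {N : ℕ} (hN : 0 < N) : 0 < fluctScale k N := by
  unfold fluctScale; positivity

lemma one_le_fluctScale {N : ℕ} (hN : 0 < N) : 1 ≤ fluctScale k N :=
  Real.one_le_rpow (by exact_mod_cast hN) (by positivity)

lemma tendsto_fluctScale (hk : 2 ≤ k) : Tendsto (fluctScale k) atTop atTop :=
  (tendsto_rpow_atTop (by positivity)).comp tendsto_natCast_atTop_atTop

/-- Rescaled fluctuation of the magnetization along `uvec q`. -/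
def fluct (k : ℕ) (s : ℝ) {N : ℕ} (x : Fin N → Fin q) : ℝ :=
  fluctScale k N * axisCoord q s (magnetization x)

lemma xvec_pos (hs : s ∈ Set.Ico (0 : ℝ) 1) (r : Fin q) : 0 < xvec q s r := by
  have hq : (1 : ℝ) ≤ q := by exact_mod_cast NeZero.one_le
  have h0 := hs.1
  have h1 := hs.2
  unfold xvec
  split_ifs
  · refine div_pos ?_ (by linarith)
    nlinarith
  · exact div_pos (by linarith) (by linarith)

lemma sum_xvec (q : ℕ) [NeZero q] (s : ℝ) : ∑ r, xvec q s r = 1 := by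
  have hq : (1 : ℝ) ≤ q := by exact_mod_cast NeZero.one_le
  rw [← Finset.add_sum_erase Finset.univ _ (Finset.mem_univ 0)]
  have : ∑ r ∈ Finset.univ.erase 0, xvec q s r = ∑ r ∈ Finset.univ.erase (0 : Fin q), (1 - s) / q :=
    Finset.sum_congr rfl fun r hr => if_neg (Finset.ne_of_mem_erase hr)
  rw [this, Finset.sum_const, Finset.card_erase_of_mem (Finset.mem_univ _), Finset.card_univ,
    Fintype.card_fin, nsmul_eq_mul, xvec, if_pos rfl, Nat.cast_sub NeZero.one_le]
  have : (q : ℝ) ≠ 0 := by linarith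
  field_simp
  push_cast
  ring

/-- By coercivity the integrand is at most a constant times `exp (Δ/n)`, with `Δ` being `N` times
the deficit. Jensen for the `n`-th power reduces this to the exponential moment of `Δ`, so the
polynomial bound `(N+1)^q` enters only through its `n`-th root. -/
lemma exists_pottsMean_moment_le (hβ : 0 ≤ β) (hs : s ∈ Set.Ico (0 : ℝ) 1) (hk : 2 ≤ k) {c' : ℝ}
    (hc' : 0 < c')
    (hcoer : ∀ t ∈ stdSimplex ℝ (Fin q), c' * (axisCoord q s t ^ (2 * k) + transverseSq q t) ≤
      freeEnergy p q β h (xvec q s) - freeEnergy p q β h t) (K : ℝ) {n : ℕ} (hn : n ≠ 0) :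
    ∃ C, 0 ≤ C ∧ ∀ N : ℕ, 0 < N → pottsMean p q β h N (fun x =>
      (1 + fluct k s x ^ (2 * k) + N * transverseSq q (magnetization x)) *
        Real.exp (K * |fluct k s x|)) ≤ C * (((N : ℝ) + 1) ^ q) ^ ((n : ℝ)⁻¹) := by
  have hn0 : (0 : ℝ) < n := by positivity
  obtain ⟨C, hC0, hC⟩ := exists_mul_exp_le (show 0 < c' / n by positivity) hk K
  refine ⟨C, hC0, fun N hN => ?_⟩
  set Δ : (Fin N → Fin q) → ℝ := fun x =>
    N * (freeEnergy p q β h (xvec q s) - freeEnergy p q β h (magnetization x)) with hΔ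
  have h1 : pottsMean p q β h N (fun x =>
      (1 + fluct k s x ^ (2 * k) + N * transverseSq q (magnetization x)) *
        Real.exp (K * |fluct k s x|)) ≤
      pottsMean p q β h N (fun x => C * Real.exp (Δ x / n)) := by
    refine pottsMean_mono fun x => hC _ _ _
      (mul_nonneg (Nat.cast_nonneg _) (transverseSq_nonneg _)) ?_
    rw [div_mul_eq_mul_div]
    refine div_le_div_of_nonneg_right ?_ hn0.le
    have := mul_le_mul_of_nonneg_left (hcoer _ (magnetization_mem_stdSimplex hN x))
      (Nat.cast_nonneg (α := ℝ) N)
    rw [hΔ]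
    refine le_trans (le_of_eq ?_) this
    rw [fluct, mul_pow, fluctScale_pow hk]; ring
  refine h1.trans ?_
  rw [pottsMean_const_mul]
  refine mul_le_mul_of_nonneg_left ?_ hC0
  have h2 : pottsMean p q β h N (fun x => Real.exp (Δ x / n)) ^ n ≤ ((N : ℝ) + 1) ^ q := by
    refine (pottsMean_pow_le (fun x => (Real.exp_pos _).le) n).trans ?_
    refine le_trans (le_of_eq ?_) (pottsMean_exp_deficit_le (p := p) hN hβ h (xvec_pos hs)
      (sum_xvec q s))
    congr 1; ext x
    rw [← Real.exp_nat_mul, mul_div_cancel₀ _ hn0.ne']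
  have h0 : 0 ≤ pottsMean p q β h N (fun x => Real.exp (Δ x / n)) :=
    pottsMean_nonneg fun x => (Real.exp_pos _).le
  rw [← Real.pow_rpow_inv_natCast h0 hn]
  exact Real.rpow_le_rpow (by positivity) h2 (by positivity)

end Convergence

lemma magnetization_mem_Icc {q N : ℕ} (hN : 0 < N) (x : Fin N → Fin q) (r : Fin q) :
    magnetization x r ∈ Set.Icc (0 : ℝ) 1 :=
  ⟨magnetization_nonneg x r, by
    rw [← sum_magnetization hN x]
    exact Finset.single_le_sum (fun i _ => magnetization_nonneg x i) (Finset.mem_univ r)⟩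

/-- With `n = 4kq` the moment factor grows like `N^(1/(4k))`, half the exponent of the scale
`N^(1/(2k))`. -/
lemma tendsto_inv_fluctScale_mul {q k : ℕ} (hk : 2 ≤ k) (hq : 2 ≤ q) :
    Tendsto (fun N : ℕ => (fluctScale k N)⁻¹ *
      (((N : ℝ) + 1) ^ q) ^ (((4 * k * q : ℕ) : ℝ)⁻¹)) atTop (𝓝 0) := by
  have hn : 4 * k * q ≠ 0 := by positivity
  have e : ∀ᶠ N : ℕ in atTop, ((1 / (N : ℝ) + (1 / (N : ℝ)) ^ 2) ^ q) ^ (((4 * k * q : ℕ) : ℝ)⁻¹) =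
      (fluctScale k N)⁻¹ * (((N : ℝ) + 1) ^ q) ^ (((4 * k * q : ℕ) : ℝ)⁻¹) := by
    filter_upwards [eventually_gt_atTop 0] with N hN
    have hN0 : (0 : ℝ) < N := by exact_mod_cast hN
    have h1 : 0 ≤ (fluctScale k N)⁻¹ := (inv_pos.2 (fluctScale_pos hN)).le
    rw [← Real.pow_rpow_inv_natCast h1 hn, ← Real.mul_rpow (by positivity) (by positivity)]
    congr 1
    have h2 : (fluctScale k N)⁻¹ ^ (4 * k * q) = ((1 / (N : ℝ)) ^ 2) ^ q := by
      rw [show 4 * k * q = (2 * k) * 2 * q by ring, pow_mul, pow_mul, inv_pow, fluctScale_pow hk,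
        one_div]
    rw [h2, ← mul_pow]
    congr 1
    field_simp
  refine Tendsto.congr' e ?_
  have h1 : Tendsto (fun N : ℕ => (1 / (N : ℝ) + (1 / (N : ℝ)) ^ 2) ^ q) atTop (𝓝 0) := by
    have h2 := tendsto_one_div_atTop_nhds_zero_nat (𝕜 := ℝ)
    have h3 := (h2.add (h2.pow 2)).pow q
    rwa [zero_pow two_ne_zero, add_zero, zero_pow (by omega)] at h3
  have h4 := h1.rpow_const (p := ((4 * k * q : ℕ) : ℝ)⁻¹) (Or.inr (by positivity))
  rwa [Real.zero_rpow (by positivity)] at h4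

/-! ### Convergence of the fluctuation by Stein's method -/

section Convergence
variable {p q : ℕ} [NeZero q] {β h s c : ℝ} {k : ℕ}

lemma axisCoord_eq_div_mul {N : ℕ} (hN : 0 < N) (x : Fin N → Fin q) :
    axisCoord q s (magnetization x) = (fluctScale k N)⁻¹ * fluct k s x := by
  rw [fluct, inv_mul_cancel_left₀ (fluctScale_pos hN).ne']

/-- Summing detailed balance over the colors other than 0 and splitting `φ (m₀ + 1/N)` into `φ m₀`
plus an increment exhibits a discrete derivative term and a drift term. -/
lemma pottsMean_flow_identity {N : ℕ} (hN : 0 < N) (φ : ℝ → ℝ) :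
    pottsMean p q β h N (fun x => (1 - magnetization x 0) * (φ (magnetization x 0 + 1 / N) -
      φ (magnetization x 0)) - (∑ r ∈ Finset.univ.erase 0, (magnetization x 0 *
        flipRatio p β h N (magnetization x 0) (magnetization x r) - magnetization x r)) *
        φ (magnetization x 0)) = 0 := by
  have e : ∀ x : Fin N → Fin q, (1 - magnetization x 0) * (φ (magnetization x 0 + 1 / N) -
      φ (magnetization x 0)) - (∑ r ∈ Finset.univ.erase 0, (magnetization x 0 *
        flipRatio p β h N (magnetization x 0) (magnetization x r) - magnetization x r)) *
        φ (magnetization x 0) =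
      ∑ r ∈ Finset.univ.erase 0, (magnetization x r * φ (magnetization x 0 + 1 / N) -
        magnetization x 0 * flipRatio p β h N (magnetization x 0) (magnetization x r) *
          φ (magnetization x 0)) := by
    intro x
    rw [← sum_erase_eq (sum_magnetization hN x), Finset.sum_mul, Finset.sum_mul,
      ← Finset.sum_sub_distrib]
    exact Finset.sum_congr rfl fun r _ => by ring
  simp_rw [e]
  rw [pottsMean_sum]
  refine Finset.sum_eq_zero fun r hr => ?_
  rw [pottsMean_sub, pottsMean_exchange hN β h (Finset.ne_of_mem_erase hr), sub_self]

/-- Quantitative convergence of the expectation of a test function, by Stein's method. -/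
lemma exists_abs_pottsMean_sub_le (hq : 2 ≤ q) (hβ : 0 ≤ β) (hs : s ∈ Set.Ico (0 : ℝ) 1)
    (hk : 2 ≤ k) (hc : 0 < c) {c' : ℝ} (hc' : 0 < c')
    (hcoer : ∀ t ∈ stdSimplex ℝ (Fin q), c' * (axisCoord q s t ^ (2 * k) + transverseSq q t) ≤
      freeEnergy p q β h (xvec q s) - freeEnergy p q β h t) {C₁ : ℝ}
    (hdrift : ∀ t ∈ stdSimplex ℝ (Fin q),
      |drift p q β h t + 2 * k * c * ((1 - s) / q) * axisCoord q s t ^ (2 * k - 1)| ≤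
        C₁ * (axisCoord q s t ^ (2 * k) + transverseSq q t))
    {g g' : ℝ → ℝ} (hg : ∀ x, HasDerivAt g (g' x) x) (hgg : ExpGrowth g) (hgg' : ExpGrowth g')
    {n : ℕ} (hn : n ≠ 0) :
    ∃ C, ∀ N : ℕ, 0 < N →
      |pottsMean p q β h N (fun x => g (fluct k s x)) - ∫ y, g y ∂(evenLaw c k)| ≤
        C * ((fluctScale k N)⁻¹ * (((N : ℝ) + 1) ^ q) ^ ((n : ℝ)⁻¹)) := by
  obtain ⟨φ, φ₁, φ₂, hφ, hφ₁, gφ, gφ₁, gφ₂, hst⟩ := exists_stein_solution hc hk hg hgg hgg'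
  obtain ⟨K, hK, hb⟩ := (gφ.abs.add gφ₁.abs).add gφ₂.abs
  have hb' : ∀ x, |φ x| + |φ₁ x| + |φ₂ x| ≤ K * Real.exp (K * |x|) := fun x =>
    (le_abs_self _).trans (hb x)
  obtain ⟨Cf, hCf0, hCf⟩ := exists_abs_flipRatio_sub_le p β h
  set C₂ : ℝ := |C₁| + q * Cf with hC₂
  obtain ⟨M, hM0, hM⟩ := exists_pottsMean_moment_le (p := p) (β := β) (h := h) hβ hs hk hc' hcoer K hn
  have hq1 : (2 : ℝ) ≤ q := by exact_mod_cast hq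
  have hm₁ : 0 < (1 - s) / q := div_pos (by linarith [hs.2]) (by linarith)
  set L := C₂ * K + K + K * Real.exp K with hL
  have hL0 : 0 ≤ L := by positivity
  refine ⟨L * M / ((1 - s) / q), fun N hN => ?_⟩
  have hN1 : (1 : ℝ) ≤ N := by exact_mod_cast hN
  have hN0 : (0 : ℝ) < N := by positivity
  set ε := (fluctScale k N)⁻¹ with hε
  have hε0 : 0 < ε := inv_pos.2 (fluctScale_pos hN)
  have hε1 : ε ≤ 1 := inv_le_one_of_one_le₀ (one_le_fluctScale hN)
  have hεN : ε ^ (2 * k) = 1 / N := by rw [hε, inv_pow, fluctScale_pow hk, one_div]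
  set I := ∫ y, g y ∂(evenLaw c k) with hI
  -- The Stein solution as a function of the magnetization of color 0. Raising that magnetization by
  -- `1/N` moves the rescaled coordinate by `δ`, which is negative because the axis vector has first
  -- entry `1 - q`.
  set Φ : ℝ → ℝ := fun a => φ (fluctScale k N * ((a - xvec q s 0) / (1 - q))) with hΦ
  set δ := -ε ^ (2 * k - 1) / ((q : ℝ) - 1) with hδ
  have hδ1 : |δ| ≤ 1 := by
    rw [hδ, abs_div, abs_neg, abs_of_pos (by positivity), abs_of_pos (by linarith : (0 : ℝ) < q - 1)]
    rw [div_le_one (by linarith)]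
    exact (pow_le_one₀ hε0.le hε1).trans (by linarith)
  have hpoint : ∀ x : Fin N → Fin q,
      |((1 - magnetization x 0) * (Φ (magnetization x 0 + 1 / N) -
      Φ (magnetization x 0)) - (∑ r ∈ Finset.univ.erase 0, (magnetization x 0 *
        flipRatio p β h N (magnetization x 0) (magnetization x r) - magnetization x r)) *
        Φ (magnetization x 0)) + (1 - s) / q * ε ^ (2 * k - 1) * (g (fluct k s x) - I)| ≤
      ε ^ (2 * k) * L * ((1 + fluct k s x ^ (2 * k) + N * transverseSq q (magnetization x)) *
        Real.exp (K * |fluct k s x|)) := by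
    intro x
    set t := magnetization x with ht
    have htS : t ∈ stdSimplex ℝ (Fin q) := magnetization_mem_stdSimplex hN x
    set W := fluct k s x with hW
    have hXW : axisCoord q s t = ε * W := axisCoord_eq_div_mul hN x
    have hΦ0 : Φ (t 0) = φ W := rfl
    have hΦ1 : Φ (t 0 + 1 / N) = φ (W + δ) := by
      rw [hΦ]; simp only []
      congr 1
      rw [hW, fluct, axisCoord, ← ht]
      have h1 : fluctScale k N * (1 / N) = ε ^ (2 * k - 1) := by
        rw [← hεN]
        have : ε ^ (2 * k) = ε * ε ^ (2 * k - 1) := by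
          rw [← pow_succ']; congr 1; omega
        rw [this, ← mul_assoc, hε, mul_inv_cancel₀ (fluctScale_pos hN).ne', one_mul]
      rw [hδ, ← h1]
      have h2 : (1 : ℝ) - q ≠ 0 := by linarith
      have h3 : (q : ℝ) - 1 ≠ 0 := by linarith
      field_simp
      ring
    have hD : |(∑ r ∈ Finset.univ.erase 0, (t 0 * flipRatio p β h N (t 0) (t r) - t r)) +
        2 * k * c * ((1 - s) / q) * (ε * W) ^ (2 * k - 1)| ≤
        C₂ * (ε ^ (2 * k) * (1 + W ^ (2 * k) + N * transverseSq q t)) := by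
      have h1 := hdrift t htS
      rw [hXW] at h1
      have h2 : |(∑ r ∈ Finset.univ.erase 0, (t 0 * flipRatio p β h N (t 0) (t r) - t r)) -
          drift p q β h t| ≤ q * Cf * (1 / N) := by
        rw [drift, ← Finset.sum_sub_distrib]
        refine (Finset.abs_sum_le_sum_abs _ _).trans ?_
        have h3 : ∀ r ∈ Finset.univ.erase (0 : Fin q),
            |t 0 * flipRatio p β h N (t 0) (t r) - t r -
              (t 0 * Real.exp (β * p * (t r ^ (p - 1) - t 0 ^ (p - 1)) - h) - t r)| ≤
              Cf / N := by
          intro r _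
          have h4 := hCf N hN (t 0) (t r) (magnetization_mem_Icc hN x 0)
            (magnetization_mem_Icc hN x r)
          have e : t 0 * flipRatio p β h N (t 0) (t r) - t r -
              (t 0 * Real.exp (β * p * (t r ^ (p - 1) - t 0 ^ (p - 1)) - h) - t r) =
              t 0 * (flipRatio p β h N (t 0) (t r) -
                Real.exp (β * p * (t r ^ (p - 1) - t 0 ^ (p - 1)) - h)) := by ring
          rw [e, abs_mul, abs_of_nonneg (magnetization_nonneg x 0)]
          calc _ ≤ 1 * (Cf / N) := by
                gcongr
                exact (magnetization_mem_Icc hN x 0).2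
            _ = _ := one_mul _
        refine (Finset.sum_le_card_nsmul _ _ _ h3).trans ?_
        rw [nsmul_eq_mul]
        have h5 : ((Finset.univ.erase (0 : Fin q)).card : ℝ) ≤ q := by
          have := Finset.card_erase_le (s := (Finset.univ : Finset (Fin q))) (a := 0)
          rw [Finset.card_univ, Fintype.card_fin] at this
          exact_mod_cast this
        calc _ ≤ (q : ℝ) * (Cf / N) := by gcongr
          _ = _ := by ring
      have hW0 : 0 ≤ W ^ (2 * k) := by rw [pow_mul]; positivity
      have hY0 := transverseSq_nonneg t
      have h6 : (ε * W) ^ (2 * k) + transverseSq q t =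
          ε ^ (2 * k) * (W ^ (2 * k) + N * transverseSq q t) := by
        rw [mul_pow, mul_add, hεN]; field_simp
      rw [h6] at h1
      have h7 : C₁ * (ε ^ (2 * k) * (W ^ (2 * k) + N * transverseSq q t)) ≤
          |C₁| * (ε ^ (2 * k) * (1 + W ^ (2 * k) + N * transverseSq q t)) := by
        refine (mul_le_mul_of_nonneg_right (le_abs_self C₁) (by positivity)).trans ?_
        gcongr
        linarith
      have h8 : q * Cf * (1 / N) ≤
          q * Cf * (ε ^ (2 * k) * (1 + W ^ (2 * k) + N * transverseSq q t)) := by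
        rw [← hεN]
        refine mul_le_mul_of_nonneg_left (le_mul_of_one_le_right (by positivity) ?_) (by positivity)
        have : 0 ≤ N * transverseSq q t := by positivity
        linarith
      have e : (∑ r ∈ Finset.univ.erase 0, (t 0 * flipRatio p β h N (t 0) (t r) - t r)) +
          2 * k * c * ((1 - s) / q) * (ε * W) ^ (2 * k - 1) =
          ((∑ r ∈ Finset.univ.erase 0, (t 0 * flipRatio p β h N (t 0) (t r) - t r)) -
            drift p q β h t) +
          (drift p q β h t + 2 * k * c * ((1 - s) / q) * (ε * W) ^ (2 * k - 1)) := by ring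
      rw [e, hC₂, add_mul]
      refine (abs_add_le _ _).trans ?_
      linarith
    rw [hΦ0, hΦ1]
    have hfin := stein_remainder_le (ε := ε) (W := W) (t₀ := t 0) (m₁ := (1 - s) / q)
      (Q := (q : ℝ) - 1) (Y := N * transverseSq q t) (K := K) (c := c) (a := φ W)
      (a' := φ (W + δ)) (a₁ := φ₁ W) (g₀ := g W - I) hk hε0 hε1 (by linarith)
      (mul_nonneg hN0.le (transverseSq_nonneg t)) hK
      (by rw [one_sub_eq_of_axisCoord hq s t, hXW])
      (magnetization_mem_Icc hN x 0).1 (magnetization_mem_Icc hN x 0).2 hD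
      (by linarith [hb' W, abs_nonneg (φ₁ W), abs_nonneg (φ₂ W)])
      (by linarith [hb' W, abs_nonneg (φ W), abs_nonneg (φ₂ W)])
      (abs_taylor_two_le (fun y _ => hφ y) (fun y _ => hφ₁ y) fun y hy => by
        have h1 : |y| ≤ |W| + 1 := by
          have h2 := Set.abs_sub_left_of_mem_uIcc hy
          rw [add_sub_cancel_left] at h2
          have h3 : |y| ≤ |y - W| + |W| := by
            have := abs_add_le (y - W) W; rwa [sub_add_cancel] at this
          linarith
        have h4 : K * Real.exp (K * |y|) ≤ K * Real.exp (K * (|W| + 1)) := by gcongr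
        linarith [hb' y, abs_nonneg (φ y), abs_nonneg (φ₁ y)])
      (hst W)
    rw [mul_assoc (ε ^ (2 * k)) L]
    exact hfin
  have hmean := abs_pottsMean_le (p := p) (β := β) (h := h) hpoint
  rw [pottsMean_add, pottsMean_flow_identity hN Φ, zero_add, pottsMean_const_mul, pottsMean_sub,
    pottsMean_const, pottsMean_const_mul] at hmean
  have hmom := hM N hN
  set R := (((N : ℝ) + 1) ^ q) ^ ((n : ℝ)⁻¹) with hR
  have h1 : (1 - s) / q * ε ^ (2 * k - 1) *
      |pottsMean p q β h N (fun x => g (fluct k s x)) - I| ≤ ε ^ (2 * k) * L * (M * R) := by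
    rw [abs_mul, abs_of_pos (by positivity)] at hmean
    exact hmean.trans (mul_le_mul_of_nonneg_left hmom (by positivity))
  have h2 : ε ^ (2 * k) = ε ^ (2 * k - 1) * ε := by rw [← pow_succ]; congr 1; omega
  rw [h2] at h1
  have h3 : (1 - s) / q * |pottsMean p q β h N (fun x => g (fluct k s x)) - I| ≤
      L * M * (ε * R) := by
    refine le_of_mul_le_mul_left ?_ (show 0 < ε ^ (2 * k - 1) by positivity)
    calc _ = (1 - s) / q * ε ^ (2 * k - 1) *
          |pottsMean p q β h N (fun x => g (fluct k s x)) - I| := by ring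
      _ ≤ _ := h1
      _ = _ := by ring
  rw [div_mul_eq_mul_div, le_div_iff₀ hm₁, mul_comm]
  exact h3

theorem tendsto_pottsMean_fluct (hq : 2 ≤ q) (hβ : 0 ≤ β) (hs : s ∈ Set.Ico (0 : ℝ) 1)
    (hk : 2 ≤ k) (hc : 0 < c) {c' : ℝ} (hc' : 0 < c')
    (hcoer : ∀ t ∈ stdSimplex ℝ (Fin q), c' * (axisCoord q s t ^ (2 * k) + transverseSq q t) ≤
      freeEnergy p q β h (xvec q s) - freeEnergy p q β h t) {C₁ : ℝ}
    (hdrift : ∀ t ∈ stdSimplex ℝ (Fin q),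
      |drift p q β h t + 2 * k * c * ((1 - s) / q) * axisCoord q s t ^ (2 * k - 1)| ≤
        C₁ * (axisCoord q s t ^ (2 * k) + transverseSq q t))
    {g g' : ℝ → ℝ} (hg : ∀ x, HasDerivAt g (g' x) x) (hgg : ExpGrowth g) (hgg' : ExpGrowth g') :
    Tendsto (fun N : ℕ => pottsMean p q β h N (fun x => g (fluct k s x))) atTop
      (𝓝 (∫ y, g y ∂(evenLaw c k))) := by
  obtain ⟨C, hC⟩ := exists_abs_pottsMean_sub_le hq hβ hs hk hc hc' hcoer hdrift hg hgg hgg'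
    (show 4 * k * q ≠ 0 by positivity)
  rw [tendsto_iff_norm_sub_tendsto_zero]
  refine squeeze_zero' (Eventually.of_forall fun N => norm_nonneg _)
    ((eventually_gt_atTop 0).mono hC) ?_
  simpa using (tendsto_inv_fluctScale_mul hk hq).const_mul C

end Convergence

/-! ### Criteria for weak convergence on the line -/

section WeakConvergence

/-- Half-open intervals form a π-system with arbitrarily small neighborhoods of each point, and
their masses are differences of distribution functions. -/
lemma tendsto_of_tendsto_real_Iic {μ : ℕ → ProbabilityMeasure ℝ} {ν : ProbabilityMeasure ℝ}
    (h : ∀ t, Tendsto (fun N => (μ N : Measure ℝ).real (Set.Iic t)) atTop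
      (𝓝 ((ν : Measure ℝ).real (Set.Iic t)))) : Tendsto μ atTop (𝓝 ν) := by
  refine (isPiSystem_Ioc (id : ℝ → ℝ) id).tendsto_probabilityMeasure_of_tendsto_of_mem ?_ ?_ ?_
  · rintro _ ⟨l, u, -, rfl⟩
    exact measurableSet_Ioc
  · intro U hU x hx
    obtain ⟨ε, hε, hball⟩ := Metric.isOpen_iff.1 hU x hx
    refine ⟨Set.Ioc (x - ε / 2) (x + ε / 2), ⟨x - ε / 2, x + ε / 2, by simp only [id]; linarith, rfl⟩,
      Ioc_mem_nhds (by linarith) (by linarith), fun y hy => hball ?_⟩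
    rw [Metric.mem_ball, Real.dist_eq, abs_lt]
    constructor <;> linarith [hy.1, hy.2]
  · rintro _ ⟨l, u, hlu, rfl⟩
    have hlu' : l ≤ u := le_of_lt hlu
    have e : ∀ ρ : ProbabilityMeasure ℝ, ((ρ (Set.Ioc (id l) (id u)) : NNReal) : ℝ) =
        (ρ : Measure ℝ).real (Set.Iic u) - (ρ : Measure ℝ).real (Set.Iic l) := by
      intro ρ
      have h1 : Set.Ioc l u = Set.Iic u \ Set.Iic l := by
        ext y; simp only [Set.mem_Ioc, Set.mem_sdiff, Set.mem_Iic, not_le]; tauto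
      change (ρ : Measure ℝ).real (Set.Ioc l u) = _
      rw [h1, measureReal_sdiff (Set.Iic_subset_Iic.2 hlu') measurableSet_Iic]
    rw [← NNReal.tendsto_coe]
    simp_rw [e]
    exact (h u).sub (h l)

/-- The threshold moves with `N`. It is trapped between fixed thresholds on either side of `b₀`, and
continuity of the limiting tail closes the gap. -/
lemma tendsto_real_Ici_of_tendsto {μ : ℕ → ProbabilityMeasure ℝ} {ν : ProbabilityMeasure ℝ}
    [NullSingletonClass (ν : Measure ℝ)]
    (hν : Continuous fun b => (ν : Measure ℝ).real (Set.Ici b)) (hμ : Tendsto μ atTop (𝓝 ν))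
    {b : ℕ → ℝ} {b₀ : ℝ} (hb : Tendsto b atTop (𝓝 b₀)) :
    Tendsto (fun N => (μ N : Measure ℝ).real (Set.Ici (b N))) atTop
      (𝓝 ((ν : Measure ℝ).real (Set.Ici b₀))) := by
  have hfix : ∀ d, Tendsto (fun N => (μ N : Measure ℝ).real (Set.Ici d)) atTop
      (𝓝 ((ν : Measure ℝ).real (Set.Ici d))) := by
    intro d
    have h0 : (ν : Measure ℝ) (frontier (Set.Ici d)) = 0 := by
      rw [frontier_Ici]; exact measure_singleton d
    exact (ENNReal.tendsto_toReal (measure_ne_top _ _)).comp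
      (ProbabilityMeasure.tendsto_measure_of_null_frontier_of_tendsto' hμ h0)
  rw [tendsto_order]
  constructor
  · intro l hl
    obtain ⟨d, hd, hdl⟩ : ∃ d, b₀ < d ∧ l < (ν : Measure ℝ).real (Set.Ici d) :=
      ((hν.tendsto b₀).eventually (lt_mem_nhds hl)).exists_gt
    filter_upwards [(hfix d).eventually (lt_mem_nhds hdl), hb.eventually (gt_mem_nhds hd)]
      with N h1 h2
    exact h1.trans_le (measureReal_mono (Set.Ici_subset_Ici.2 h2.le))
  · intro l hl
    obtain ⟨d, hd, hdl⟩ : ∃ d, d < b₀ ∧ (ν : Measure ℝ).real (Set.Ici d) < l :=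
      ((hν.tendsto b₀).eventually (gt_mem_nhds hl)).exists_lt
    filter_upwards [(hfix d).eventually (gt_mem_nhds hdl), hb.eventually (lt_mem_nhds hd)]
      with N h1 h2
    exact (measureReal_mono (Set.Ici_subset_Ici.2 h2.le)).trans_lt h1

/-- Reduces convergence of characteristic functions to real test functions, the only ones that the
Stein estimate covers. -/
lemma charFun_eq_cos_add_sin (μ : Measure ℝ) [IsFiniteMeasure μ] (t : ℝ) :
    charFun μ t = ((∫ x, Real.cos (t * x) ∂μ : ℝ) : ℂ) +
      ((∫ x, Real.sin (t * x) ∂μ : ℝ) : ℂ) * Complex.I := by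
  have h1 : Integrable (fun x => Real.cos (t * x)) μ :=
    Integrable.of_bound (by fun_prop) 1 (ae_of_all _ fun x => Real.abs_cos_le_one _)
  have h2 : Integrable (fun x => Real.sin (t * x)) μ :=
    Integrable.of_bound (by fun_prop) 1 (ae_of_all _ fun x => Real.abs_sin_le_one _)
  rw [charFun_apply_real, ← integral_complex_ofReal, ← integral_complex_ofReal,
    ← integral_mul_const, ← integral_add h1.ofReal (h2.ofReal.mul_const _)]
  congr 1; ext x
  rw [← Complex.ofReal_mul, Complex.exp_mul_I, Complex.ofReal_cos, Complex.ofReal_sin]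

end WeakConvergence

/-! ### The model as a measure, and the likelihood equation -/

section PottsMeasure
variable {p q N : ℕ} [NeZero q] {β h : ℝ}

lemma integral_pottsMeasure (f : (Fin N → Fin q) → ℝ) :
    ∫ x, f x ∂(pottsMeasure p q β h N) = pottsMean p q β h N f := by
  rw [pottsMeasure, PMF.integral_eq_sum, pottsMean]
  refine Finset.sum_congr rfl fun x _ => ?_
  rw [pottsPMF, PMF.ofFintype_apply, ENNReal.toReal_ofReal (prob_nonneg β h x), smul_eq_mul]

lemma pottsMeasure_real_apply (S : Set (Fin N → Fin q)) [DecidablePred (· ∈ S)] :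
    (pottsMeasure p q β h N).real S = pottsMean p q β h N fun x => if x ∈ S then 1 else 0 := by
  rw [← integral_pottsMeasure, ← integral_indicator_one (Set.toFinite S).measurableSet]
  congr 1; ext x
  simp [Set.indicator_apply]

end PottsMeasure

section Likelihood
variable {p q N : ℕ} [NeZero q] {β h : ℝ}

lemma weight_tilt (β h h' : ℝ) (x : Fin N → Fin q) :
    weight p q β h' N x = weight p q β h N x * Real.exp (N * (h' - h) * magnetization x 0) := by
  rw [weight, weight, ← Real.exp_add]; congr 1; ring

lemma pottsMean_eq_div (f : (Fin N → Fin q) → ℝ) :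
    pottsMean p q β h N f = (∑ x, weight p q β h N x * f x) / partitionSum p q β h N := by
  rw [pottsMean, Finset.sum_div]
  exact Finset.sum_congr rfl fun x _ => by rw [prob]; ring

lemma pottsMean_tilt (β h h' : ℝ) (f : (Fin N → Fin q) → ℝ) :
    pottsMean p q β h' N f =
      pottsMean p q β h N (fun x => f x * Real.exp (N * (h' - h) * magnetization x 0)) /
        pottsMean p q β h N (fun x => Real.exp (N * (h' - h) * magnetization x 0)) := by
  rw [pottsMean_eq_div, pottsMean_eq_div, pottsMean_eq_div,
    div_div_div_cancel_right₀ (partitionSum_pos p q β h N).ne', partitionSum]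
  simp_rw [weight_tilt β h h']
  congr 1
  exact Finset.sum_congr rfl fun x _ => by ring

/-- Raising the field tilts by an increasing function of the magnetization, so the mean moves by a
normalized covariance of two increasing functions. It is positive because with two colors and one
site the magnetization is not constant. -/
lemma strictMono_pottsMean_magnetization (hN : 0 < N) (hq : 2 ≤ q) (β : ℝ) :
    StrictMono fun h => pottsMean p q β h N fun x => magnetization x 0 := by
  intro h h' hh
  have hN0 : (0 : ℝ) < N := by exact_mod_cast hN
  simp only []
  set M := pottsMean p q β h N fun x => magnetization x 0 with hM
  have hΔ : 0 < N * (h' - h) := mul_pos hN0 (by linarith)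
  set e : (Fin N → Fin q) → ℝ := fun x => Real.exp (N * (h' - h) * magnetization x 0) with he
  set e₀ := Real.exp (N * (h' - h) * M) with he₀
  have hE : 0 < pottsMean p q β h N e := by
    refine Finset.sum_pos (fun x _ => mul_pos (div_pos (Real.exp_pos _)
      (partitionSum_pos p q β h N)) (Real.exp_pos _)) Finset.univ_nonempty
  rw [pottsMean_tilt β h h', lt_div_iff₀ hE, ← sub_pos, ← pottsMean_const_mul, ← pottsMean_sub]
  have h0 : pottsMean p q β h N (fun x => (magnetization x 0 - M) * e₀) = 0 := by
    simp_rw [mul_comm _ e₀]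
    rw [pottsMean_const_mul, pottsMean_sub, pottsMean_const, ← hM, sub_self, mul_zero]
  have h1 : pottsMean p q β h N (fun x => magnetization x 0 * e x - M * e x) =
      pottsMean p q β h N (fun x => (magnetization x 0 - M) * (e x - e₀)) := by
    rw [← sub_zero (pottsMean p q β h N fun x => magnetization x 0 * e x - M * e x), ← h0,
      ← pottsMean_sub]
    congr 1; ext x; ring
  rw [h1]
  have hsgn : ∀ x : Fin N → Fin q, 0 ≤ (magnetization x 0 - M) * (e x - e₀) := by
    intro x
    rcases le_total M (magnetization x 0) with hx | hx
    · refine mul_nonneg (by linarith) (sub_nonneg.2 (Real.exp_le_exp.2 ?_))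
      exact mul_le_mul_of_nonneg_left hx hΔ.le
    · refine mul_nonneg_of_nonpos_of_nonpos (by linarith) (sub_nonpos.2 (Real.exp_le_exp.2 ?_))
      exact mul_le_mul_of_nonneg_left hx hΔ.le
  have hne : ∃ x : Fin N → Fin q, magnetization x 0 ≠ M := by
    by_contra! hall
    have hA : magnetization (fun _ : Fin N => (0 : Fin q)) 0 = 1 := by
      simp [magnetization, hN0.ne']
    have hB : magnetization (fun _ : Fin N => (⟨1, by omega⟩ : Fin q)) 0 = 0 := by
      have : (⟨1, by omega⟩ : Fin q) ≠ 0 := by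
        intro h; have := congrArg Fin.val h; simp at this
      simp [magnetization, this]
    rw [hall] at hA hB
    linarith
  obtain ⟨x, hx⟩ := hne
  refine Finset.sum_pos' (fun x _ => mul_nonneg (prob_nonneg β h x) (hsgn x))
    ⟨x, Finset.mem_univ _, mul_pos (div_pos (Real.exp_pos _) (partitionSum_pos p q β h N))
      (lt_of_le_of_ne (hsgn x) (Ne.symm (mul_ne_zero (sub_ne_zero.2 hx) (sub_ne_zero.2 ?_))))⟩
  intro h2
  exact hx (mul_left_cancel₀ hΔ.ne' (Real.exp_injective h2))

lemma continuous_prob (β : ℝ) (x : Fin N → Fin q) : Continuous fun h => prob p q β h N x := by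
  unfold prob partitionSum weight
  refine Continuous.div (by fun_prop) (by fun_prop) fun h => ?_
  exact (partitionSum_pos p q β h N).ne'

lemma prob_le_exp (β h : ℝ) (x y : Fin N → Fin q) :
    prob p q β h N x ≤ Real.exp (β * N * ∑ r, magnetization x r ^ p -
      β * N * ∑ r, magnetization y r ^ p) *
        Real.exp (h * (N * (magnetization x 0 - magnetization y 0))) := by
  have h1 : weight p q β h N y ≤ partitionSum p q β h N :=
    Finset.single_le_sum (f := weight p q β h N) (fun x _ => (Real.exp_pos _).le)
      (Finset.mem_univ y)
  refine (div_le_div_of_nonneg_left (Real.exp_pos _).le (Real.exp_pos _) h1).trans (le_of_eq ?_)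
  rw [← Real.exp_sub, ← Real.exp_add]
  congr 1; ring

/-- Keeping a single competitor in the partition sum bounds the likelihood. The configuration
without color 0 sends it to zero as `h → -∞`, and the all-0 configuration as `h → +∞`. Continuity
then gives a maximizer. -/
lemma exists_isMLE (hN : 0 < N) (hq : 2 ≤ q) (β : ℝ) (x : Fin N → Fin q)
    (hx0 : 0 < magnetization x 0) (hx1 : magnetization x 0 < 1) :
    ∃ h, IsMLE p q β N x h := by
  have hN0 : (0 : ℝ) < N := by exact_mod_cast hN
  refine (continuous_prob β x).exists_forall_ge' 0 ?_
  have hpos : 0 < prob p q β 0 N x := div_pos (Real.exp_pos _) (partitionSum_pos p q β 0 N)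
  have hA : magnetization (fun _ : Fin N => (0 : Fin q)) 0 = 1 := by
    simp [magnetization, hN0.ne']
  have hB : magnetization (fun _ : Fin N => (⟨1, by omega⟩ : Fin q)) 0 = 0 := by
    have : (⟨1, by omega⟩ : Fin q) ≠ 0 := by
      intro h; have := congrArg Fin.val h; simp at this
    simp [magnetization, this]
  rw [cocompact_eq_atBot_atTop, eventually_sup]
  constructor
  · have h1 : Tendsto (fun h : ℝ => Real.exp (h * (N * (magnetization x 0 -
        magnetization (fun _ : Fin N => (⟨1, by omega⟩ : Fin q)) 0)))) atBot (𝓝 0) := by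
      rw [hB, sub_zero]
      exact Real.tendsto_exp_atBot.comp (tendsto_id.atBot_mul_const (by positivity))
    have h2 := h1.const_mul (Real.exp (β * N * ∑ r, magnetization x r ^ p -
      β * N * ∑ r, magnetization (fun _ : Fin N => (⟨1, by omega⟩ : Fin q)) r ^ p))
    rw [mul_zero] at h2
    filter_upwards [h2.eventually (gt_mem_nhds hpos)] with h hh
    exact (prob_le_exp β h x _).trans hh.le
  · have h1 : Tendsto (fun h : ℝ => Real.exp (h * (N * (magnetization x 0 -
        magnetization (fun _ : Fin N => (0 : Fin q)) 0)))) atTop (𝓝 0) := by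
      rw [hA]
      refine Real.tendsto_exp_atBot.comp (tendsto_id.atTop_mul_const_of_neg ?_)
      exact mul_neg_of_pos_of_neg hN0 (by linarith)
    have h2 := h1.const_mul (Real.exp (β * N * ∑ r, magnetization x r ^ p -
      β * N * ∑ r, magnetization (fun _ : Fin N => (0 : Fin q)) r ^ p))
    rw [mul_zero] at h2
    filter_upwards [h2.eventually (gt_mem_nhds hpos)] with h hh
    exact (prob_le_exp β h x _).trans hh.le

/-- Likelihood equation. -/
lemma magnetization_eq_of_isMLE (hN : 0 < N) (β h : ℝ) (x : Fin N → Fin q)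
    (hx : IsMLE p q β N x h) :
    magnetization x 0 = pottsMean p q β h N fun y => magnetization y 0 := by
  have hN0 : (0 : ℝ) < N := by exact_mod_cast hN
  have hw : ∀ y : Fin N → Fin q, HasDerivAt (fun h => weight p q β h N y)
      (weight p q β h N y * (N * magnetization y 0)) h := by
    intro y
    unfold weight
    have h1 : HasDerivAt (fun h : ℝ => β * N * ∑ r, magnetization y r ^ p +
        N * h * magnetization y 0) (N * 1 * magnetization y 0) h :=
      (((hasDerivAt_id h).const_mul (N : ℝ)).mul_const _).const_add _
    exact h1.exp.congr_deriv (by ring)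
  have hZ : HasDerivAt (fun h => partitionSum p q β h N)
      (∑ y, weight p q β h N y * (N * magnetization y 0)) h :=
    HasDerivAt.fun_sum fun y _ => hw y
  have hZ0 := (partitionSum_pos p q β h N).ne'
  have hd := (hw x).div hZ hZ0
  have hmax : IsLocalMax (fun h => prob p q β h N x) h := Eventually.of_forall hx
  have h0 := hmax.hasDerivAt_eq_zero hd
  rw [div_eq_zero_iff, or_iff_left (by positivity)] at h0
  have hwx : weight p q β h N x ≠ 0 := (Real.exp_pos _).ne'
  rw [pottsMean_eq_div, eq_div_iff hZ0]
  have h2 : ∑ y, weight p q β h N y * (N * magnetization y 0) =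
      N * ∑ y, weight p q β h N y * magnetization y 0 := by
    rw [Finset.mul_sum]; exact Finset.sum_congr rfl fun y _ => by ring
  rw [h2] at h0
  have h3 : weight p q β h N x * N * (magnetization x 0 * partitionSum p q β h N -
      ∑ y, weight p q β h N y * magnetization y 0) = 0 := by linear_combination h0
  rcases mul_eq_zero.1 h3 with h4 | h4
  · exact absurd h4 (mul_ne_zero hwx hN0.ne')
  · linarith

/-- The likelihood equation turns `h` into a mean, and strict monotonicity of the mean in the field
transfers the inequality. Concavity of the likelihood is not needed. -/
lemma isMLE_le_iff (hN : 0 < N) (hq : 2 ≤ q) (β h h' : ℝ) (x : Fin N → Fin q)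
    (hx : IsMLE p q β N x h) :
    h ≤ h' ↔ magnetization x 0 ≤ pottsMean p q β h' N fun y => magnetization y 0 := by
  rw [magnetization_eq_of_isMLE hN β h x hx]
  exact ((strictMono_pottsMean_magnetization hN hq β).le_iff_le).symm

end Likelihood

/-! ### From magnetization fluctuations to the estimate -/

section MLE
variable {p q : ℕ} [NeZero q] {β h s c : ℝ} {k : ℕ}

/-- Expectations of smooth test functions of exponential growth of the rescaled magnetization
converge to those under `evenLaw c k`. -/
def FluctConverges (p q : ℕ) [NeZero q] (β h s c : ℝ) (k : ℕ) : Prop :=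
  ∀ g g' : ℝ → ℝ, (∀ x, HasDerivAt g (g' x) x) → ExpGrowth g → ExpGrowth g' →
    Tendsto (fun N : ℕ => pottsMean p q β h N (fun x => g (fluct k s x))) atTop
      (𝓝 (∫ y, g y ∂(evenLaw c k)))

lemma tendsto_real_fluct_ge (hc : 0 < c) (hk : 2 ≤ k) (hconv : FluctConverges p q β h s c k)
    {b : ℕ → ℝ} {b₀ : ℝ} (hb : Tendsto b atTop (𝓝 b₀)) :
    Tendsto (fun N => (pottsMeasure p q β h N).real {x | b N ≤ fluct k s x}) atTop
      (𝓝 ((evenLaw c k).real (Set.Ici b₀))) := by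
  have := isProbabilityMeasure_evenLaw hc hk
  have := nullSingletonClass_evenLaw (c := c) (k := k)
  have hmeas : ∀ N, Measurable (fluct k s : (Fin N → Fin q) → ℝ) := fun N => measurable_of_finite _
  let μ : ℕ → ProbabilityMeasure ℝ := fun N =>
    ⟨(pottsMeasure p q β h N).map (fluct k s),
      Measure.isProbabilityMeasure_map (hmeas N).aemeasurable⟩
  let ν : ProbabilityMeasure ℝ := ⟨evenLaw c k, inferInstance⟩
  have hint : ∀ (N : ℕ) (f : ℝ → ℝ), Continuous f → ∫ y, f y ∂(μ N : Measure ℝ) =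
      pottsMean p q β h N (fun x => f (fluct k s x)) := by
    intro N f hf
    rw [← integral_pottsMeasure]
    exact integral_map (hmeas N).aemeasurable hf.aestronglyMeasurable
  have hμ : Tendsto μ atTop (𝓝 ν) := by
    refine ProbabilityMeasure.tendsto_of_tendsto_charFun fun t => ?_
    simp_rw [charFun_eq_cos_add_sin]
    have hbdd : ∀ (a : ℝ) (f : ℝ → ℝ), (∀ x, |f x| ≤ 1) → ExpGrowth fun x => a * f x := by
      intro a f hf
      exact ((expGrowth_const 1).of_le fun x => by simpa using hf x).const_mul a
    have hcos : Tendsto (fun N => ∫ x, Real.cos (t * x) ∂(μ N : Measure ℝ)) atTop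
        (𝓝 (∫ x, Real.cos (t * x) ∂(evenLaw c k))) := by
      simp_rw [hint _ (fun x => Real.cos (t * x)) (by fun_prop)]
      refine hconv (fun x => Real.cos (t * x)) (fun x => t * -Real.sin (t * x)) (fun x => ?_) ?_ ?_
      · exact ((hasDerivAt_id x).const_mul t).cos.congr_deriv (by simp only [id]; ring)
      · simpa using hbdd 1 _ fun x => Real.abs_cos_le_one (t * x)
      · exact hbdd t _ fun x => by rw [abs_neg]; exact Real.abs_sin_le_one (t * x)
    have hsin : Tendsto (fun N => ∫ x, Real.sin (t * x) ∂(μ N : Measure ℝ)) atTop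
        (𝓝 (∫ x, Real.sin (t * x) ∂(evenLaw c k))) := by
      simp_rw [hint _ (fun x => Real.sin (t * x)) (by fun_prop)]
      refine hconv (fun x => Real.sin (t * x)) (fun x => t * Real.cos (t * x)) (fun x => ?_) ?_ ?_
      · exact ((hasDerivAt_id x).const_mul t).sin.congr_deriv (by simp only [id]; ring)
      · simpa using hbdd 1 _ fun x => Real.abs_sin_le_one (t * x)
      · exact hbdd t _ fun x => Real.abs_cos_le_one (t * x)
    exact ((Complex.continuous_ofReal.tendsto _).comp hcos).add
      (((Complex.continuous_ofReal.tendsto _).comp hsin).mul_const _)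
  have hν : Continuous fun b => (ν : Measure ℝ).real (Set.Ici b) := by
    have e : (fun b => (ν : Measure ℝ).real (Set.Ici b)) =
        fun b => (evenLaw c k).real (Set.Iic (-b)) := by
      ext b; exact (evenLaw_real_Iic_neg hc hk b).symm
    rw [e]
    exact (continuous_evenLaw_real_Iic hc hk).comp continuous_neg
  have : NullSingletonClass (ν : Measure ℝ) := nullSingletonClass_evenLaw
  refine (tendsto_real_Ici_of_tendsto hν hμ hb).congr fun N => ?_
  exact map_measureReal_apply (hmeas N) measurableSet_Ici

lemma fluct_eq {N : ℕ} (x : Fin N → Fin q) :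
    fluct k s x = fluctScale k N / (1 - q) * (magnetization x 0 - xvec q s 0) := by
  rw [fluct, axisCoord]; ring

/-- The field shift multiplies the weight by `exp (θ W)` with `θ = (1-q) t`, up to a constant that
cancels. The shifted mean is a quotient of two expectations under `h`, both of test functions of
exponential growth. -/
lemma tendsto_pottsMean_tilt_fluct (hq : 2 ≤ q) (hc : 0 < c) (hk : 2 ≤ k)
    (hconv : FluctConverges p q β h s c k) (t : ℝ) :
    Tendsto (fun N : ℕ => pottsMean p q β (h + t / N * fluctScale k N) N (fun x => fluct k s x))
      atTop (𝓝 (tiltMean c k ((1 - q) * t))) := by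
  have hq1 : (2 : ℝ) ≤ q := by exact_mod_cast hq
  set θ : ℝ := (1 - q) * t with hθ
  have hexp : ∀ x : ℝ, HasDerivAt (fun x => Real.exp (θ * x)) (θ * Real.exp (θ * x)) x := fun x =>
    ((hasDerivAt_id x).const_mul θ).exp.congr_deriv (by simp only [id]; ring)
  have h1 := hconv (fun x => x * Real.exp (θ * x))
    (fun x => Real.exp (θ * x) + x * (θ * Real.exp (θ * x)))
    (fun x => ((hasDerivAt_id x).mul (hexp x)).congr_deriv (by simp only [id]; ring))
    (expGrowth_id.mul (expGrowth_exp_mul θ))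
    ((expGrowth_exp_mul θ).add (expGrowth_id.mul ((expGrowth_exp_mul θ).const_mul θ)))
  have h2 := hconv _ _ hexp (expGrowth_exp_mul θ) ((expGrowth_exp_mul θ).const_mul θ)
  have hne : ∫ x, Real.exp (θ * x) ∂(evenLaw c k) ≠ 0 := by
    have := isProbabilityMeasure_evenLaw hc hk
    exact (integral_exp_pos (integrable_evenLaw hc hk (f := fun x => Real.exp (θ * x))
      (by fun_prop) (expGrowth_exp_mul θ))).ne'
  rw [tiltMean_eq_div hc hk]
  refine (h1.div h2 hne).congr' ?_
  filter_upwards [eventually_gt_atTop 0] with N hN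
  have hN0 : (N : ℝ) ≠ 0 := by positivity
  have hr := (fluctScale_pos (k := k) hN).ne'
  have hexpo : ∀ x : Fin N → Fin q, Real.exp (N * (h + t / N * fluctScale k N - h) *
      magnetization x 0) = Real.exp (t * fluctScale k N * xvec q s 0) *
      Real.exp (θ * fluct k s x) := by
    intro x
    rw [← Real.exp_add, fluct_eq, hθ]
    have h3 : (1 : ℝ) - q ≠ 0 := by linarith
    congr 1
    field_simp
    ring
  rw [pottsMean_tilt β h]
  simp_rw [hexpo, mul_left_comm _ (Real.exp (t * fluctScale k N * xvec q s 0))]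
  rw [pottsMean_const_mul, pottsMean_const_mul, mul_div_mul_left _ _ (Real.exp_pos _).ne']
  rfl

lemma pottsMean_fluct_eq {N : ℕ} (h' : ℝ) :
    pottsMean p q β h' N (fun x => fluct k s x) = fluctScale k N / (1 - q) *
      (pottsMean p q β h' N (fun x => magnetization x 0) - xvec q s 0) := by
  simp_rw [fluct_eq]
  rw [pottsMean_const_mul, pottsMean_sub, pottsMean_const]

lemma rpow_mul_sub_le_iff {N : ℕ} (hN : 0 < N) (a t : ℝ) :
    (N : ℝ) ^ (1 - (2 * k : ℝ)⁻¹) * (a - h) ≤ t ↔ a ≤ h + t / N * fluctScale k N := by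
  have hN0 : (0 : ℝ) < N := by exact_mod_cast hN
  have hr := fluctScale_pos (k := k) hN
  rw [Real.rpow_sub hN0, Real.rpow_one]
  change N / fluctScale k N * (a - h) ≤ t ↔ _
  rw [div_mul_eq_mul_div, div_le_iff₀ hr, mul_comm, ← le_div_iff₀ hN0, sub_le_iff_le_add',
    div_mul_eq_mul_div]

/-- The comparison of magnetizations reverses when expressed through `fluct`, because its factor
`fluctScale k N / (1 - q)` is negative. Hence upper tails of `fluct` appear. -/
lemma mle_event_iff (hq : 2 ≤ q) {N : ℕ} (hN : 0 < N)
    {hhat : (Fin N → Fin q) → ℝ}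
    (hML : ∀ x : Fin N → Fin q, (∃ h' : ℝ, IsMLE p q β N x h') → IsMLE p q β N x (hhat x))
    (t : ℝ) (x : Fin N → Fin q) (hx0 : 0 < magnetization x 0) (hx1 : magnetization x 0 < 1) :
    (N : ℝ) ^ (1 - (2 * k : ℝ)⁻¹) * (hhat x - h) ≤ t ↔
      pottsMean p q β (h + t / N * fluctScale k N) N (fun x => fluct k s x) ≤ fluct k s x := by
  have hq1 : (2 : ℝ) ≤ q := by exact_mod_cast hq
  rw [rpow_mul_sub_le_iff hN, isMLE_le_iff hN hq β _ _ x (hML x (exists_isMLE hN hq β x hx0 hx1)),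
    pottsMean_fluct_eq, fluct_eq, mul_le_mul_left_of_neg
      (div_neg_of_pos_of_neg (fluctScale_pos hN) (by linarith)), sub_le_sub_iff_right]

lemma tendsto_fluct_sq_bound (hk : 2 ≤ k) (hconv : FluctConverges p q β h s c k) (A : ℝ) :
    Tendsto (fun N : ℕ => pottsMean p q β h N (fun x => A / fluctScale k N ^ 2 * fluct k s x ^ 2))
      atTop (𝓝 0) := by
  have h1 := hconv (fun x => x ^ 2) (fun x => 2 * x)
    (fun x => (hasDerivAt_pow 2 x).congr_deriv (by simp)) (expGrowth_pow 2)
    (expGrowth_id.const_mul 2)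
  have h2 : Tendsto (fun N => A / fluctScale k N ^ 2) atTop (𝓝 0) :=
    Tendsto.const_div_atTop ((tendsto_pow_atTop two_ne_zero).comp (tendsto_fluctScale hk)) A
  simp_rw [pottsMean_const_mul]
  simpa using h2.mul h1

/-- Away from samples in which color 0 is absent or universal, the event is that `fluct` exceeds its
shifted mean, and evenness of the limit turns the upper tail into a lower one. On the excluded
samples the estimate is arbitrary, but their probability vanishes. -/
lemma tendsto_mle_cdf (hq : 2 ≤ q) (hs : s ∈ Set.Ico (0 : ℝ) 1) (hc : 0 < c) (hk : 2 ≤ k)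
    (hconv : FluctConverges p q β h s c k) {hhat : (N : ℕ) → (Fin N → Fin q) → ℝ}
    (hML : ∀ (N : ℕ) (x : Fin N → Fin q), (∃ h' : ℝ, IsMLE p q β N x h') →
      IsMLE p q β N x (hhat N x)) (t : ℝ) :
    Tendsto (fun N => (pottsMeasure p q β h N).real
      {x | (N : ℝ) ^ (1 - (2 * k : ℝ)⁻¹) * (hhat N x - h) ≤ t}) atTop
      (𝓝 ((evenLaw c k).real (Set.Iic (-tiltMean c k ((1 - q) * t))))) := by
  classical
  have hq1 : (2 : ℝ) ≤ q := by exact_mod_cast hq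
  rw [evenLaw_real_Iic_neg hc hk]
  have h1 := tendsto_real_fluct_ge hc hk hconv (tendsto_pottsMean_tilt_fluct hq hc hk hconv t)
  set m₀ := xvec q s 0 with hm₀
  have hm0 : 0 < m₀ := xvec_pos hs 0
  have hm1 : m₀ < 1 := by
    have := one_sub_eq_of_axisCoord hq s (xvec q s)
    rw [axisCoord, sub_self, zero_div, add_zero] at this
    have h2 : 0 < ((q : ℝ) - 1) * ((1 - s) / q) :=
      mul_pos (by linarith) (div_pos (by linarith [hs.2]) (by linarith))
    linarith
  set d := min m₀ (1 - m₀) with hd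
  have hd0 : 0 < d := lt_min hm0 (by linarith)
  -- Chebyshev: on an excluded sample the magnetization is at distance at least `d` from `m₀`, so `A
  -- / fluctScale² * fluct²` is at least 1 there, while its mean tends to zero.
  set A := ((1 - q) / d : ℝ) ^ 2 with hA
  have h3 := tendsto_fluct_sq_bound hk hconv A
  have hdiff : Tendsto (fun N => (pottsMeasure p q β h N).real
      {x | (N : ℝ) ^ (1 - (2 * k : ℝ)⁻¹) * (hhat N x - h) ≤ t} -
      (pottsMeasure p q β h N).real {x | pottsMean p q β (h + t / N * fluctScale k N) N
        (fun x => fluct k s x) ≤ fluct k s x}) atTop (𝓝 0) := by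
    refine squeeze_zero_norm' ?_ h3
    filter_upwards [eventually_gt_atTop 0] with N hN
    rw [pottsMeasure_real_apply, pottsMeasure_real_apply, ← pottsMean_sub, Real.norm_eq_abs]
    refine abs_pottsMean_le fun x => ?_
    have hr := fluctScale_pos (k := k) hN
    simp only [Set.mem_ofPred_eq]
    by_cases hx : 0 < magnetization x 0 ∧ magnetization x 0 < 1
    · simp only [mle_event_iff (s := s) hq hN (hML N) t x hx.1 hx.2, sub_self, abs_zero]
      positivity
    · have hd1 : d ≤ |magnetization x 0 - m₀| := by
        rcases lt_or_ge 0 (magnetization x 0) with h4 | h4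
        · have h5 : 1 ≤ magnetization x 0 := not_lt.1 fun h6 => hx ⟨h4, h6⟩
          exact (min_le_right _ _).trans ((by linarith : 1 - m₀ ≤ magnetization x 0 - m₀).trans
            (le_abs_self _))
        · exact (min_le_left _ _).trans ((by linarith : m₀ ≤ -(magnetization x 0 - m₀)).trans
            (neg_le_abs _))
      have hge : 1 ≤ A / fluctScale k N ^ 2 * fluct k s x ^ 2 := by
        have e : A / fluctScale k N ^ 2 * fluct k s x ^ 2 =
            (|magnetization x 0 - m₀| / d) ^ 2 := by
          rw [fluct_eq, hA, ← hm₀, div_pow _ d, div_pow _ d, sq_abs]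
          have h6 : (1 : ℝ) - q ≠ 0 := by linarith
          field_simp
        rw [e]
        exact one_le_pow₀ ((one_le_div hd0).2 hd1)
      refine le_trans ?_ hge
      split_ifs <;> norm_num
  simpa using hdiff.add h1

theorem tendstoInDistribution_mle (hq : 2 ≤ q) (hs : s ∈ Set.Ico (0 : ℝ) 1) (hc : 0 < c)
    (hk : 2 ≤ k) (hconv : FluctConverges p q β h s c k)
    {hhat : (N : ℕ) → (Fin N → Fin q) → ℝ}
    (hML : ∀ (N : ℕ) (x : Fin N → Fin q), (∃ h' : ℝ, IsMLE p q β N x h') →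
      IsMLE p q β N x (hhat N x)) {G : Measure ℝ} [IsProbabilityMeasure G]
    (hG : ∀ t : ℝ, G.real (Set.Iic t) =
      (evenLaw c k).real (Set.Iic (-tiltMean c k ((1 - q) * t)))) :
    TendstoInDistribution
      (fun (N : ℕ) (x : Fin N → Fin q) => (N : ℝ) ^ (1 - (2 * k : ℝ)⁻¹) * (hhat N x - h))
      atTop (fun y : ℝ => y) (fun N => pottsMeasure p q β h N) G := by
  have hmeas : ∀ N, Measurable fun x : Fin N → Fin q =>
      (N : ℝ) ^ (1 - (2 * k : ℝ)⁻¹) * (hhat N x - h) := fun N => measurable_of_finite _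
  refine ⟨fun N => (hmeas N).aemeasurable, aemeasurable_id', ?_⟩
  refine tendsto_of_tendsto_real_Iic fun t => ?_
  have e : ((G.map fun y : ℝ => y).real (Set.Iic t)) =
      (evenLaw c k).real (Set.Iic (-tiltMean c k ((1 - q) * t))) := by
    rw [Measure.map_id', hG]
  simp only [ProbabilityMeasure.coe_mk]
  rw [e]
  refine (tendsto_mle_cdf hq hs hc hk hconv hML t).congr fun N => ?_
  exact (map_measureReal_apply (hmeas N) measurableSet_Iic).symm

/-- Limit theorem for the maximum likelihood estimate, with a non-Gaussian limit. -/
theorem exists_nonGaussian_limit_mle (hq : 2 ≤ q) (hs : s ∈ Set.Ico (0 : ℝ) 1) (hc : 0 < c)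
    (hk : 2 ≤ k) (hconv : FluctConverges p q β h s c k)
    {hhat : (N : ℕ) → (Fin N → Fin q) → ℝ}
    (hML : ∀ (N : ℕ) (x : Fin N → Fin q), (∃ h' : ℝ, IsMLE p q β N x h') →
      IsMLE p q β N x (hhat N x)) :
    ∃ (G : Measure ℝ) (_ : IsProbabilityMeasure G),
      (∀ t : ℝ, G.real (Set.Iic t) =
        (evenLaw c k).real (Set.Iic (-∫ u, u ∂(volume.tilted fun x =>
          -(c * x ^ (2 * k)) + (1 - q) * t * x)))) ∧
      (∀ (a : ℝ) (v : NNReal), G ≠ gaussianReal a v) ∧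
      TendstoInDistribution
        (fun (N : ℕ) (x : Fin N → Fin q) => (N : ℝ) ^ (1 - (2 * k : ℝ)⁻¹) * (hhat N x - h))
        atTop (fun y : ℝ => y) (fun N => pottsMeasure p q β h N) G := by
  have hq1 : (1 : ℝ) - q < 0 := by
    have : (2 : ℝ) ≤ q := by exact_mod_cast hq
    linarith
  obtain ⟨G, hGp, hG⟩ := exists_law_tiltMean hc hk hq1
  refine ⟨G, hGp, fun t => ?_, ne_gaussianReal_of_tiltMean hc hk hq1 hG,
    tendstoInDistribution_mle hq hs hc hk hconv hML hG⟩
  rw [hG, integral_id_tilted_even_pow hc hk]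

end MLE

/-! ### Taylor expansion at a zero of higher order -/

section TaylorChain

/-- Induction on the order with the mean value inequality: the bound for the chain starting at `F 1`
integrates to the one for `F 0`. Bounding instead of integrating loses only the factorial in the
remainder. -/
lemma abs_taylor_chain_le {ρ M : ℝ} {n : ℕ} {F : ℕ → ℝ → ℝ}
    (hF : ∀ j ≤ n, ∀ τ : ℝ, |τ| < ρ → HasDerivAt (F j) (F (j + 1) τ) τ)
    (hM : ∀ τ : ℝ, |τ| < ρ → |F (n + 1) τ| ≤ M) (h0 : ∀ j < n, F j 0 = 0) {τ : ℝ} (hτ : |τ| < ρ) :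
    |F 0 τ - F n 0 / n.factorial * τ ^ n| ≤ M * |τ| ^ (n + 1) := by
  have hρ : 0 < ρ := (abs_nonneg τ).trans_lt hτ
  have hball : ∀ y ∈ Set.uIcc 0 τ, |y| ≤ |τ| := fun y hy => by
    simpa using Set.abs_sub_left_of_mem_uIcc hy
  induction n generalizing F τ with
  | zero =>
    have := (convex_uIcc 0 τ).norm_image_sub_le_of_norm_hasDerivWithin_le
      (fun y hy => (hF 0 le_rfl y ((hball y hy).trans_lt hτ)).hasDerivWithinAt)
      (fun y hy => hM y ((hball y hy).trans_lt hτ)) Set.left_mem_uIcc Set.right_mem_uIcc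
    simpa using this
  | succ n ih =>
    have hM0 : 0 ≤ M := (abs_nonneg _).trans (hM 0 (by simpa using hρ))
    set A := F (n + 1) 0 / n.factorial with hA
    have hstep : ∀ y ∈ Set.uIcc 0 τ, |F 1 y - A * y ^ n| ≤ M * |τ| ^ (n + 1) := by
      intro y hy
      refine (ih (F := fun j => F (j + 1)) (fun j hj => hF (j + 1) (by omega)) hM
        (fun j hj => h0 (j + 1) (by omega)) ((hball y hy).trans_lt hτ) fun z hz => ?_).trans ?_
      · simpa using Set.abs_sub_left_of_mem_uIcc hz
      · exact mul_le_mul_of_nonneg_left (pow_le_pow_left₀ (abs_nonneg _) (hball y hy) _) hM0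
    have hd : ∀ y ∈ Set.uIcc 0 τ, HasDerivAt (fun y => F 0 y - A / (n + 1) * y ^ (n + 1))
        (F 1 y - A * y ^ n) y := by
      intro y hy
      refine ((hF 0 (by omega) y ((hball y hy).trans_lt hτ)).sub
        ((hasDerivAt_pow (n + 1) y).const_mul _)).congr_deriv ?_
      have : (n : ℝ) + 1 ≠ 0 := by positivity
      push_cast
      field_simp
    have := (convex_uIcc 0 τ).norm_image_sub_le_of_norm_hasDerivWithin_le
      (fun y hy => (hd y hy).hasDerivWithinAt) hstep Set.left_mem_uIcc Set.right_mem_uIcc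
    rw [h0 0 (by omega)] at this
    simp only [Real.norm_eq_abs, sub_zero, zero_pow (Nat.succ_ne_zero n), mul_zero] at this
    have e : F (n + 1) 0 / ((n + 1).factorial : ℝ) = A / (n + 1) := by
      rw [hA, Nat.factorial_succ]; push_cast; rw [div_div, mul_comm ((n : ℝ) + 1)]
    rw [e]
    calc _ ≤ M * |τ| ^ (n + 1) * |τ| := this
      _ = _ := by ring

/-- At a local maximum, the first nonvanishing derivative has even order and is negative. -/
lemma chain_nonpos_of_max {ρ M : ℝ} (hρ : 0 < ρ) {n : ℕ} {F : ℕ → ℝ → ℝ}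
    (hF : ∀ j ≤ n, ∀ τ : ℝ, |τ| < ρ → HasDerivAt (F j) (F (j + 1) τ) τ)
    (hM : ∀ τ : ℝ, |τ| < ρ → |F (n + 1) τ| ≤ M) (h0 : ∀ j < n, F j 0 = 0)
    (hmax : ∀ τ : ℝ, |τ| < ρ → F 0 τ ≤ 0) (ς : ℝ) (hς : |ς| = 1) : F n 0 * ς ^ n ≤ 0 := by
  have hM0 : 0 ≤ M := (abs_nonneg _).trans (hM 0 (by simpa using hρ))
  have hfac : (0 : ℝ) < n.factorial := by positivity
  have key : ∀ ε : ℝ, 0 < ε → ε < ρ → F n 0 * ς ^ n ≤ n.factorial * M * ε := by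
    intro ε hε hερ
    have hab : |ε * ς| = ε := by rw [abs_mul, hς, mul_one, abs_of_pos hε]
    have h1 := abs_taylor_chain_le hF hM h0 (τ := ε * ς) (by rwa [hab])
    rw [hab] at h1
    have h2 := hmax (ε * ς) (by rwa [hab])
    have h3 := (abs_le.1 h1).1
    have h4 : F n 0 / n.factorial * (ε * ς) ^ n ≤ M * ε ^ (n + 1) := by linarith
    have h5 : ε ^ n * (F n 0 * ς ^ n) ≤ ε ^ n * (n.factorial * M * ε) := by
      have e1 : ε ^ n * (F n 0 * ς ^ n) = n.factorial * (F n 0 / n.factorial * (ε * ς) ^ n) := by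
        rw [mul_pow]; field_simp
      have e2 : ε ^ n * (n.factorial * M * ε) = n.factorial * (M * ε ^ (n + 1)) := by ring
      rw [e1, e2]
      gcongr
    exact le_of_mul_le_mul_left h5 (by positivity)
  by_contra! hcon
  set a := F n 0 * ς ^ n with ha
  set L := n.factorial * M with hL
  have hL0 : 0 ≤ L := by positivity
  have h1 := key (min (ρ / 2) (a / (2 * (L + 1)))) (lt_min (by linarith) (by positivity))
    ((min_le_left _ _).trans_lt (by linarith))
  have h2 : L * min (ρ / 2) (a / (2 * (L + 1))) ≤ L * (a / (2 * (L + 1))) := by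
    gcongr; exact min_le_right _ _
  have h3 : L * (a / (2 * (L + 1))) ≤ a / 2 := by
    rw [mul_div_assoc', div_le_div_iff₀ (by positivity) (by positivity)]
    nlinarith
  linarith

end TaylorChain

/-! ### Derivatives of the free energy at one site and along the axis -/

section Derivatives

/-- Successive derivatives of `x ↦ β x ^ p - x log x` on the positive half-line. -/
def siteDeriv (p : ℕ) (β : ℝ) : ℕ → ℝ → ℝ
  | 0, x => β * x ^ p - x * Real.log x
  | 1, x => β * p * x ^ (p - 1) - Real.log x - 1
  | j + 2, x => β * p.descFactorial (j + 2) * (x ^ p / x ^ (j + 2)) +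
      (-1) ^ (j + 1) * j.factorial / x ^ (j + 1)

lemma cast_descFactorial_succ (p j : ℕ) :
    (p.descFactorial (j + 1) : ℝ) = (p - j) * p.descFactorial j := by
  rw [Nat.descFactorial_succ]
  rcases le_or_gt j p with h | h
  · rw [Nat.cast_mul, Nat.cast_sub h]
  · rw [Nat.descFactorial_of_lt h]; simp

/-- A quotient `x^p / x^j` avoids truncated exponents, so that one formula covers all orders,
including those above `p`, where the falling factorial vanishes. -/
lemma hasDerivAt_pow_div_pow (p j : ℕ) {x : ℝ} (hx : 0 < x) :
    HasDerivAt (fun x : ℝ => x ^ p / x ^ j) ((p - j) * (x ^ p / x ^ (j + 1))) x := by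
  have h1 := (hasDerivAt_pow p x).div (hasDerivAt_pow j x) (by positivity)
  refine h1.congr_deriv ?_
  have e1 : ∀ n : ℕ, (n : ℝ) * x ^ (n - 1) = n * (x ^ n / x) := by
    intro n
    rcases n with _ | n
    · simp
    · rw [Nat.add_sub_cancel, pow_succ, mul_div_cancel_right₀ _ hx.ne']
  rw [e1 p, e1 j]
  field_simp
  ring

lemma hasDerivAt_siteDeriv (p : ℕ) (β : ℝ) (j : ℕ) {x : ℝ} (hx : 0 < x) :
    HasDerivAt (siteDeriv p β j) (siteDeriv p β (j + 1) x) x := by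
  match j with
  | 0 =>
    refine (((hasDerivAt_pow p x).const_mul β).sub
      ((hasDerivAt_id x).mul (Real.hasDerivAt_log hx.ne'))).congr_deriv ?_
    simp only [siteDeriv, id]
    field_simp
    ring
  | 1 =>
    have h1 : HasDerivAt (fun x : ℝ => β * p * x ^ (p - 1) - Real.log x - 1)
        (β * p * ((p - 1 : ℕ) * x ^ (p - 1 - 1)) - x⁻¹) x :=
      (((hasDerivAt_pow (p - 1) x).const_mul (β * p)).sub (Real.hasDerivAt_log hx.ne')).sub_const 1
    refine h1.congr_deriv ?_
    simp only [siteDeriv]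
    rcases p with _ | _ | p
    · simp; field_simp
    · simp [Nat.descFactorial]; field_simp
    · have e : x ^ (p + 1 + 1) / x ^ 2 = x ^ p := by field_simp; ring
      rw [e]
      simp [Nat.descFactorial]
      field_simp
      ring
  | j + 2 =>
    have h1 : HasDerivAt (fun x : ℝ => β * p.descFactorial (j + 2) * (x ^ p / x ^ (j + 2)) +
        (-1) ^ (j + 1) * j.factorial * ((x : ℝ) ^ 0 / x ^ (j + 1)))
        (β * p.descFactorial (j + 2) * ((p - (j + 2 : ℕ)) * (x ^ p / x ^ (j + 2 + 1))) +
        (-1) ^ (j + 1) * j.factorial * (((0 : ℕ) - (j + 1 : ℕ)) * ((x : ℝ) ^ 0 / x ^ (j + 1 + 1)))) x :=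
      ((hasDerivAt_pow_div_pow p (j + 2) hx).const_mul _).add
        ((hasDerivAt_pow_div_pow 0 (j + 1) hx).const_mul _)
    have e : siteDeriv p β (j + 2) = fun x : ℝ => β * p.descFactorial (j + 2) *
        (x ^ p / x ^ (j + 2)) + (-1) ^ (j + 1) * j.factorial * ((x : ℝ) ^ 0 / x ^ (j + 1)) := by
      ext x; simp only [siteDeriv]; rw [pow_zero, mul_one_div]
    rw [e]
    refine h1.congr_deriv ?_
    change _ = β * p.descFactorial (j + 1 + 2) * (x ^ p / x ^ (j + 1 + 2)) +
      (-1) ^ (j + 1 + 1) * (j + 1).factorial / x ^ (j + 1 + 1)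
    rw [cast_descFactorial_succ p (j + 2), Nat.factorial_succ]
    push_cast
    ring

/-- The entropy contributes `1/x²` and the interaction is nonnegative. Consequently the second
derivative separates points, which the analysis of the Hessian relies on. -/
lemma siteDeriv_three_pos (p : ℕ) {β : ℝ} (hβ : 0 ≤ β) {x : ℝ} (hx : 0 < x) :
    0 < siteDeriv p β 3 x := by
  have : siteDeriv p β 3 x = β * p.descFactorial 3 * (x ^ p / x ^ 3) + 1 / x ^ 2 := by
    simp [siteDeriv]
  rw [this]
  positivity

lemma strictMonoOn_siteDeriv_two (p : ℕ) {β : ℝ} (hβ : 0 ≤ β) :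
    StrictMonoOn (siteDeriv p β 2) (Set.Ioi 0) := by
  refine strictMonoOn_of_deriv_pos (convex_Ioi 0)
    (fun x hx => (hasDerivAt_siteDeriv p β 2 hx).continuousAt.continuousWithinAt) fun x hx => ?_
  rw [interior_Ioi] at hx
  rw [(hasDerivAt_siteDeriv p β 2 hx).deriv]
  exact siteDeriv_three_pos p hβ hx

end Derivatives

section LineDeriv
variable {p q : ℕ} {β h : ℝ}

/-- Successive derivatives of `fline p q β h`. -/
def lineDeriv (p q : ℕ) (β h : ℝ) (j : ℕ) (σ : ℝ) : ℝ :=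
  (((q : ℝ) - 1) / q) ^ j * siteDeriv p β j ((1 + ((q : ℝ) - 1) * σ) / q) +
    (q - 1) * ((-1 / q) ^ j * siteDeriv p β j ((1 - σ) / q)) +
    h * (if j = 0 then (1 + ((q : ℝ) - 1) * σ) / q else if j = 1 then ((q : ℝ) - 1) / q else 0)

lemma hasDerivAt_lineDeriv (j : ℕ) {σ : ℝ} (h0 : 0 < (1 + ((q : ℝ) - 1) * σ) / q)
    (h1 : 0 < (1 - σ) / q) :
    HasDerivAt (lineDeriv p q β h j) (lineDeriv p q β h (j + 1) σ) σ := by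
  have ha : HasDerivAt (fun σ : ℝ => (1 + ((q : ℝ) - 1) * σ) / q) (((q : ℝ) - 1) / q) σ := by
    have := (((hasDerivAt_id σ).const_mul ((q : ℝ) - 1)).const_add 1).div_const (q : ℝ)
    simpa using this
  have hb : HasDerivAt (fun σ : ℝ => (1 - σ) / q) (-1 / q) σ := by
    simpa using ((hasDerivAt_id σ).const_sub 1).div_const (q : ℝ)
  have h2 := (((hasDerivAt_siteDeriv p β j h0).comp σ ha).const_mul ((((q : ℝ) - 1) / q) ^ j)).add
    ((((hasDerivAt_siteDeriv p β j h1).comp σ hb).const_mul ((-1 / (q : ℝ)) ^ j)).const_mul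
      ((q : ℝ) - 1))
  have h3 : HasDerivAt (fun σ : ℝ => h * (if j = 0 then (1 + ((q : ℝ) - 1) * σ) / q else
      if j = 1 then ((q : ℝ) - 1) / q else 0))
      (h * (if j = 0 then ((q : ℝ) - 1) / q else 0)) σ := by
    refine HasDerivAt.const_mul h ?_
    split_ifs
    · exact ha
    · exact hasDerivAt_const _ _
    · exact hasDerivAt_const _ _
  refine (h2.add h3).congr_deriv ?_
  simp only [lineDeriv, Nat.succ_ne_zero, if_false, Nat.add_eq_right]
  ring

end LineDeriv

section Line
variable {p q : ℕ} [NeZero q] {β h s : ℝ}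

lemma freeEnergy_eq_sum (t : Fin q → ℝ) :
    freeEnergy p q β h t = ∑ r, siteDeriv p β 0 (t r) + h * t 0 := by
  simp only [freeEnergy, siteDeriv, Finset.sum_sub_distrib, Finset.mul_sum]
  ring

lemma fline_eq_lineDeriv (σ : ℝ) : fline p q β h σ = lineDeriv p q β h 0 σ := by
  rw [fline, freeEnergy_eq_sum, ← Finset.add_sum_erase Finset.univ _ (Finset.mem_univ 0)]
  have : ∑ r ∈ Finset.univ.erase 0, siteDeriv p β 0 (xvec q σ r) =
      ∑ r ∈ Finset.univ.erase (0 : Fin q), siteDeriv p β 0 ((1 - σ) / q) :=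
    Finset.sum_congr rfl fun r hr => by rw [xvec, if_neg (Finset.ne_of_mem_erase hr)]
  rw [this, Finset.sum_const, Finset.card_erase_of_mem (Finset.mem_univ _), Finset.card_univ,
    Fintype.card_fin, nsmul_eq_mul, Nat.cast_sub NeZero.one_le, lineDeriv]
  simp [xvec]

end Line

section LineIncrement
variable {p q : ℕ} {β h s : ℝ}

lemma hasDerivAt_lineDeriv_add (j : ℕ) {τ : ℝ}
    (hτ : 0 < (1 + ((q : ℝ) - 1) * (s + τ)) / q ∧ 0 < (1 - (s + τ)) / q) :
    HasDerivAt (fun τ => lineDeriv p q β h j (s + τ)) (lineDeriv p q β h (j + 1) (s + τ)) τ :=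
  (hasDerivAt_lineDeriv j hτ.1 hτ.2).comp_const_add s τ

/-- The chain of derivatives of the increment of `fline` at `s`. -/
def lineIncr (p q : ℕ) (β h s : ℝ) (j : ℕ) (τ : ℝ) : ℝ :=
  lineDeriv p q β h j (s + τ) - if j = 0 then lineDeriv p q β h 0 s else 0

lemma hasDerivAt_lineIncr (j : ℕ) {τ : ℝ}
    (hτ : 0 < (1 + ((q : ℝ) - 1) * (s + τ)) / q ∧ 0 < (1 - (s + τ)) / q) :
    HasDerivAt (lineIncr p q β h s j) (lineIncr p q β h s (j + 1) τ) τ := by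
  refine ((hasDerivAt_lineDeriv_add j hτ).sub_const _).congr_deriv ?_
  simp [lineIncr]

lemma lineIncr_zero_eq (n : ℕ) (hn : n ≠ 0) :
    lineIncr p q β h s n 0 = lineDeriv p q β h n s := by
  simp [lineIncr, hn]

lemma lineIncr_zero_of_vanish {n : ℕ} (h0 : ∀ j < n, 0 < j → lineDeriv p q β h j s = 0) :
    ∀ j < n, lineIncr p q β h s j 0 = 0 := by
  intro j hj
  rcases Nat.eq_zero_or_pos j with rfl | h1
  · simp [lineIncr]
  · rw [lineIncr_zero_eq j h1.ne', h0 j hj h1]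

lemma hessForm_coeff (hp : 2 ≤ p) {x : ℝ} (hx : 0 < x) :
    β * p * (p - 1) * x ^ (p - 2) - 1 / x = siteDeriv p β 2 x := by
  obtain ⟨n, rfl⟩ := Nat.exists_eq_add_of_le hp
  have e : x ^ (2 + n) / x ^ 2 = x ^ n := by rw [pow_add]; field_simp
  simp only [siteDeriv, e, Nat.add_sub_cancel_left]
  simp only [Nat.descFactorial, Nat.sub_zero]
  rw [show 2 + n - 1 = n + 1 by omega]
  push_cast
  simp
  ring

/-- Testing the kernel condition against differences of basis vectors, which lie in the hyperplane,
compares the entries `r` and `r'` directly. -/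
lemma hessForm_single_sub_single (m t : Fin q → ℝ) (r r' : Fin q) :
    hessForm p q β m t (Pi.single r 1 - Pi.single r' 1) =
      (β * p * (p - 1) * m r ^ (p - 2) - 1 / m r) * t r -
        (β * p * (p - 1) * m r' ^ (p - 2) - 1 / m r') * t r' := by
  have key : ∀ a : Fin q → ℝ,
      ∑ b, a b * t b * (Pi.single r 1 - Pi.single r' 1 : Fin q → ℝ) b = a r * t r - a r' * t r' := by
    intro a
    simp [Pi.single_apply, mul_sub, Finset.sum_sub_distrib]
  exact key fun b => β * p * (p - 1) * m b ^ (p - 2) - 1 / m b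

end LineIncrement

/-! ### Vanishing derivatives at the maximizer -/

section CriticalPoint
variable {p q : ℕ} [NeZero q] {β h s : ℝ}

/-- The neighborhood is two-sided even at `s = 0`: slightly negative parameters still give
probability vectors. The parity argument for odd derivatives needs this. -/
lemma eventually_line_pos (hs : s ∈ Set.Ico (0 : ℝ) 1) :
    ∀ᶠ σ in 𝓝 s, 0 < (1 + ((q : ℝ) - 1) * σ) / q ∧ 0 < (1 - σ) / q := by
  have hq : (1 : ℝ) ≤ q := by exact_mod_cast NeZero.one_le
  have h0 : 0 < (1 + ((q : ℝ) - 1) * s) / q := by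
    have := hs.1
    exact div_pos (by nlinarith) (by linarith)
  have h1 : 0 < (1 - s) / q := div_pos (by linarith [hs.2]) (by linarith)
  have c0 : ContinuousAt (fun σ : ℝ => (1 + ((q : ℝ) - 1) * σ) / q) s := by fun_prop
  have c1 : ContinuousAt (fun σ : ℝ => (1 - σ) / q) s := by fun_prop
  exact (c0.eventually (lt_mem_nhds h0)).and (c1.eventually (lt_mem_nhds h1))

lemma iteratedDeriv_fline (j : ℕ) :
    ∀ σ : ℝ, (0 < (1 + ((q : ℝ) - 1) * σ) / q ∧ 0 < (1 - σ) / q) →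
      iteratedDeriv j (fline p q β h) σ = lineDeriv p q β h j σ := by
  induction j with
  | zero => intro σ _; rw [iteratedDeriv_zero, fline_eq_lineDeriv]
  | succ j ih =>
    intro σ hσ
    rw [iteratedDeriv_succ]
    have c0 : ContinuousAt (fun σ : ℝ => (1 + ((q : ℝ) - 1) * σ) / q) σ := by fun_prop
    have c1 : ContinuousAt (fun σ : ℝ => (1 - σ) / q) σ := by fun_prop
    have he : iteratedDeriv j (fline p q β h) =ᶠ[𝓝 σ] lineDeriv p q β h j :=
      ((c0.eventually (lt_mem_nhds hσ.1)).and (c1.eventually (lt_mem_nhds hσ.2))).mono ih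
    rw [he.deriv_eq, (hasDerivAt_lineDeriv j hσ.1 hσ.2).deriv]

lemma exists_line_nhds (p : ℕ) (β h : ℝ) (hs : s ∈ Set.Ico (0 : ℝ) 1) (j : ℕ) :
    ∃ ρ M : ℝ, 0 < ρ ∧ ∀ τ : ℝ, |τ| < ρ →
      (0 < (1 + ((q : ℝ) - 1) * (s + τ)) / q ∧ 0 < (1 - (s + τ)) / q) ∧
        |lineDeriv p q β h j (s + τ)| ≤ M := by
  have hpos := eventually_line_pos (q := q) hs
  have hcont : ContinuousAt (lineDeriv p q β h j) s :=
    (hasDerivAt_lineDeriv j hpos.self_of_nhds.1 hpos.self_of_nhds.2).continuousAt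
  have hb : ∀ᶠ σ in 𝓝 s, |lineDeriv p q β h j σ| ≤ |lineDeriv p q β h j s| + 1 :=
    (hcont.abs.eventually (gt_mem_nhds (lt_add_one _))).mono fun σ hσ => hσ.le
  obtain ⟨ρ, hρ, hball⟩ := Metric.eventually_nhds_iff.1 (hpos.and hb)
  exact ⟨ρ, _, hρ, fun τ hτ => hball (by simpa [Real.dist_eq] using hτ)⟩

lemma xvec_mem_stdSimplex {σ : ℝ}
    (hσ : 0 < (1 + ((q : ℝ) - 1) * σ) / q ∧ 0 < (1 - σ) / q) :
    xvec q σ ∈ stdSimplex ℝ (Fin q) := by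
  refine ⟨fun r => ?_, sum_xvec q σ⟩
  unfold xvec
  split_ifs
  · exact hσ.1.le
  · exact hσ.2.le

lemma lineDeriv_mul_pow_nonpos (hs : s ∈ Set.Ico (0 : ℝ) 1)
    (hmax : IsGlobalMaximizer p q β h (xvec q s)) {n : ℕ} (hn : n ≠ 0)
    (h0 : ∀ j < n, 0 < j → lineDeriv p q β h j s = 0) (ς : ℝ) (hς : |ς| = 1) :
    lineDeriv p q β h n s * ς ^ n ≤ 0 := by
  obtain ⟨ρ, M, hρ, hM⟩ := exists_line_nhds (q := q) p β h hs (n + 1)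
  rw [← lineIncr_zero_eq n hn]
  refine chain_nonpos_of_max (M := M) hρ (fun j _ τ hτ => hasDerivAt_lineIncr j (hM τ hτ).1)
    (fun τ hτ => ?_) (lineIncr_zero_of_vanish h0) (fun τ hτ => ?_) ς hς
  · simpa [lineIncr] using (hM τ hτ).2
  · have := hmax.2 (xvec_mem_stdSimplex (hM τ hτ).1)
    simp only [Set.mem_ofPred_eq] at this
    simp only [lineIncr, if_true, ← fline_eq_lineDeriv, sub_nonpos]
    exact this

/-- An odd leading term changes sign, so moving in both directions from a maximum forces it to
vanish. -/
lemma lineDeriv_eq_zero_of_odd (hs : s ∈ Set.Ico (0 : ℝ) 1)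
    (hmax : IsGlobalMaximizer p q β h (xvec q s)) {n : ℕ} (hn : Odd n)
    (h0 : ∀ j < n, 0 < j → lineDeriv p q β h j s = 0) : lineDeriv p q β h n s = 0 := by
  have hn0 : n ≠ 0 := hn.pos.ne'
  have h1 := lineDeriv_mul_pow_nonpos hs hmax hn0 h0 1 (by simp)
  have h2 := lineDeriv_mul_pow_nonpos hs hmax hn0 h0 (-1) (by simp)
  rw [one_pow] at h1
  rw [hn.neg_one_pow] at h2
  linarith

lemma lineDeriv_nonpos_of_even (hs : s ∈ Set.Ico (0 : ℝ) 1)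
    (hmax : IsGlobalMaximizer p q β h (xvec q s)) {n : ℕ} (hn : n ≠ 0)
    (h0 : ∀ j < n, 0 < j → lineDeriv p q β h j s = 0) : lineDeriv p q β h n s ≤ 0 := by
  have h1 := lineDeriv_mul_pow_nonpos hs hmax hn h0 1 (by simp)
  rwa [one_pow, mul_one] at h1

/-- At a special point the second derivative along the axis vanishes, and the transverse second
derivative is negative unless there are no transverse directions. -/
lemma singular_consequences (hp : 2 ≤ p) (hq : 2 ≤ q) (hβ : 0 < β) (hs : s ∈ Set.Ico (0 : ℝ) 1)
    (hmax : IsGlobalMaximizer p q β h (xvec q s))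
    (hsing : IsSingularOnHyperplane p q β (xvec q s)) :
    lineDeriv p q β h 2 s = 0 ∧ (q = 2 ∨ siteDeriv p β 2 ((1 - s) / q) < 0) := by
  have hq1 : (2 : ℝ) ≤ q := by exact_mod_cast hq
  have hq0 : (0 : ℝ) < q := by linarith
  set m₀ := (1 + ((q : ℝ) - 1) * s) / q with hm₀
  set m₁ := (1 - s) / q with hm₁
  have hpos := (eventually_line_pos (q := q) hs).self_of_nhds
  have hm0 : 0 < m₀ := hpos.1
  have hm1 : 0 < m₁ := hpos.2
  have hle : m₁ ≤ m₀ := by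
    rw [hm₀, hm₁]
    refine div_le_div_of_nonneg_right ?_ hq0.le
    nlinarith [hs.1]
  set A := siteDeriv p β 2 m₀ with hA
  set B := siteDeriv p β 2 m₁ with hB
  have hmono := strictMonoOn_siteDeriv_two p hβ.le
  have hBA : B ≤ A := hmono.monotoneOn hm1 hm0 hle
  have hF2 : lineDeriv p q β h 2 s = ((q : ℝ) - 1) / q ^ 2 * ((q - 1) * A + B) := by
    simp only [lineDeriv, ← hm₀, ← hm₁, ← hA, ← hB]
    norm_num
    field_simp
  have hF1 : lineDeriv p q β h 1 s = 0 :=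
    lineDeriv_eq_zero_of_odd hs hmax odd_one fun j h1 h2 => by omega
  have hv2 : ∀ j < 2, 0 < j → lineDeriv p q β h j s = 0 := fun j h1 h2 => by
    obtain rfl : j = 1 := by omega
    exact hF1
  have hF2le := lineDeriv_nonpos_of_even hs hmax two_ne_zero hv2
  have hcoef : 0 < ((q : ℝ) - 1) / q ^ 2 := div_pos (by linarith) (by positivity)
  have hABle : (q - 1) * A + B ≤ 0 := by
    rw [hF2] at hF2le
    by_contra! hcon
    linarith [mul_pos hcoef hcon]
  -- A kernel vector satisfies `B t r = A t 0` for `r ≠ 0`; summing gives `((q-1)A + B) t 0 = 0`. If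
  -- `t 0 = 0` then `B = 0`, so `A ≥ 0` by monotonicity, and the second-order condition `hABle`
  -- again forces equality.
  have hAB : (q - 1) * A + B = 0 := by
    obtain ⟨t, ht0, hsum, hker⟩ := hsing
    have hK : ∀ r, r ≠ 0 → B * t r = A * t 0 := by
      intro r hr
      have h1 := hker (Pi.single r 1 - Pi.single 0 1) (by simp)
      rw [hessForm_single_sub_single] at h1
      simp only [xvec, if_true, if_neg hr] at h1
      rw [hessForm_coeff hp hm1, hessForm_coeff hp hm0] at h1
      linarith
    have hsum' : ∑ r ∈ Finset.univ.erase 0, t r = -t 0 := by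
      have := Finset.add_sum_erase Finset.univ t (Finset.mem_univ 0)
      linarith
    have hprod : ((q - 1) * A + B) * t 0 = 0 := by
      have h1 : ∑ r ∈ Finset.univ.erase 0, B * t r = ∑ r ∈ Finset.univ.erase (0 : Fin q), A * t 0 :=
        Finset.sum_congr rfl fun r hr => hK r (Finset.ne_of_mem_erase hr)
      rw [← Finset.mul_sum, hsum', Finset.sum_const, Finset.card_erase_of_mem (Finset.mem_univ _),
        Finset.card_univ, Fintype.card_fin, nsmul_eq_mul, Nat.cast_sub NeZero.one_le] at h1
      push_cast at h1
      linear_combination -h1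
    rcases mul_eq_zero.1 hprod with h1 | h1
    · exact h1
    · have hB0 : B = 0 := by
        by_contra hne
        refine ht0 (funext fun r => ?_)
        by_cases hr : r = 0
        · rw [hr, h1]; rfl
        · have := hK r hr
          rw [h1, mul_zero] at this
          exact (mul_eq_zero.1 this).resolve_left hne
      have hA0 : 0 ≤ A := hB0 ▸ hBA
      have : 0 ≤ (q - 1) * A := mul_nonneg (by linarith) hA0
      linarith
  have hF2z : lineDeriv p q β h 2 s = 0 := by rw [hF2, hAB, mul_zero]
  refine ⟨hF2z, ?_⟩
  -- If `B ≥ 0`, then `A ≥ B` and `(q-1)A + B = 0` give `A = B = 0`, hence `m₀ = m₁`. The third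
  -- derivative is then a positive multiple of `q - 2`, and it must vanish at the maximum.
  by_cases hB0 : B < 0
  · exact Or.inr hB0
  · left
    have hB0' : 0 ≤ B := not_lt.1 hB0
    have hA0 : 0 ≤ A := hB0'.trans hBA
    have h1 : 0 ≤ (q - 1) * A := mul_nonneg (by linarith) hA0
    have hBz : B = 0 := by linarith
    have hAz : A = 0 := by
      have : (q - 1) * A = 0 := by linarith
      exact (mul_eq_zero.1 this).resolve_left (by linarith)
    have hmm : m₀ = m₁ := hmono.injOn hm0 hm1 (by rw [← hA, ← hB, hAz, hBz])
    have hF3 : lineDeriv p q β h 3 s = 0 := by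
      refine lineDeriv_eq_zero_of_odd hs hmax (by decide) fun j h1 h2 => ?_
      obtain rfl | rfl : j = 1 ∨ j = 2 := by omega
      · exact hF1
      · exact hF2z
    have hC := siteDeriv_three_pos p hβ.le hm1
    have hF3' : lineDeriv p q β h 3 s =
        ((q : ℝ) - 1) / q ^ 3 * siteDeriv p β 3 m₁ * (q * (q - 2)) := by
      simp only [lineDeriv, ← hm₀, ← hm₁, hmm]
      norm_num
      field_simp
      ring
    rw [hF3'] at hF3
    have h2 : 0 < ((q : ℝ) - 1) / q ^ 3 * siteDeriv p β 3 m₁ :=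
      mul_pos (div_pos (by linarith) (by positivity)) hC
    have h3 := (mul_eq_zero.1 hF3).resolve_left h2.ne'
    have h4 := (mul_eq_zero.1 h3).resolve_left hq0.ne'
    have h5 : (q : ℝ) = 2 := by linarith
    exact_mod_cast h5

end CriticalPoint

/-! ### Geometry of the simplex around the axis -/

lemma mem_Icc_of_mem_stdSimplex {q : ℕ} {t : Fin q → ℝ} (ht : t ∈ stdSimplex ℝ (Fin q)) (r : Fin q) :
    t r ∈ Set.Icc (0 : ℝ) 1 :=
  ⟨ht.1 r, ht.2 ▸ Finset.single_le_sum (fun i _ => ht.1 i) (Finset.mem_univ r)⟩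

section Geometry
variable {q : ℕ} [NeZero q] {s : ℝ} {t : Fin q → ℝ}

lemma sum_erase_const (a : ℝ) : ∑ _r ∈ Finset.univ.erase (0 : Fin q), a = (q - 1) * a := by
  rw [Finset.sum_const, Finset.card_erase_of_mem (Finset.mem_univ _), Finset.card_univ,
    Fintype.card_fin, nsmul_eq_mul, Nat.cast_sub NeZero.one_le, Nat.cast_one]

lemma transverseSq_eq (hq : 2 ≤ q) (s : ℝ) (t : Fin q → ℝ) :
    transverseSq q t = ∑ r ∈ Finset.univ.erase 0, (t r - ((1 - s) / q + axisCoord q s t)) ^ 2 := by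
  have h1 : (2 : ℝ) ≤ q := by exact_mod_cast hq
  have h2 : (q : ℝ) - 1 ≠ 0 := by linarith
  rw [transverseSq, one_sub_eq_of_axisCoord hq s t, mul_div_cancel_left₀ _ h2]

lemma sum_erase_sub_eq_zero (hq : 2 ≤ q) (s : ℝ) (ht : t ∈ stdSimplex ℝ (Fin q)) :
    ∑ r ∈ Finset.univ.erase 0, (t r - ((1 - s) / q + axisCoord q s t)) = 0 := by
  rw [Finset.sum_sub_distrib, sum_erase_const, sum_erase_eq ht.2, one_sub_eq_of_axisCoord hq s t,
    sub_self]

/-- Identifies `s - q * axisCoord` as the parameter of the axis point having the same coordinate 0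
as `t`. -/
lemma line_coords (hq : 2 ≤ q) (s : ℝ) (t : Fin q → ℝ) :
    (1 + ((q : ℝ) - 1) * (s + -(q * axisCoord q s t))) / q = t 0 ∧
      (1 - (s + -(q * axisCoord q s t))) / q = (1 - s) / q + axisCoord q s t := by
  have h1 : (2 : ℝ) ≤ q := by exact_mod_cast hq
  have h3 : (q : ℝ) ≠ 0 := by linarith
  have h := one_sub_eq_of_axisCoord hq s t
  constructor
  · rw [← sub_sub_cancel 1 (t 0), h]
    field_simp
    ring
  · field_simp
    ring

lemma mean_mem_Icc (hq : 2 ≤ q) (s : ℝ) (ht : t ∈ stdSimplex ℝ (Fin q)) :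
    (1 - s) / q + axisCoord q s t ∈ Set.Icc (0 : ℝ) 1 := by
  have h1 : (2 : ℝ) ≤ q := by exact_mod_cast hq
  have h := one_sub_eq_of_axisCoord hq s t
  have h0 := mem_Icc_of_mem_stdSimplex ht 0
  constructor
  · by_contra! hcon
    nlinarith [h0.2]
  · by_contra! hcon
    nlinarith [h0.1]

lemma abs_axisCoord_le_one (hq : 2 ≤ q) (hs : s ∈ Set.Ico (0 : ℝ) 1)
    (ht : t ∈ stdSimplex ℝ (Fin q)) : |axisCoord q s t| ≤ 1 := by
  have h1 : (2 : ℝ) ≤ q := by exact_mod_cast hq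
  have h := mean_mem_Icc hq s ht
  have h2 : 0 ≤ (1 - s) / q := div_nonneg (by linarith [hs.2]) (by linarith)
  have h3 : (1 - s) / q ≤ 1 := (div_le_one (by linarith)).2 (by linarith [hs.1])
  rw [abs_le]
  constructor <;> linarith [h.1, h.2]

lemma abs_axisCoord_lt (hq : 2 ≤ q) (ht : t ∈ stdSimplex ℝ (Fin q)) {ρ : ℝ}
    (hρ : ∀ r ≠ 0, |t r - (1 - s) / q| < ρ) : |axisCoord q s t| < ρ := by
  have h1 : (2 : ℝ) ≤ q := by exact_mod_cast hq
  have hne : (Finset.univ.erase (0 : Fin q)).Nonempty := by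
    rw [← Finset.card_pos, Finset.card_erase_of_mem (Finset.mem_univ _), Finset.card_univ,
      Fintype.card_fin]
    omega
  have h2 := sum_erase_sub_eq_zero hq s ht
  have h3 : ((q : ℝ) - 1) * axisCoord q s t =
      ∑ r ∈ Finset.univ.erase 0, (t r - (1 - s) / q) := by
    rw [← sum_erase_const, ← sub_eq_zero, ← Finset.sum_sub_distrib, ← neg_eq_zero,
      ← Finset.sum_neg_distrib, ← h2]
    exact Finset.sum_congr rfl fun r _ => by ring
  have h4 : ((q : ℝ) - 1) * |axisCoord q s t| < (q - 1) * ρ := by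
    rw [← abs_of_pos (show (0 : ℝ) < q - 1 by linarith), ← abs_mul, h3,
      abs_of_pos (show (0 : ℝ) < q - 1 by linarith), ← sum_erase_const ρ]
    exact (Finset.abs_sum_le_sum_abs _ _).trans_lt
      (Finset.sum_lt_sum_of_nonempty hne fun r hr => hρ r (Finset.ne_of_mem_erase hr))
  exact lt_of_mul_lt_mul_left h4 (by linarith)

end Geometry

/-! ### Coercivity of the free energy deficit -/

section Coercivity
variable {p q : ℕ} [NeZero q] {β h s : ℝ}

lemma freeEnergy_eq_line_add (hq : 2 ≤ q) (s : ℝ) (t : Fin q → ℝ) :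
    freeEnergy p q β h t = lineDeriv p q β h 0 (s + -(q * axisCoord q s t)) +
      ∑ r ∈ Finset.univ.erase 0,
        (siteDeriv p β 0 (t r) - siteDeriv p β 0 ((1 - s) / q + axisCoord q s t)) := by
  obtain ⟨e0, e1⟩ := line_coords hq s t
  rw [freeEnergy_eq_sum, ← Finset.add_sum_erase Finset.univ _ (Finset.mem_univ 0),
    Finset.sum_sub_distrib, sum_erase_const, lineDeriv, e0, e1]
  simp
  ring

/-- Expand around the average of the coordinates other than 0: linear terms cancel because
deviations sum to zero, leaving a negative quadratic form. For `q = 2` there is a single such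
coordinate and both sides are zero. -/
lemma exists_transverse_bound (hq : 2 ≤ q) (hs : s ∈ Set.Ico (0 : ℝ) 1)
    (htr : q = 2 ∨ siteDeriv p β 2 ((1 - s) / q) < 0) :
    ∃ ρ c : ℝ, 0 < ρ ∧ 0 < c ∧ ∀ t ∈ stdSimplex ℝ (Fin q),
      (∀ r ≠ 0, |t r - (1 - s) / q| < ρ) →
      ∑ r ∈ Finset.univ.erase 0,
        (siteDeriv p β 0 (t r) - siteDeriv p β 0 ((1 - s) / q + axisCoord q s t)) ≤
        -(c * transverseSq q t) := by
  rcases htr with h2 | ha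
  · refine ⟨1, 1, one_pos, one_pos, fun t ht _ => ?_⟩
    have hcard : (Finset.univ.erase (0 : Fin q)).card = 1 := by
      rw [Finset.card_erase_of_mem (Finset.mem_univ _), Finset.card_univ, Fintype.card_fin, h2]
    obtain ⟨r, hr⟩ := Finset.card_eq_one.1 hcard
    have h3 := sum_erase_sub_eq_zero hq s ht
    rw [hr, Finset.sum_singleton] at h3
    rw [transverseSq_eq hq s, hr, Finset.sum_singleton, Finset.sum_singleton, h3,
      sub_eq_zero.1 h3]
    simp
  · set m := (1 - s) / (q : ℝ) with hm
    set a := siteDeriv p β 2 m with haa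
    have hm0 : 0 < m := (eventually_line_pos (q := q) hs).self_of_nhds.2
    have hcont : ContinuousAt (siteDeriv p β 2) m := (hasDerivAt_siteDeriv p β 2 hm0).continuousAt
    have hb : ∀ᶠ x in 𝓝 m, |siteDeriv p β 2 x - a| < -a / 4 := by
      have : ContinuousAt (fun x => |siteDeriv p β 2 x - a|) m := (hcont.sub_const a).abs
      refine this.eventually (gt_mem_nhds ?_)
      simp only [← haa, sub_self, abs_zero]
      linarith
    obtain ⟨ρ, hρ, hball⟩ := Metric.eventually_nhds_iff.1 ((lt_mem_nhds hm0).and hb)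
    simp only [Real.dist_eq] at hball
    refine ⟨ρ, -a / 4, hρ, by linarith, fun t ht hnear => ?_⟩
    have hX := abs_axisCoord_lt hq ht hnear
    set X := axisCoord q s t with hXd
    have hsum := sum_erase_sub_eq_zero hq s ht
    rw [← hm, ← hXd] at hsum
    have hterm : ∀ r ∈ Finset.univ.erase (0 : Fin q),
        siteDeriv p β 0 (t r) - siteDeriv p β 0 (m + X) ≤
          (t r - (m + X)) * siteDeriv p β 1 (m + X) + a / 4 * (t r - (m + X)) ^ 2 := by
      intro r hr
      set δ := t r - (m + X) with hδ
      have hδe : t r = (m + X) + δ := by ring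
      have hseg : ∀ x ∈ Set.uIcc (m + X) ((m + X) + δ), |x - m| < ρ := by
        intro x hx
        have hx1 : m + X ∈ Metric.ball m ρ := by simpa [Real.dist_eq] using hX
        have hx2 : (m + X) + δ ∈ Metric.ball m ρ := by
          rw [← hδe]; simpa [Real.dist_eq] using hnear r (Finset.ne_of_mem_erase hr)
        have := (convex_ball m ρ).segment_subset hx1 hx2 (by rwa [segment_eq_uIcc])
        simpa [Real.dist_eq] using this
      -- Subtracting `a/2 x²` makes the second derivative smaller than `-a/4` in absolute value, so
      -- the quadratic coefficient is at most `a/2 - a/4 = a/4`.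
      have key := abs_taylor_two_le (f := fun x => siteDeriv p β 0 x - a / 2 * x ^ 2)
        (f₁ := fun x => siteDeriv p β 1 x - a * x) (f₂ := fun x => siteDeriv p β 2 x - a)
        (w := m + X) (δ := δ) (M := -a / 4)
        (fun x hx => by
          refine ((hasDerivAt_siteDeriv p β 0 (hball (hseg x hx)).1).sub
            ((hasDerivAt_pow 2 x).const_mul (a / 2))).congr_deriv ?_
          simp; ring)
        (fun x hx => by
          refine ((hasDerivAt_siteDeriv p β 1 (hball (hseg x hx)).1).sub
            ((hasDerivAt_id x).const_mul a)).congr_deriv ?_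
          simp)
        (fun x hx => (hball (hseg x hx)).2.le)
      have := (abs_le.1 key).2
      rw [hδe]
      nlinarith
    refine (Finset.sum_le_sum hterm).trans (le_of_eq ?_)
    rw [Finset.sum_add_distrib, ← Finset.sum_mul, ← Finset.mul_sum, hsum, zero_mul, zero_add,
      transverseSq_eq hq s, ← hm, ← hXd]
    ring

/-- The radius makes the Taylor remainder at most half of the leading term. -/
lemma exists_line_bound (hs : s ∈ Set.Ico (0 : ℝ) 1) {n : ℕ} (hn : n ≠ 0) (hev : Even n)
    (h0 : ∀ j < n, 0 < j → lineDeriv p q β h j s = 0) (hneg : lineDeriv p q β h n s < 0) :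
    ∃ ρ c : ℝ, 0 < ρ ∧ 0 < c ∧ ∀ τ : ℝ, |τ| < ρ →
      lineDeriv p q β h 0 (s + τ) - lineDeriv p q β h 0 s ≤ -(c * τ ^ n) := by
  obtain ⟨ρ, M, hρ, hM⟩ := exists_line_nhds (q := q) p β h hs (n + 1)
  have hM0 : 0 ≤ M := (abs_nonneg _).trans (hM 0 (by simpa using hρ)).2
  set A := lineDeriv p q β h n s / n.factorial with hA
  have hA0 : A < 0 := div_neg_of_neg_of_pos hneg (by positivity)
  refine ⟨min ρ (-A / (2 * (M + 1))), -A / 2, lt_min hρ (div_pos (by linarith) (by linarith)),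
    by linarith, fun τ hτ => ?_⟩
  have h1 := abs_taylor_chain_le (F := lineIncr p q β h s) (M := M) (n := n)
    (fun j _ τ hτ => hasDerivAt_lineIncr j (hM τ hτ).1)
    (fun τ hτ => by simpa [lineIncr] using (hM τ hτ).2) (lineIncr_zero_of_vanish h0)
    (hτ.trans_le (min_le_left _ _))
  rw [lineIncr_zero_eq n hn, ← hA] at h1
  have h2 := (abs_le.1 h1).2
  have h3 : M * |τ| ≤ -A / 2 := by
    have := (lt_div_iff₀ (by linarith : 0 < 2 * (M + 1))).1 (hτ.trans_le (min_le_right _ _))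
    nlinarith [abs_nonneg τ]
  have h4 : M * |τ| ^ (n + 1) ≤ -A / 2 * τ ^ n := by
    rw [pow_succ, hev.pow_abs]
    have := mul_le_mul_of_nonneg_right h3 (hev.pow_nonneg τ)
    linarith
  have h5 : lineIncr p q β h s 0 τ = lineDeriv p q β h 0 (s + τ) - lineDeriv p q β h 0 s := by
    simp [lineIncr]
  rw [← h5]
  linarith

lemma continuous_freeEnergy : Continuous (freeEnergy p q β h) := by
  unfold freeEnergy
  refine ((continuous_const.mul (continuous_finsetSum _ fun r _ => (continuous_apply r).pow p)).add
    (continuous_const.mul (continuous_apply 0))).sub (continuous_finsetSum _ fun r _ => ?_)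
  exact Real.continuous_mul_log.comp (continuous_apply r)

lemma continuous_axisCoord : Continuous (axisCoord q s) :=
  ((continuous_apply 0).sub continuous_const).div_const _

lemma continuous_transverseSq : Continuous (transverseSq q) :=
  continuous_finsetSum _ fun r _ =>
    ((continuous_apply r).sub ((continuous_const.sub (continuous_apply 0)).div_const _)).pow 2

/-- Around a unique maximizer on the axis the free energy deficit dominates `axisCoord ^ n` and
`transverseSq`, if the derivatives along the axis up to order `n - 1` vanish. -/
lemma exists_coercive (hq : 2 ≤ q) (hs : s ∈ Set.Ico (0 : ℝ) 1)
    (hmax : IsGlobalMaximizer p q β h (xvec q s))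
    (huniq : ∀ m, IsGlobalMaximizer p q β h m → m = xvec q s) {n : ℕ} (hn : n ≠ 0) (hev : Even n)
    (h0 : ∀ j < n, 0 < j → lineDeriv p q β h j s = 0) (hneg : lineDeriv p q β h n s < 0)
    (htr : q = 2 ∨ siteDeriv p β 2 ((1 - s) / q) < 0) :
    ∃ c' : ℝ, 0 < c' ∧ ∀ t ∈ stdSimplex ℝ (Fin q),
      c' * (axisCoord q s t ^ n + transverseSq q t) ≤
        freeEnergy p q β h (xvec q s) - freeEnergy p q β h t := by
  have hq1 : (2 : ℝ) ≤ q := by exact_mod_cast hq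
  have hq0 : (0 : ℝ) < q := by linarith
  obtain ⟨ρ₁, c₁, hρ₁, hc₁, htrans⟩ := exists_transverse_bound (p := p) (β := β) hq hs htr
  obtain ⟨ρ₂, c₂, hρ₂, hc₂, hline⟩ := exists_line_bound hs hn hev h0 hneg
  -- The parameter along the axis moves by `-q * axisCoord`, hence the division by `q`.
  set ρ := min ρ₁ (ρ₂ / q) with hρd
  have hρ : 0 < ρ := lt_min hρ₁ (by positivity)
  have hΘ : ∀ t : Fin q → ℝ, 0 ≤ axisCoord q s t ^ n + transverseSq q t := fun t =>
    add_nonneg (hev.pow_nonneg _) (transverseSq_nonneg t)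
  -- Away from the maximizer, compactness and uniqueness give a positive gap `d`, while the
  -- right-hand quantity is bounded on the simplex.
  have hfar : ∃ c₃ : ℝ, 0 < c₃ ∧ ∀ t ∈ stdSimplex ℝ (Fin q), (∃ r ≠ 0, ρ ≤ |t r - (1 - s) / q|) →
      c₃ * (axisCoord q s t ^ n + transverseSq q t) ≤
        freeEnergy p q β h (xvec q s) - freeEnergy p q β h t := by
    have hcl : IsClosed {t : Fin q → ℝ | ∃ r ≠ 0, ρ ≤ |t r - (1 - s) / q|} := by
      have : {t : Fin q → ℝ | ∃ r ≠ 0, ρ ≤ |t r - (1 - s) / q|} =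
          ⋃ r ∈ {r : Fin q | r ≠ 0}, {t | ρ ≤ |t r - (1 - s) / q|} := by
        ext t; simp
      rw [this]
      exact (Set.toFinite _).isClosed_biUnion fun r _ =>
        isClosed_le continuous_const (((continuous_apply r).sub continuous_const).abs)
    have hK := (isCompact_stdSimplex ℝ (Fin q)).inter_right hcl
    rcases Set.eq_empty_or_nonempty
      (stdSimplex ℝ (Fin q) ∩ {t : Fin q → ℝ | ∃ r ≠ 0, ρ ≤ |t r - (1 - s) / q|}) with he | hne
    · exact ⟨1, one_pos, fun t ht hr => absurd he (Set.Nonempty.ne_empty ⟨t, ht, hr⟩)⟩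
    · obtain ⟨T, ⟨hT, hTr⟩, hTmax⟩ := hK.exists_isMaxOn hne
        (continuous_freeEnergy (p := p) (β := β) (h := h)).continuousOn
      have hgap : freeEnergy p q β h T < freeEnergy p q β h (xvec q s) := by
        by_contra! hcon
        have hTm : IsGlobalMaximizer p q β h T := ⟨hT, fun t ht => (hmax.2 ht).trans hcon⟩
        obtain ⟨r, hr, hr'⟩ := hTr
        rw [huniq T hTm, xvec, if_neg hr, sub_self, abs_zero] at hr'
        linarith
      obtain ⟨B, hB⟩ := (isCompact_stdSimplex ℝ (Fin q)).exists_bound_of_continuousOn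
        (((continuous_axisCoord (s := s)).pow n).add continuous_transverseSq).continuousOn
      have hB0 : 0 ≤ B := (norm_nonneg _).trans (hB T hT)
      set d := freeEnergy p q β h (xvec q s) - freeEnergy p q β h T with hd
      have hd0 : 0 < d := sub_pos.2 hgap
      refine ⟨d / (B + 1), by positivity, fun t ht hr => ?_⟩
      have h1 : freeEnergy p q β h t ≤ freeEnergy p q β h T := hTmax ⟨ht, hr⟩
      have h2 : axisCoord q s t ^ n + transverseSq q t ≤ B := (Real.le_norm_self _).trans (hB t ht)
      calc d / (B + 1) * (axisCoord q s t ^ n + transverseSq q t) ≤ d / (B + 1) * (B + 1) :=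
            mul_le_mul_of_nonneg_left (by linarith) (by positivity)
        _ = d := div_mul_cancel₀ _ (by positivity)
        _ ≤ _ := by rw [hd]; linarith
  obtain ⟨c₃, hc₃, hfar⟩ := hfar
  refine ⟨min (min c₁ (c₂ * q ^ n)) c₃, by positivity, fun t ht => ?_⟩
  by_cases hnear : ∃ r ≠ 0, ρ ≤ |t r - (1 - s) / q|
  · exact (mul_le_mul_of_nonneg_right (min_le_right _ _) (hΘ t)).trans (hfar t ht hnear)
  · push Not at hnear
    have hX := abs_axisCoord_lt hq ht hnear
    have h1 := htrans t ht fun r hr => (hnear r hr).trans_le (min_le_left _ _)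
    have hτ : |-(q * axisCoord q s t)| < ρ₂ := by
      rw [abs_neg, abs_mul, abs_of_pos hq0]
      have := (lt_div_iff₀ hq0).1 (hX.trans_le (min_le_right _ _))
      linarith
    have h2 := hline _ hτ
    rw [hev.neg_pow, mul_pow] at h2
    have e1 : freeEnergy p q β h (xvec q s) = lineDeriv p q β h 0 s := fline_eq_lineDeriv s
    rw [e1, freeEnergy_eq_line_add hq s t]
    have h3 : min (min c₁ (c₂ * q ^ n)) c₃ ≤ c₁ := (min_le_left _ _).trans (min_le_left _ _)
    have h4 : min (min c₁ (c₂ * q ^ n)) c₃ ≤ c₂ * q ^ n :=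
      (min_le_left _ _).trans (min_le_right _ _)
    have h5 := mul_le_mul_of_nonneg_right h3 (transverseSq_nonneg t)
    have h6 := mul_le_mul_of_nonneg_right h4 (hev.pow_nonneg (axisCoord q s t))
    rw [mul_add]
    linarith

end Coercivity

/-! ### Expansion of the drift -/

section Drift
variable {p q : ℕ} [NeZero q] {β h s : ℝ}

lemma exponent_le (hβ : 0 ≤ β) {a w : ℝ} (ha : a ∈ Set.Icc (0 : ℝ) 1) (hw : w ∈ Set.Icc (0 : ℝ) 1) :
    β * p * (w ^ (p - 1) - a ^ (p - 1)) - h ≤ β * p + |h| := by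
  have h1 := pow_le_one₀ (n := p - 1) hw.1 hw.2
  have h2 := pow_nonneg ha.1 (p - 1)
  have h3 : β * p * (w ^ (p - 1) - a ^ (p - 1)) ≤ β * p * 1 :=
    mul_le_mul_of_nonneg_left (by linarith) (by positivity)
  linarith [neg_abs_le h]

/-- Replacing each coordinate other than 0 by their average costs only second order, since the
first-order terms share one coefficient and the deviations sum to zero. -/
lemma exists_abs_drift_sub_le (hq : 2 ≤ q) (hβ : 0 ≤ β) (s : ℝ) :
    ∃ C, 0 ≤ C ∧ ∀ t ∈ stdSimplex ℝ (Fin q),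
      |drift p q β h t - (q - 1) * (t 0 * Real.exp (β * p *
        (((1 - s) / q + axisCoord q s t) ^ (p - 1) - t 0 ^ (p - 1)) - h) -
          ((1 - s) / q + axisCoord q s t))| ≤ C * transverseSq q t := by
  set E := Real.exp (β * p + |h|) with hE
  set L := β * p * (p - 1 : ℕ) with hL
  set L' := β * p * ((p - 1 : ℕ) * (p - 1 - 1 : ℕ)) with hL'
  have hL0 : 0 ≤ L := by positivity
  have hL0' : 0 ≤ L' := by positivity
  refine ⟨E * (L ^ 2 + L'), by positivity, fun t ht => ?_⟩
  have hv := mean_mem_Icc hq s ht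
  set v := (1 - s) / q + axisCoord q s t with hvd
  have ha := mem_Icc_of_mem_stdSimplex ht 0
  set a := t 0 with had
  have hterm : ∀ r ∈ Finset.univ.erase (0 : Fin q),
      |(a * Real.exp (β * p * (t r ^ (p - 1) - a ^ (p - 1)) - h) - t r) -
        (a * Real.exp (β * p * (v ^ (p - 1) - a ^ (p - 1)) - h) - v) - (t r - v) *
        (a * (Real.exp (β * p * (v ^ (p - 1) - a ^ (p - 1)) - h) * (L * v ^ (p - 1 - 1))) - 1)| ≤
        E * (L ^ 2 + L') * (t r - v) ^ 2 := by
    intro r _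
    have hr := mem_Icc_of_mem_stdSimplex ht r
    set δ := t r - v with hδ
    have hδe : t r = v + δ := by ring
    have hD : ∀ x : ℝ, HasDerivAt (fun x => Real.exp (β * p * (x ^ (p - 1) - a ^ (p - 1)) - h))
        (Real.exp (β * p * (x ^ (p - 1) - a ^ (p - 1)) - h) * (L * x ^ (p - 1 - 1))) x := by
      intro x
      refine ((((hasDerivAt_pow (p - 1) x).sub_const _).const_mul (β * p)).sub_const h).exp.congr_deriv ?_
      rw [hL]; ring
    rw [hδe]
    refine abs_taylor_two_le
      (f := fun x => a * Real.exp (β * p * (x ^ (p - 1) - a ^ (p - 1)) - h) - x)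
      (f₁ := fun x => a * (Real.exp (β * p * (x ^ (p - 1) - a ^ (p - 1)) - h) *
        (L * x ^ (p - 1 - 1))) - 1)
      (f₂ := fun x => a * (Real.exp (β * p * (x ^ (p - 1) - a ^ (p - 1)) - h) *
        (L * x ^ (p - 1 - 1)) * (L * x ^ (p - 1 - 1)) +
        Real.exp (β * p * (x ^ (p - 1) - a ^ (p - 1)) - h) * (L' * x ^ (p - 1 - 1 - 1))))
      (fun x _ => ((hD x).const_mul a).sub (hasDerivAt_id x))
      (fun x _ => ?_) (fun x hx => ?_)
    · refine ((((hD x).mul ((hasDerivAt_pow (p - 1 - 1) x).const_mul L)).const_mul a).sub_const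
        1).congr_deriv ?_
      rw [hL, hL']; ring
    · have hx01 : x ∈ Set.Icc (0 : ℝ) 1 := by
        have := (convex_Icc (0 : ℝ) 1).segment_subset hv (hδe ▸ hr) (by rwa [segment_eq_uIcc])
        exact this
      have hexp : Real.exp (β * p * (x ^ (p - 1) - a ^ (p - 1)) - h) ≤ E :=
        Real.exp_le_exp.2 (exponent_le hβ ha hx01)
      have h1 : x ^ (p - 1 - 1) ≤ 1 := pow_le_one₀ hx01.1 hx01.2
      have h2 : x ^ (p - 1 - 1 - 1) ≤ 1 := pow_le_one₀ hx01.1 hx01.2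
      have h10 : 0 ≤ x ^ (p - 1 - 1) := pow_nonneg hx01.1 _
      have h20 : 0 ≤ x ^ (p - 1 - 1 - 1) := pow_nonneg hx01.1 _
      have ha0 := ha.1
      rw [abs_of_nonneg (by positivity)]
      calc _ ≤ 1 * (E * (L * 1) * (L * 1) + E * (L' * 1)) := by gcongr; exact ha.2
        _ = _ := by ring
  have hsum := sum_erase_sub_eq_zero hq s ht
  rw [← hvd] at hsum
  have e : drift p q β h t - (q - 1) * (a * Real.exp (β * p * (v ^ (p - 1) - a ^ (p - 1)) - h) - v) =
      ∑ r ∈ Finset.univ.erase (0 : Fin q),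
      ((a * Real.exp (β * p * (t r ^ (p - 1) - a ^ (p - 1)) - h) - t r) -
        (a * Real.exp (β * p * (v ^ (p - 1) - a ^ (p - 1)) - h) - v) - (t r - v) *
        (a * (Real.exp (β * p * (v ^ (p - 1) - a ^ (p - 1)) - h) * (L * v ^ (p - 1 - 1))) - 1)) := by
    rw [Finset.sum_sub_distrib, Finset.sum_sub_distrib, ← Finset.sum_mul, hsum, zero_mul, sub_zero,
      sum_erase_const, drift]
  rw [e, transverseSq_eq hq s, ← hvd, Finset.mul_sum]
  exact (Finset.abs_sum_le_sum_abs _ _).trans (Finset.sum_le_sum hterm)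

/-- The drift along the axis, in terms of the first derivative of `fline`. -/
lemma axis_flow_eq (hq : 2 ≤ q) {t : Fin q → ℝ} (h0 : 0 < t 0)
    (hv : 0 < (1 - s) / q + axisCoord q s t) :
    t 0 * Real.exp (β * p *
        (((1 - s) / q + axisCoord q s t) ^ (p - 1) - t 0 ^ (p - 1)) - h) =
      ((1 - s) / q + axisCoord q s t) * Real.exp
        (-(q / (q - 1) * lineDeriv p q β h 1 (s + -(q * axisCoord q s t)))) := by
  have hq1 : (2 : ℝ) ≤ q := by exact_mod_cast hq
  have hq2 : (q : ℝ) - 1 ≠ 0 := by linarith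
  have hq3 : (q : ℝ) ≠ 0 := by linarith
  obtain ⟨e0, e1⟩ := line_coords hq s t
  set v := (1 - s) / q + axisCoord q s t with hvd
  have e : -(q / (q - 1) * lineDeriv p q β h 1 (s + -(q * axisCoord q s t))) =
      (β * p * (v ^ (p - 1) - t 0 ^ (p - 1)) - h) + (Real.log (t 0) - Real.log v) := by
    simp only [lineDeriv, e0, e1, siteDeriv]
    norm_num
    field_simp
    ring
  rw [e, Real.exp_add _ (_ - _), Real.exp_sub (Real.log _), Real.exp_log h0, Real.exp_log hv]
  field_simp

/-- By `axis_flow_eq` the flow is `(q-1) v (exp D - 1)` with `(q-1) D = -q f'(s - qX)`, where `X` is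
`axisCoord` and `v = (1-s)/q + X`. Taylor expansion of `f'` at order `2k-1` yields the leading term.
Replacing `exp D - 1` by `D`, and `v` by `(1-s)/q`, costs `O(X^(2k))`. -/
lemma exists_abs_axis_flow_le (hq : 2 ≤ q) (hβ : 0 ≤ β) (hs : s ∈ Set.Ico (0 : ℝ) 1) {k : ℕ}
    (hk : 2 ≤ k) (h0 : ∀ j < 2 * k, 0 < j → lineDeriv p q β h j s = 0) :
    ∃ C, 0 ≤ C ∧ ∀ t ∈ stdSimplex ℝ (Fin q),
      |(q - 1) * (t 0 * Real.exp (β * p *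
        (((1 - s) / q + axisCoord q s t) ^ (p - 1) - t 0 ^ (p - 1)) - h) -
          ((1 - s) / q + axisCoord q s t)) +
        2 * k * (-(q ^ (2 * k) * lineDeriv p q β h (2 * k) s / (2 * k).factorial)) *
          ((1 - s) / q) * axisCoord q s t ^ (2 * k - 1)| ≤ C * axisCoord q s t ^ (2 * k) := by
  have hq1 : (2 : ℝ) ≤ q := by exact_mod_cast hq
  have hq2 : (0 : ℝ) < (q : ℝ) - 1 := by linarith
  have hq3 : (0 : ℝ) < q := by linarith
  obtain ⟨n, hn⟩ : ∃ n, 2 * k = n + 1 := ⟨2 * k - 1, by omega⟩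
  have hodd : Odd n := by
    rw [← Nat.not_even_iff_odd]; intro he
    have := he.add_one; rw [← hn] at this
    exact (Nat.not_odd_iff_even.2 (even_two_mul k)) this
  have hev : Even (n + 1) := hodd.add_one
  have hnk : 2 * (k : ℝ) = n + 1 := by exact_mod_cast hn
  rw [show 2 * k - 1 = n by omega]
  rw [hn] at h0 ⊢
  rw [hnk]
  set l := lineDeriv p q β h (n + 1) s with hl
  set c := -(q ^ (n + 1) * l / ((n + 1).factorial : ℝ)) with hc
  set m := (1 - s) / (q : ℝ) with hm
  have hm0 : 0 < m := (eventually_line_pos (q := q) hs).self_of_nhds.2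
  obtain ⟨ρ, M, hρ, hM⟩ := exists_line_nhds (q := q) p β h hs (n + 2)
  have hM0 : 0 ≤ M := (abs_nonneg _).trans (hM 0 (by simpa using hρ)).2
  set A := (n + 1) * c with hA
  set B := q * M * q ^ (n + 1) with hB
  have hB0 : 0 ≤ B := by positivity
  set K := (|A| + B) / (q - 1) with hK
  have hK0 : 0 ≤ K := by positivity
  -- the logarithmic flow near the maximizer
  have hnear : ∀ t : Fin q → ℝ, |q * axisCoord q s t| < ρ →
      |(q - 1) * (-(q / (q - 1) * lineDeriv p q β h 1 (s + -(q * axisCoord q s t)))) +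
        A * axisCoord q s t ^ n| ≤ B * axisCoord q s t ^ (n + 1) := by
    intro t ht
    set X := axisCoord q s t with hX
    have h1 := abs_taylor_chain_le (F := fun j τ => lineDeriv p q β h (j + 1) (s + τ)) (M := M)
      (n := n) (fun j _ τ hτ => hasDerivAt_lineDeriv_add (j + 1) (hM τ hτ).1)
      (fun τ hτ => (hM τ hτ).2) (fun j hj => by
        simp only [add_zero]; exact h0 (j + 1) (by omega) (by omega))
      (τ := -(q * X)) (by rwa [abs_neg])
    simp only [add_zero, zero_add, ← hl] at h1
    rw [abs_neg, hev.pow_abs, hodd.neg_pow, mul_pow, mul_pow] at h1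
    have hfac : ((n + 1).factorial : ℝ) = (n + 1) * n.factorial := by
      rw [Nat.factorial_succ]; push_cast; ring
    have hfn : (0 : ℝ) < n.factorial := by positivity
    have e : (q - 1) * (-(q / (q - 1) * lineDeriv p q β h 1 (s + -(q * X)))) + A * X ^ n =
        -q * (lineDeriv p q β h 1 (s + -(q * X)) - l / n.factorial * -(q ^ n * X ^ n)) := by
      rw [hA, hc, hfac]
      field_simp
      ring
    rw [e, abs_mul, abs_neg, abs_of_pos hq3, hB]
    calc _ ≤ (q : ℝ) * (M * (q ^ (n + 1) * X ^ (n + 1))) := by gcongr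
      _ = _ := by ring
  -- The first bound keeps the axis point in the Taylor neighborhood and the second ensures `|D| ≤
  -- 1`. For `|X| ≥ ρ'` everything is bounded and `X^(2k)` is bounded below.
  set ρ' := min (ρ / q) (1 / (K + 1)) with hρ'
  have hρ'0 : 0 < ρ' := by positivity
  set E := Real.exp (β * p + |h|) with hE
  have hE0 : 0 ≤ E := (Real.exp_pos _).le
  refine ⟨max (B + |A| + (q - 1) * K ^ 2) (((q - 1) * (E + 1) + |A| * m) / ρ' ^ (n + 1)),
    le_max_of_le_left (by positivity), fun t ht => ?_⟩
  have hv := mean_mem_Icc hq s ht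
  have hX1 := abs_axisCoord_le_one hq hs ht
  have ha := mem_Icc_of_mem_stdSimplex ht 0
  rw [← hm] at hv
  rcases lt_or_ge |axisCoord q s t| ρ' with hlt | hge
  · have hqX : |q * axisCoord q s t| < ρ := by
      rw [abs_mul, abs_of_pos hq3]
      have := (lt_div_iff₀ hq3).1 (hlt.trans_le (min_le_left _ _))
      linarith
    have hpos := (hM (-(q * axisCoord q s t)) (by rwa [abs_neg])).1
    obtain ⟨e0, e1⟩ := line_coords hq s t
    rw [e0, e1] at hpos
    have h1 := hnear t hqX
    rw [axis_flow_eq hq hpos.1 hpos.2]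
    set D := -(q / (q - 1) * lineDeriv p q β h 1 (s + -(q * axisCoord q s t))) with hD
    set X := axisCoord q s t with hX
    have hXn : |X| ^ (n + 1) = X ^ (n + 1) := hev.pow_abs X
    have hXn0 : 0 ≤ X ^ (n + 1) := hev.pow_nonneg X
    have hXsq : (|X| ^ n) ^ 2 ≤ X ^ (n + 1) := by
      rw [← hXn, ← pow_mul]
      exact pow_le_pow_of_le_one (abs_nonneg _) hX1 (by omega)
    have hDn : |D| ≤ K * |X| ^ n := by
      have h2 : |(q - 1) * D| ≤ (|A| + B) * |X| ^ n := by
        have h3 : X ^ (n + 1) ≤ |X| ^ n := by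
          rw [← hXn, pow_succ]; exact mul_le_of_le_one_right (by positivity) hX1
        have h4 : |(q - 1) * D| ≤ |(q - 1) * D + A * X ^ n| + |A * X ^ n| := by
          have := abs_sub ((q - 1) * D + A * X ^ n) (A * X ^ n)
          rwa [add_sub_cancel_right] at this
        rw [abs_mul A, abs_pow] at h4
        have h5 : B * X ^ (n + 1) ≤ B * |X| ^ n := by gcongr
        linarith
      rw [abs_mul, abs_of_pos hq2] at h2
      rw [hK, div_mul_eq_mul_div, le_div_iff₀ hq2]
      linarith
    have hD1 : |D| ≤ 1 := by
      refine hDn.trans ?_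
      have h2 : |X| ^ n ≤ |X| := pow_le_of_le_one (abs_nonneg _) hX1 (by omega)
      have h3 := (lt_div_iff₀ (by linarith : 0 < K + 1)).1 (hlt.trans_le (min_le_right _ _))
      have h4 : K * |X| ^ n ≤ K * |X| := by gcongr
      linarith [abs_nonneg X]
    have hexp := Real.abs_exp_sub_one_sub_id_le hD1
    have hD2 : D ^ 2 ≤ K ^ 2 * X ^ (n + 1) := by
      rw [← sq_abs]
      calc |D| ^ 2 ≤ (K * |X| ^ n) ^ 2 := by gcongr
        _ = K ^ 2 * (|X| ^ n) ^ 2 := by ring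
        _ ≤ _ := by gcongr
    have e : (q - 1) * ((m + X) * Real.exp D - (m + X)) + A * m * X ^ n =
        (m + X) * ((q - 1) * D + A * X ^ n) - A * X ^ (n + 1) +
          (q - 1) * (m + X) * (Real.exp D - 1 - D) := by ring
    rw [e]
    have t1 : |(m + X) * ((q - 1) * D + A * X ^ n)| ≤ B * X ^ (n + 1) := by
      rw [abs_mul, abs_of_nonneg hv.1]
      exact (mul_le_of_le_one_left (abs_nonneg _) hv.2).trans h1
    have t2 : |A * X ^ (n + 1)| = |A| * X ^ (n + 1) := by rw [abs_mul, abs_of_nonneg hXn0]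
    have t3 : |(q - 1) * (m + X) * (Real.exp D - 1 - D)| ≤ (q - 1) * K ^ 2 * X ^ (n + 1) := by
      rw [abs_mul, abs_mul, abs_of_pos hq2, abs_of_nonneg hv.1]
      calc ((q : ℝ) - 1) * (m + X) * |Real.exp D - 1 - D| ≤ (q - 1) * 1 * (K ^ 2 * X ^ (n + 1)) := by
            gcongr
            · exact hv.2
            · exact hexp.trans hD2
        _ = _ := by ring
    calc _ ≤ |(m + X) * ((q - 1) * D + A * X ^ n)| + |A * X ^ (n + 1)| +
          |(q - 1) * (m + X) * (Real.exp D - 1 - D)| :=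
        (abs_add_le _ _).trans (add_le_add (abs_sub _ _) le_rfl)
      _ ≤ (B + |A| + (q - 1) * K ^ 2) * X ^ (n + 1) := by rw [t2]; linarith
      _ ≤ _ := by gcongr; exact le_max_left _ _
  · set X := axisCoord q s t with hX
    have hXn : |X| ^ (n + 1) = X ^ (n + 1) := hev.pow_abs X
    have hexp : Real.exp (β * p * ((m + X) ^ (p - 1) - t 0 ^ (p - 1)) - h) ≤ E :=
      Real.exp_le_exp.2 (exponent_le hβ ha hv)
    set e := Real.exp (β * p * ((m + X) ^ (p - 1) - t 0 ^ (p - 1)) - h) with he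
    have he0 : 0 < e := Real.exp_pos _
    have t1 : |t 0 * e - (m + X)| ≤ E + 1 := by
      have h1 : t 0 * e ≤ E := (mul_le_of_le_one_left he0.le ha.2).trans hexp
      have h2 : 0 ≤ t 0 * e := mul_nonneg ha.1 he0.le
      rw [abs_le]; constructor <;> linarith [hv.1, hv.2]
    have t2 : |A * m * X ^ n| ≤ |A| * m := by
      rw [abs_mul, abs_mul, abs_of_pos hm0, abs_pow]
      exact mul_le_of_le_one_right (by positivity) (pow_le_one₀ (abs_nonneg _) hX1)
    have t3 : ρ' ^ (n + 1) ≤ X ^ (n + 1) := by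
      rw [← hXn]; gcongr
    calc _ ≤ (q - 1) * (E + 1) + |A| * m := by
          refine (abs_add_le _ _).trans (add_le_add ?_ t2)
          rw [abs_mul, abs_of_pos hq2]
          gcongr
      _ = ((q - 1) * (E + 1) + |A| * m) / ρ' ^ (n + 1) * ρ' ^ (n + 1) :=
          (div_mul_cancel₀ _ (by positivity)).symm
      _ ≤ ((q - 1) * (E + 1) + |A| * m) / ρ' ^ (n + 1) * X ^ (n + 1) := by gcongr
      _ ≤ _ := by
          have : 0 ≤ X ^ (n + 1) := hev.pow_nonneg X
          gcongr; exact le_max_right _ _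

lemma exists_drift_bound (hq : 2 ≤ q) (hβ : 0 ≤ β) (hs : s ∈ Set.Ico (0 : ℝ) 1) {k : ℕ}
    (hk : 2 ≤ k) (h0 : ∀ j < 2 * k, 0 < j → lineDeriv p q β h j s = 0) :
    ∃ C, ∀ t ∈ stdSimplex ℝ (Fin q),
      |drift p q β h t +
        2 * k * (-(q ^ (2 * k) * lineDeriv p q β h (2 * k) s / (2 * k).factorial)) *
          ((1 - s) / q) * axisCoord q s t ^ (2 * k - 1)| ≤
        C * (axisCoord q s t ^ (2 * k) + transverseSq q t) := by
  obtain ⟨C₁, hC₁, h1⟩ := exists_abs_drift_sub_le (p := p) (h := h) hq hβ s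
  obtain ⟨C₂, hC₂, h2⟩ := exists_abs_axis_flow_le hq hβ hs hk h0
  refine ⟨C₁ + C₂, fun t ht => ?_⟩
  have hX : 0 ≤ axisCoord q s t ^ (2 * k) := (even_two_mul k).pow_nonneg _
  have hY := transverseSq_nonneg t
  have h3 := abs_add_le _ _ |>.trans (add_le_add (h1 t ht) (h2 t ht))
  rw [← add_assoc, sub_add_cancel] at h3
  refine h3.trans ?_
  nlinarith [mul_nonneg hC₁ hX, mul_nonneg hC₂ hY]

end Drift

/-! ### Which parameters are degenerate to fifth order -/

section CriticalExponents

/-- Here `n = p - 2`, `κ = (q-1) m₁ / m₀`, and `a`, `b` are `β p (p-1) m^(p-1)` at `m₀` and `m₁`.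
Orders 2, 3, 4 determine `b`, `n κ a` and `n κ`. Order 5 then reduces to `1 - κ` times a positive
factor. -/
lemma critical_ratio_eq {n κ a b : ℝ} (hn : 0 ≤ n) (hκ : 0 < κ)
    (h2 : κ * (a - 1) + (b - 1) = 0) (h3 : κ ^ 2 * (n * a + 1) - (n * b + 1) = 0)
    (h4 : κ ^ 3 * (n * (n - 1) * a - 2) + (n * (n - 1) * b - 2) = 0)
    (h5 : κ ^ 4 * (n * (n - 1) * (n - 2) * a + 6) - (n * (n - 1) * (n - 2) * b + 6) = 0) :
    κ = 1 ∧ n = 2 ∧ a = 1 ∧ b = 1 := by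
  have hb : b = 1 + κ - κ * a := by linarith
  subst hb
  have e1 : n * (κ * a) = n + 1 - κ := by
    have : (1 + κ) * (n * (κ * a) - (n + 1 - κ)) = 0 := by linear_combination h3
    have := (mul_eq_zero.1 this).resolve_left (by linarith)
    linarith
  have e2 : n * κ = 1 + κ ^ 2 := by
    have : (1 + κ) * (n + 1) * (n * κ - (1 + κ ^ 2)) = 0 := by
      linear_combination h4 - (n - 1) * (κ ^ 2 - 1) * e1
    have := (mul_eq_zero.1 this).resolve_left (mul_ne_zero (by linarith) (by linarith))
    linarith
  have e3 : κ = 1 := by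
    have h : (1 - κ) * ((1 + κ) * (κ * ((n + 1) * (n + 2)))) = 0 := by
      linear_combination -h5 + (n - 1) * (n - 2) * (κ ^ 3 + 1) * e1 +
        (1 - κ ^ 2) * (6 - (n - 1) * (n - 2)) * e2
    have := (mul_eq_zero.1 h).resolve_right (by positivity)
    linarith
  subst e3
  have e4 : n = 2 := by linarith
  subst e4
  have e5 : a = 1 := by linarith
  subst e5
  norm_num

variable {p q : ℕ} {β h s : ℝ}

lemma siteDeriv_mul_pow (hp : 1 ≤ p) (j : ℕ) {x : ℝ} (hx : 0 < x) :
    siteDeriv p β (j + 2) x * x ^ (j + 1) =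
      β * p.descFactorial (j + 2) * x ^ (p - 1) + (-1) ^ (j + 1) * j.factorial := by
  obtain ⟨n, rfl⟩ := Nat.exists_eq_add_of_le' hp
  simp only [siteDeriv, Nat.add_sub_cancel]
  field_simp
  ring

/-- Multiplying by powers of the coordinates makes the entropy terms constants, so the equations
become polynomial in `κ`, `a`, `b` and `p`. -/
lemma ratio_relation_of_lineDeriv_eq_zero (hq : 2 ≤ q) (j : ℕ)
    (h0 : 0 < (1 + ((q : ℝ) - 1) * s) / q) (h1 : lineDeriv p q β h (j + 2) s = 0) :
    (((q : ℝ) - 1) * ((1 - s) / q) / ((1 + ((q : ℝ) - 1) * s) / q)) ^ (j + 1) *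
        (siteDeriv p β (j + 2) ((1 + ((q : ℝ) - 1) * s) / q) *
          ((1 + ((q : ℝ) - 1) * s) / q) ^ (j + 1)) +
      (-1) ^ j * (siteDeriv p β (j + 2) ((1 - s) / q) * ((1 - s) / q) ^ (j + 1)) = 0 := by
  have hq1 : (2 : ℝ) ≤ q := by exact_mod_cast hq
  have hq2 : (q : ℝ) - 1 ≠ 0 := by linarith
  have hq3 : (q : ℝ) ≠ 0 := by linarith
  simp only [lineDeriv, if_false, mul_zero, add_zero,
    show j + 2 ≠ 0 by omega, show j + 2 ≠ 1 by omega] at h1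
  set m₀ := (1 + ((q : ℝ) - 1) * s) / q
  set m₁ := (1 - s) / (q : ℝ)
  set S₀ := siteDeriv p β (j + 2) m₀
  set S₁ := siteDeriv p β (j + 2) m₁
  have h2 : ((q : ℝ) - 1) ^ (j + 1) * S₀ + (-1) ^ j * S₁ = 0 := by
    have e : (((q : ℝ) - 1) / q) ^ (j + 2) * S₀ + (q - 1) * ((-1 / q) ^ (j + 2) * S₁) =
        (q - 1) / q ^ (j + 2) * ((q - 1) ^ (j + 1) * S₀ + (-1) ^ j * S₁) := by
      rw [div_pow, div_pow]
      field_simp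
      ring
    rw [e] at h1
    exact (mul_eq_zero.1 h1).resolve_left (div_ne_zero hq2 (pow_ne_zero _ hq3))
  rw [div_pow, mul_pow]
  have h3 : m₀ ^ (j + 1) ≠ 0 := (pow_pos h0 _).ne'
  field_simp
  linear_combination m₁ ^ (j + 1) * h2

/-- The second to fifth derivatives along the axis vanish only in the four-tensor Ising case. -/
lemma degenerate_parameters (hp : 2 ≤ p) (hq : 2 ≤ q) (hs : s ∈ Set.Ico (0 : ℝ) 1)
    (h2 : lineDeriv p q β h 2 s = 0) (h3 : lineDeriv p q β h 3 s = 0)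
    (h4 : lineDeriv p q β h 4 s = 0) (h5 : lineDeriv p q β h 5 s = 0) :
    p = 4 ∧ q = 2 ∧ s = 0 ∧ β = 2 / 3 := by
  have hq1 : (2 : ℝ) ≤ q := by exact_mod_cast hq
  have hq0 : (0 : ℝ) < q := by linarith
  have : NeZero q := ⟨by omega⟩
  obtain ⟨hm0, hm1⟩ := (eventually_line_pos (q := q) hs).self_of_nhds
  have r2 := ratio_relation_of_lineDeriv_eq_zero hq 0 hm0 h2
  have r3 := ratio_relation_of_lineDeriv_eq_zero hq 1 hm0 h3
  have r4 := ratio_relation_of_lineDeriv_eq_zero hq 2 hm0 h4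
  have r5 := ratio_relation_of_lineDeriv_eq_zero hq 3 hm0 h5
  rw [siteDeriv_mul_pow (by omega) _ hm0, siteDeriv_mul_pow (by omega) _ hm1] at r2 r3 r4 r5
  set m₀ := (1 + ((q : ℝ) - 1) * s) / q with hm₀
  set m₁ := (1 - s) / (q : ℝ) with hm₁
  have hκ : 0 < ((q : ℝ) - 1) * m₁ / m₀ := div_pos (mul_pos (by linarith) hm1) hm0
  set κ := ((q : ℝ) - 1) * m₁ / m₀ with hκd
  have hn : (0 : ℝ) ≤ p - 2 := by
    have : (2 : ℝ) ≤ p := by exact_mod_cast hp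
    linarith
  simp only [cast_descFactorial_succ, Nat.descFactorial_zero, Nat.factorial] at r2 r3 r4 r5
  push_cast at r2 r3 r4 r5
  obtain ⟨hκ1, hn2, ha, hb⟩ := critical_ratio_eq (a := β * p * (p - 1) * m₀ ^ (p - 1))
    (b := β * p * (p - 1) * m₁ ^ (p - 1)) hn hκ (by linear_combination r2)
    (by linear_combination r3) (by linear_combination r4) (by linear_combination r5)
  have hp4 : p = 4 := by
    have : (p : ℝ) = 4 := by linarith
    exact_mod_cast this
  subst hp4
  have hβ : β * (4 : ℕ) * ((4 : ℕ) - 1) ≠ 0 := left_ne_zero_of_mul (ha.trans_ne one_ne_zero)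
  have hmm : m₀ = m₁ := by
    have := mul_left_cancel₀ hβ (ha.trans hb.symm)
    exact (pow_left_inj₀ hm0.le hm1.le (by norm_num)).1 this
  have hq2 : q = 2 := by
    rw [hκd, hmm, mul_div_cancel_right₀ _ hm1.ne'] at hκ1
    have : (q : ℝ) = 2 := by linarith
    exact_mod_cast this
  subst hq2
  have hs0 : s = 0 := by
    rw [hm₀, hm₁] at hmm
    push_cast at hmm
    linarith
  refine ⟨rfl, rfl, hs0, ?_⟩
  rw [hm₁, hs0] at hb
  norm_num at hb
  linarith

lemma lineDeriv_six_degenerate : lineDeriv 4 2 (2 / 3) h 6 0 = -24 := by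
  simp [lineDeriv, siteDeriv, Nat.descFactorial, Nat.factorial]
  norm_num

end CriticalExponents

/-! ### Special points and the two types -/

section Special
variable {p q : ℕ} [NeZero q] {β h s : ℝ}

lemma xvec_injective (hq : 2 ≤ q) : Function.Injective (xvec q) := by
  intro s s' hss
  have hq1 : (2 : ℝ) ≤ q := by exact_mod_cast hq
  have hq2 : (q : ℝ) - 1 ≠ 0 := by linarith
  have hq3 : (q : ℝ) ≠ 0 := by linarith
  have := congrFun hss 0
  simp only [xvec, if_true] at this
  rw [div_left_inj' hq3, add_right_inj] at this
  exact mul_left_cancel₀ hq2 this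

lemma exists_nonGaussian_limit_mle_of_special (hp : 2 ≤ p) (hq : 2 ≤ q)
    (hsp : IsSpecial p q β h) (hs : s ∈ Set.Ico (0 : ℝ) 1)
    (hmax : IsGlobalMaximizer p q β h (xvec q s)) {k : ℕ} (hk : 2 ≤ k)
    (h0 : ∀ j < 2 * k, 0 < j → lineDeriv p q β h j s = 0)
    (hneg : lineDeriv p q β h (2 * k) s < 0) {c : ℝ}
    (hc : c = -(q ^ (2 * k) * lineDeriv p q β h (2 * k) s / (2 * k).factorial))
    {hhat : (N : ℕ) → (Fin N → Fin q) → ℝ}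
    (hML : ∀ (N : ℕ) (x : Fin N → Fin q), (∃ h' : ℝ, IsMLE p q β N x h') →
      IsMLE p q β N x (hhat N x)) :
    ∃ (G : Measure ℝ) (_ : IsProbabilityMeasure G),
      (∀ t : ℝ, G.real (Set.Iic t) =
        (evenLaw c k).real (Set.Iic (-∫ u, u ∂(volume.tilted fun x =>
          -(c * x ^ (2 * k)) + (1 - q) * t * x)))) ∧
      (∀ (a : ℝ) (v : NNReal), G ≠ gaussianReal a v) ∧
      TendstoInDistribution
        (fun (N : ℕ) (x : Fin N → Fin q) => (N : ℝ) ^ (1 - (2 * k : ℝ)⁻¹) * (hhat N x - h))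
        atTop (fun y : ℝ => y) (fun N => pottsMeasure p q β h N) G := by
  obtain ⟨hβ, -, m, hm, huniq, hsing⟩ := hsp
  obtain rfl : m = xvec q s := (huniq _ hmax).symm
  obtain ⟨-, htr⟩ := singular_consequences hp hq hβ hs hmax hsing
  have hq0 : (0 : ℝ) < q := by exact_mod_cast (by omega : 0 < q)
  have hc0 : 0 < c := by
    rw [hc, neg_pos]
    exact div_neg_of_neg_of_pos (mul_neg_of_pos_of_neg (by positivity) hneg) (by positivity)
  obtain ⟨c', hc', hcoer⟩ :=
    exists_coercive hq hs hmax huniq (by omega) (even_two_mul k) h0 hneg htr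
  obtain ⟨C, hC⟩ := exists_drift_bound hq hβ.le hs hk h0
  rw [← hc] at hC
  exact exists_nonGaussian_limit_mle hq hs hc0 hk
    (fun g g' hg hgg hgg' => tendsto_pottsMean_fluct hq hβ.le hs hk hc0 hc' hcoer hC hg hgg hgg') hML

lemma line_vanish_of_special (hp : 2 ≤ p) (hq : 2 ≤ q) (hsp : IsSpecial p q β h)
    (hs : s ∈ Set.Ico (0 : ℝ) 1) (hmax : IsGlobalMaximizer p q β h (xvec q s)) :
    ∀ j < 4, 0 < j → lineDeriv p q β h j s = 0 := by
  obtain ⟨hβ, -, m, hm, huniq, hsing⟩ := hsp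
  obtain rfl : m = xvec q s := (huniq _ hmax).symm
  obtain ⟨h2, -⟩ := singular_consequences hp hq hβ hs hmax hsing
  have h1 : lineDeriv p q β h 1 s = 0 :=
    lineDeriv_eq_zero_of_odd hs hmax odd_one fun j h1 h2 => by omega
  have h12 : ∀ j < 3, 0 < j → lineDeriv p q β h j s = 0 := by
    intro j hj hj'
    obtain rfl | rfl : j = 1 ∨ j = 2 := by omega
    exacts [h1, h2]
  intro j hj hj'
  rcases Nat.lt_or_ge j 3 with h | h
  · exact h12 j h hj'
  · obtain rfl : j = 3 := by omega
    exact lineDeriv_eq_zero_of_odd hs hmax (by decide) h12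

lemma quarticLaw_eq (p q : ℕ) [NeZero q] (β h s t : ℝ) :
    quarticLaw p q β h s 0 t = volume.tilted fun x =>
      -(-(q ^ 4 * iteratedDeriv 4 (fline p q β h) s / 24) * x ^ 4) + (1 - q) * t * x := by
  rw [quarticLaw]
  congr 1
  funext x
  ring

lemma sexticLaw_eq (t : ℝ) :
    sexticLaw t = volume.tilted fun x => -(32 / 15 * x ^ 6) + (1 - (2 : ℕ)) * t * x := by
  rw [sexticLaw]
  congr 1
  funext x
  push_cast
  ring

end Special
end TensorPotts
end

theorem theorem3p2 (p q : ℕ) [NeZero q] (hp : 2 ≤ p) (hq : 2 ≤ q) (β h : ℝ)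
    (hhat : (N : ℕ) → (Fin N → Fin q) → ℝ)
    (hML : ∀ (N : ℕ) (x : Fin N → Fin q), (∃ h' : ℝ, TensorPotts.IsMLE p q β N x h') →
      TensorPotts.IsMLE p q β N x (hhat N x)) :
    (TensorPotts.IsTypeISpecial p q β h →
      ∀ s ∈ Set.Ico (0 : ℝ) 1, TensorPotts.IsGlobalMaximizer p q β h (TensorPotts.xvec q s) →
        ∃ (G : Measure ℝ) (_ : IsProbabilityMeasure G),
          (∀ t : ℝ, G.real (Set.Iic t) =
            (TensorPotts.quarticLaw p q β h s 0 0).real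
              (Set.Iic (-∫ u, u ∂(TensorPotts.quarticLaw p q β h s 0 t)))) ∧
          (∀ (a : ℝ) (v : NNReal), G ≠ gaussianReal a v) ∧
          TendstoInDistribution
            (fun (N : ℕ) (x : Fin N → Fin q) => (N : ℝ) ^ (3 / 4 : ℝ) * (hhat N x - h))
            atTop (fun y : ℝ => y) (fun N => TensorPotts.pottsMeasure p q β h N) G) ∧
    (TensorPotts.IsTypeIISpecial p q β h →
      ∃ (G : Measure ℝ) (_ : IsProbabilityMeasure G),
        (∀ t : ℝ, G.real (Set.Iic t) =
          (TensorPotts.sexticLaw 0).real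
            (Set.Iic (-∫ u, u ∂(TensorPotts.sexticLaw t)))) ∧
        (∀ (a : ℝ) (v : NNReal), G ≠ gaussianReal a v) ∧
        TendstoInDistribution
          (fun (N : ℕ) (x : Fin N → Fin q) => (N : ℝ) ^ (5 / 6 : ℝ) * (hhat N x - h))
          atTop (fun y : ℝ => y) (fun N => TensorPotts.pottsMeasure p q β h N) G) := by
  open TensorPotts in
  constructor
  · rintro ⟨hsp, s', hs', hmax', h4⟩ s hs hmax
    obtain ⟨-, -, m, -, huniq, -⟩ := id hsp
    -- The sign of the fourth derivative is given at `s'`; uniqueness of the maximizer carries it to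
    -- the prescribed `s`.
    obtain rfl : s = s' := xvec_injective hq ((huniq _ hmax).trans (huniq _ hmax').symm)
    have e4 : iteratedDeriv 4 (fline p q β h) s = lineDeriv p q β h 4 s :=
      iteratedDeriv_fline 4 s (eventually_line_pos hs).self_of_nhds
    obtain ⟨G, hGp, hG, hne, hlim⟩ := exists_nonGaussian_limit_mle_of_special (k := 2) hp hq hsp hs
      hmax le_rfl (line_vanish_of_special hp hq hsp hs hmax) (e4 ▸ h4)
      (c := -(q ^ 4 * iteratedDeriv 4 (fline p q β h) s / 24))
      (by rw [e4]; norm_num [Nat.factorial]) hML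
    refine ⟨G, hGp, fun t => ?_, hne, ?_⟩
    · rw [hG t, quarticLaw_eq, quarticLaw_eq]
      simp [evenLaw]
    · norm_num at hlim
      exact hlim
  · rintro ⟨hsp, s, hs, hmax, h4⟩
    have e4 : iteratedDeriv 4 (fline p q β h) s = lineDeriv p q β h 4 s :=
      iteratedDeriv_fline 4 s (eventually_line_pos hs).self_of_nhds
    rw [e4] at h4
    have h123 := line_vanish_of_special hp hq hsp hs hmax
    have h1234 : ∀ j < 5, 0 < j → lineDeriv p q β h j s = 0 := by
      intro j hj hj'
      rcases Nat.lt_or_ge j 4 with hlt | hge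
      · exact h123 j hlt hj'
      · obtain rfl : j = 4 := by omega
        exact h4
    have h5 : lineDeriv p q β h 5 s = 0 := lineDeriv_eq_zero_of_odd hs hmax (by decide) h1234
    have h12345 : ∀ j < 2 * 3, 0 < j → lineDeriv p q β h j s = 0 := by
      intro j hj hj'
      rcases Nat.lt_or_ge j 5 with hlt | hge
      · exact h1234 j hlt hj'
      · obtain rfl : j = 5 := by omega
        exact h5
    obtain ⟨rfl, rfl, rfl, rfl⟩ := degenerate_parameters hp hq hs (h1234 2 (by norm_num) (by norm_num))
      (h1234 3 (by norm_num) (by norm_num)) h4 h5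
    -- The source of the constant in the limit law: `c = 2^6 * 24 / 6! = 32/15`.
    have h6 : lineDeriv 4 2 (2 / 3) h (2 * 3) 0 = -24 := lineDeriv_six_degenerate
    obtain ⟨G, hGp, hG, hne, hlim⟩ := exists_nonGaussian_limit_mle_of_special (k := 3) hp hq hsp hs
      hmax (by norm_num) h12345 (by rw [h6]; norm_num) (c := 32 / 15)
      (by rw [h6]; norm_num [Nat.factorial]) hML
    refine ⟨G, hGp, fun t => ?_, hne, ?_⟩
    · rw [hG t, sexticLaw_eq, sexticLaw_eq]
      simp [evenLaw]
    · norm_num at hlim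
      exact hlim
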